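/- **Setting.** Let $\mathbb{T}^3=\mathbb{R}^3/\mathbb{Z}^3$ and $T>0$. For $p,q\in[1,\infty]$ let $\|f\|_{L^p(0,T;L^q)}=\big\|\,\|f(\cdot,t)\|_{L^q(\mathbb{T}^3)}\big\|_{L^p(0,T)}$. A pair $(v,\Pi)$ is a *weak solution* of the incompressible Euler equations on $[0,T]\times\mathbb{T}^3$ if $v\in C_{\mathrm{weak}}([0,T];L^2(\mathbb{T}^3))$, $\Pi\in L^1([0,T]\times\mathbb{T}^3)$, for every $\varphi\in C^\infty([0,T]\times\mathbb{T}^3)^3$ $$\int_{\mathbb{T}^3}\big[v(x,T)\cdot\varphi(x,T)-v(x,0)\cdot\varphi(x,0)\big]dx=\int_0^T\!\!\int_{\mathbb{T}^3}\big[v\cdot\partial_t\varphi+v\otimes v:\nabla\varphi+\Pi\,\mathrm{div}\,\varphi\big]dx\,dt,$$ and $\int_0^T\int_{\mathbb{T}^3}v\cdot\nabla\psi\,dx\,dt=0$ for every $\psi\in C^\infty([0,T]\times\mathbb{T}^3)$. For $0<s<1$ and $p,q\in[1,\infty]$ we use the following classes. * $f\in L^p(0,T;B^s_{q,\infty})$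 if $f\in L^p(0,T;L^q)$ and $t\mapsto\sup_{z\ne0}|z|^{-s}\|f(\cdot+z,t)-f(\cdot,t)\|_{L^q(\mathbb{T}^3)}$ belongs to $L^p(0,T)$. * $f\in L^p(0,T;B^s_{q,c(\mathbb{N})})$ if $f\in L^p(0,T;L^q)$ and $\lim_{z\to0}|z|^{-s}\|f(\cdot+z,\cdot)-f\|_{L^p(0,T;L^q)}=0$. * (for $p,q<\infty$) $f\in L^p(0,T;\underline{B}^s_{q,VMO})$ if $f\in L^p(0,T;L^q)$ and $$\lim_{\varepsilon\to0^+}\frac1{\varepsilon^{s}}\Big(\int_0^T\Big[\int_{\mathbb{T}^3}\frac1{|B_\varepsilon(0)|}\int_{B_\varepsilon(0)}|f(x,t)-f(x-y,t)|^q\,dy\,dx\Big]^{p/q}dt\Big)^{1/p}=0 .$$ **Theorem.** Let $(v,\Pi)$ be a weak solution of the incompressible Euler equations on $[0,T]\times\mathbb{T}^3$, and suppose that its vorticity $\omega=\mathrm{curl}\,v$ (in the sense of distributions) satisfies $\omega\in C([0,T];L^{3/2}(\mathbb{T}^3))$. Suppose that at least one of the following conditions holds: 1. $v\in L^p\big(0,T;B^{2/p}_{\frac{2p}{p-1},c(\mathbb{N})}\big)$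 for some $2<p\le3$; 2. $v\in L^p\big(0,T;\underline{B}^{2/p}_{\frac{2p}{p-1},VMO}\big)$ for some $2<p\le3$; 3. $\nabla v\in L^p\big(0,T;L^{\frac{6p}{5p-7}}(\mathbb{T}^3)\big)$ for some $2<p\le3$ (with $\nabla v$ in the sense of distributions); 4. $v\in L^k(0,T;B^\alpha_{\ell,c(\mathbb{N})})$ and $\omega\in L^p(0,T;B^\beta_{q,\infty})$, 5. $v\in L^k(0,T;B^\alpha_{\ell,\infty})$ and $\omega\in L^p(0,T;B^\beta_{q,c(\mathbb{N})})$, where in 4 and 5, for some $0<\theta\le2$, $\alpha,\beta\in(0,1)$ and $k,\ell,p,q\in[1,\infty]$, $$\frac\theta k+\frac1p=1,\qquad \frac\theta\ell+\frac1q=\frac\theta2,\qquad \theta\alpha+\beta\ge1 .$$ Then the helicity is conserved: for every $t\in[0,T]$ the function $\omega(\cdot,t)\cdot v(\cdot,t)$ is integrable on $\mathbb{T}^3$ and $$\int_{\mathbb{T}^3}\omega(x,t)\cdot v(x,t)\,dx=\int_{\mathbb{T}^3}\omega(x,0)\cdot v(x,0)\,dx .$$ -/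

import Mathlib

open MeasureTheory Filter Topology Set
open scoped ENNReal

noncomputable section

namespace EulerTorus

/-- Euclidean space `ℝ³` with the Euclidean norm. -/
abbrev E3 : Type := EuclideanSpace ℝ (Fin 3)

/-- The periodic domain `𝕋³ = ℝ³ / ℤ³`, with its Lebesgue measure `volume` of total mass one. -/
abbrev T3 : Type := UnitAddTorus (Fin 3)

/-- The projection `ℝ³ → 𝕋³`. -/
def toTorus (x : E3) : T3 := fun i => ((x i : ℝ) : UnitAddCircle)

section Calculus

variable {F : Type*} [NormedAddCommGroup F] [NormedSpace ℝ F]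

/-- A function on the torus is smooth when its periodic lift to `ℝ³` is. -/
def SmoothOnTorus (f : T3 → F) : Prop :=
  ContDiff ℝ ((⊤ : ℕ∞) : WithTop ℕ∞) (fun x : E3 => f (toTorus x))

/-- A time-dependent function on the torus is smooth when its periodic lift to `ℝ × ℝ³` is;
the restrictions to `[0, T] × 𝕋³` of such functions are the smooth functions on `[0, T] × 𝕋³`,
which is compact. -/
def SmoothSpaceTime (f : ℝ → T3 → F) : Prop :=
  ContDiff ℝ ((⊤ : ℕ∞) : WithTop ℕ∞) (fun z : ℝ × E3 => f z.1 (toTorus z.2))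

/-- The classical partial derivative `∂ᵢ f (x)` on the torus. -/
def pderiv (i : Fin 3) (f : T3 → F) (x : T3) : F :=
  deriv (fun s : ℝ => f (x + toTorus (EuclideanSpace.single i s))) 0

end Calculus

/-- The classical divergence `∑ᵢ ∂ᵢ φᵢ`. -/
def divergence (φ : T3 → E3) (x : T3) : ℝ :=
  ∑ i, pderiv i (fun y => φ y i) x

/-- The classical curl (the coordinates of `ℝ³` are indexed by `0, 1, 2`). -/
def curl (φ : T3 → E3) (x : T3) : E3 :=
  !₂[pderiv 1 (fun y => φ y 2) x - pderiv 2 (fun y => φ y 1) x,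
     pderiv 2 (fun y => φ y 0) x - pderiv 0 (fun y => φ y 2) x,
     pderiv 0 (fun y => φ y 1) x - pderiv 1 (fun y => φ y 0) x]

/-- `w` is the curl of `u` in the sense of distributions on `𝕋³`. -/
def IsWeakCurl (u w : T3 → E3) : Prop :=
  Integrable u ∧ Integrable w ∧
    ∀ ψ : T3 → E3, SmoothOnTorus ψ →
      ∫ x, inner ℝ (w x) (ψ x) = ∫ x, inner ℝ (u x) (curl ψ x)

/-- `g` is the partial derivative `∂ⱼ u` in the sense of distributions on `𝕋³`. -/
def IsWeakPartial (j : Fin 3) (u g : T3 → E3) : Prop :=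
  Integrable u ∧ Integrable g ∧
    ∀ ψ : T3 → ℝ, SmoothOnTorus ψ →
      ∫ x, ψ x • g x = - ∫ x, pderiv j ψ x • u x

/-- `(v, Π)` is a weak solution of the incompressible Euler equations on `[0, T] × 𝕋³`;
its initial datum is `v 0`. -/
structure IsWeakEulerSolution (T : ℝ) (v : ℝ → T3 → E3) (P : ℝ → T3 → ℝ) : Prop where
  measurable : AEStronglyMeasurable (fun z : ℝ × T3 => v z.1 z.2)
    ((volume.restrict (Icc 0 T)).prod volume)
  memLp_two : ∀ t ∈ Icc 0 T, MemLp (v t) 2 volume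
  weak_continuous : ∀ g : T3 → E3, MemLp g 2 volume →
    ContinuousOn (fun t => ∫ x, inner ℝ (v t x) (g x)) (Icc 0 T)
  pressure_integrable : Integrable (fun z : ℝ × T3 => P z.1 z.2)
    ((volume.restrict (Icc 0 T)).prod volume)
  momentum : ∀ φ : ℝ → T3 → E3, SmoothSpaceTime φ →
    ∫ x, (inner ℝ (v T x) (φ T x) - inner ℝ (v 0 x) (φ 0 x)) =
      ∫ t in (0 : ℝ)..T, ∫ x,
        (inner ℝ (v t x) (deriv (fun s => φ s x) t)
          + ∑ i, ∑ j, v t x i * v t x j * pderiv j (fun y => φ t y i) x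
          + P t x * divergence (φ t) x)
  div_free : ∀ ψ : ℝ → T3 → ℝ, SmoothSpaceTime ψ →
    ∫ t in (0 : ℝ)..T, ∫ x, ∑ i, v t x i * pderiv i (ψ t) x = 0

/-- `f ∈ C([0, T]; L^q(𝕋³))`, for the strong topology of `L^q`. -/
def ContinuousInLq (T : ℝ) (q : ℝ≥0∞) (f : ℝ → T3 → E3) : Prop :=
  (∀ t ∈ Icc 0 T, MemLp (f t) q volume) ∧
    ∀ t₀ ∈ Icc 0 T,
      Tendsto (fun t => eLpNorm (fun x => f t x - f t₀ x) q volume) (𝓝[Icc 0 T] t₀) (𝓝 0)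

/-- The `L^p(0, T)` norm of an `[0, ∞]`-valued function of time. -/
def timeNorm (T : ℝ) (p : ℝ≥0∞) (N : ℝ → ℝ≥0∞) : ℝ≥0∞ :=
  eLpNorm N p (volume.restrict (Ioo 0 T))

/-- `f ∈ L^p(0, T; L^q(𝕋³))`. -/
def MemLpLq (T : ℝ) (p q : ℝ≥0∞) (f : ℝ → T3 → E3) : Prop :=
  AEStronglyMeasurable (fun z : ℝ × T3 => f z.1 z.2) ((volume.restrict (Ioo 0 T)).prod volume) ∧
    timeNorm T p (fun t => eLpNorm (f t) q volume) < ⊤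

/-- The `L^q(𝕋³)` norm of the increment `f (· + z) - f`. -/
def incrNorm (q : ℝ≥0∞) (f : T3 → E3) (z : E3) : ℝ≥0∞ :=
  eLpNorm (fun x => f (x + toTorus z) - f x) q volume

/-- The seminorm of `B^s_{q,∞}(𝕋³)`, `0 < s < 1`, in its finite difference form. -/
def besovSeminorm (s : ℝ) (q : ℝ≥0∞) (f : T3 → E3) : ℝ≥0∞ :=
  ⨆ (z : E3) (_ : z ≠ 0), incrNorm q f z / ENNReal.ofReal (‖z‖ ^ s)

/-- `f ∈ L^p(0, T; B^s_{q,∞}(𝕋³))`, `0 < s < 1`. -/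
def MemLpBesovInfty (T : ℝ) (p : ℝ≥0∞) (s : ℝ) (q : ℝ≥0∞) (f : ℝ → T3 → E3) : Prop :=
  MemLpLq T p q f ∧ timeNorm T p (fun t => besovSeminorm s q (f t)) < ⊤

/-- `f ∈ L^p(0, T; B^s_{q,c(ℕ)}(𝕋³))`, `0 < s < 1`: the function is in `L^p(0, T; L^q)`, and its
increments are `o(|z|^s)` in `L^p(0, T; L^q)`. -/
def MemLpBesovC (T : ℝ) (p : ℝ≥0∞) (s : ℝ) (q : ℝ≥0∞) (f : ℝ → T3 → E3) : Prop :=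
  MemLpLq T p q f ∧
    Tendsto (fun z : E3 => timeNorm T p (fun t => incrNorm q (f t) z) / ENNReal.ofReal (‖z‖ ^ s))
      (𝓝[≠] 0) (𝓝 0)

/-- The averaged increment
`(∫_{𝕋³} ⨍_{B_ε(0)} |f(x) - f(x - y)|^q dy dx)^{1/q}`, with Euclidean balls. -/
def avgIncr (q ε : ℝ) (f : T3 → E3) : ℝ≥0∞ :=
  (∫⁻ x, ⨍⁻ y in Metric.ball (0 : E3) ε, ‖f x - f (x - toTorus y)‖ₑ ^ q ∂volume ∂volume) ^ (1 / q)

/-- `f` is in the Besov-VMO space `L^p(0, T; B^s_{q,VMO}(𝕋³))`. -/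
def MemLpBesovVMO (T p s q : ℝ) (f : ℝ → T3 → E3) : Prop :=
  MemLpLq T (ENNReal.ofReal p) (ENNReal.ofReal q) f ∧
    Tendsto (fun ε : ℝ => timeNorm T (ENNReal.ofReal p) (fun t => avgIncr q ε (f t))
        / ENNReal.ofReal (ε ^ s))
      (𝓝[>] 0) (𝓝 0)

/-- `∇f ∈ L^p(0, T; L^q(𝕋³))`, the gradient being taken in the sense of distributions. -/
def GradMemLpLq (T : ℝ) (p q : ℝ≥0∞) (f : ℝ → T3 → E3) : Prop :=
  ∃ g : Fin 3 → ℝ → T3 → E3, ∀ j,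
    (∀ᵐ t ∂(volume.restrict (Ioo 0 T)), IsWeakPartial j (f t) (g j t)) ∧ MemLpLq T p q (g j)

end EulerTorus

end

noncomputable section

namespace EulerTorus

/-! ### The projection `ℝ³ → 𝕋³` -/

theorem toTorus_add (x y : E3) : toTorus (x + y) = toTorus x + toTorus y := by
  ext i; simp [toTorus]

@[simp] theorem toTorus_zero : toTorus 0 = 0 := by
  ext i; simp [toTorus]

theorem toTorus_neg (x : E3) : toTorus (-x) = -toTorus x := by
  ext i; simp [toTorus]

theorem toTorus_sub (x y : E3) : toTorus (x - y) = toTorus x - toTorus y := by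
  ext i; simp [toTorus]

theorem isOpenQuotientMap_toTorus : IsOpenQuotientMap toTorus := by
  have h : IsOpenQuotientMap (Pi.map fun (_ : Fin 3) (r : ℝ) => (r : UnitAddCircle)) :=
    IsOpenQuotientMap.piMap fun _ => QuotientAddGroup.isOpenQuotientMap_mk
  exact h.comp (EuclideanSpace.equiv (Fin 3) ℝ).toHomeomorph.isOpenQuotientMap

theorem surjective_toTorus : Function.Surjective toTorus := isOpenQuotientMap_toTorus.surjective

@[fun_prop] theorem continuous_toTorus : Continuous toTorus := isOpenQuotientMap_toTorus.continuous

@[fun_prop] theorem measurable_toTorus : Measurable toTorus := continuous_toTorus.measurable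

theorem continuous_of_lift {X : Type*} [TopologicalSpace X] {f : T3 → X}
    (hf : Continuous fun x : E3 => f (toTorus x)) : Continuous f :=
  isOpenQuotientMap_toTorus.isQuotientMap.continuous_iff.2 hf

instance isProbabilityMeasure_volume_T3 : IsProbabilityMeasure (volume : Measure T3) := by
  have : IsProbabilityMeasure (volume : Measure UnitAddCircle) := ⟨by simp⟩
  rw [volume_pi]
  infer_instance

/-- The half-open unit cube with corner `a`. -/
def cube (a : Fin 3 → ℝ) : Set E3 := {y | ∀ i, y i ∈ Ioc (a i) (a i + 1)}

theorem measurePreserving_toTorus (a : Fin 3 → ℝ) :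
    MeasurePreserving toTorus (volume.restrict (cube a)) volume := by
  have h1 : MeasurePreserving (fun (y : Fin 3 → ℝ) i => ((y i : ℝ) : UnitAddCircle))
      (volume.restrict (univ.pi fun i => Ioc (a i) (a i + 1))) volume := by
    have := measurePreserving_pi _ _ (fun i => UnitAddCircle.measurePreserving_mk (a i))
    rwa [volume_pi, Measure.restrict_pi_pi, volume_pi]
  have h2 := (EuclideanSpace.volume_preserving_symm_measurableEquiv_toLp (Fin 3)).restrict_preimage
    (s := univ.pi fun i => Ioc (a i) (a i + 1)) (MeasurableSet.univ_pi fun i => measurableSet_Ioc)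
  have h3 : (MeasurableEquiv.toLp 2 (Fin 3 → ℝ)).symm ⁻¹' (univ.pi fun i => Ioc (a i) (a i + 1))
      = cube a := by
    ext y; simp [cube]
  rw [h3] at h2
  exact h1.comp h2

theorem lintegral_cube {f : T3 → ℝ≥0∞} (hf : AEMeasurable f) (a : Fin 3 → ℝ) :
    ∫⁻ y in cube a, f (toTorus y) = ∫⁻ x, f x := by
  rw [← (measurePreserving_toTorus a).map_eq, lintegral_map' ?_ (by fun_prop)]
  rwa [(measurePreserving_toTorus a).map_eq]

theorem iUnion_cube : ⋃ n : Fin 3 → ℤ, cube (fun i => (n i : ℝ)) = univ := by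
  refine eq_univ_of_forall fun y => mem_iUnion.2 ⟨fun i => ⌈y i⌉ - 1, fun i => ?_⟩
  have := Int.ceil_lt_add_one (y i)
  have := Int.le_ceil (y i)
  simp only [Int.cast_sub, Int.cast_one, mem_Ioc]
  constructor <;> linarith

theorem quasiMeasurePreserving_toTorus :
    Measure.QuasiMeasurePreserving toTorus volume volume := by
  refine ⟨by fun_prop, ?_⟩
  refine Measure.AbsolutelyContinuous.mk fun s hs h0 => ?_
  rw [Measure.map_apply (by fun_prop) hs, ← inter_univ (toTorus ⁻¹' s), ← iUnion_cube,
    inter_iUnion]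
  refine measure_iUnion_null fun n => ?_
  rw [← Measure.restrict_apply (measurable_toTorus hs),
    (measurePreserving_toTorus _).measure_preimage hs.nullMeasurableSet, h0]

theorem measurePreserving_add_right_T3 (a : T3) :
    MeasurePreserving (fun x : T3 => x + a) volume volume := measurePreserving_add_right _ a

theorem measurePreserving_sub_right_T3 (a : T3) :
    MeasurePreserving (fun x : T3 => x - a) volume volume := by
  simpa only [sub_eq_add_neg] using measurePreserving_add_right (volume : Measure T3) (-a)

theorem measurePreserving_sub_left_E3 (x : E3) :
    MeasurePreserving (fun y : E3 => x - y) volume volume :=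
  Measure.measurePreserving_sub_left volume x

theorem quasiMeasurePreserving_sub_toTorus (x : T3) :
    Measure.QuasiMeasurePreserving (fun y : E3 => x - toTorus y) volume volume := by
  obtain ⟨x, rfl⟩ := surjective_toTorus x
  have := quasiMeasurePreserving_toTorus.comp
    (measurePreserving_sub_left_E3 x).quasiMeasurePreserving
  simpa only [Function.comp_def, toTorus_sub] using this

theorem quasiMeasurePreserving_sub_toTorus_prod :
    Measure.QuasiMeasurePreserving (fun z : T3 × E3 => z.1 - toTorus z.2)
      ((volume : Measure T3).prod volume) volume :=
  QuasiMeasurePreserving.prod_of_right (by fun_prop)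
    (Eventually.of_forall fun x => quasiMeasurePreserving_sub_toTorus x)

theorem lintegral_ball_toTorus_le_of_le_half {f : T3 → ℝ≥0∞} (hf : AEMeasurable f) {R : ℝ}
    (hR : R ≤ 1 / 2) (x : E3) :
    ∫⁻ y in Metric.ball x R, f (toTorus y) ≤ ∫⁻ z, f z := by
  rw [← lintegral_cube hf (fun i => x i - 1 / 2)]
  refine lintegral_mono_set fun y hy i => ?_
  have h1 : |y i - x i| < 1 / 2 :=
    lt_of_le_of_lt (by simpa using PiLp.norm_apply_le (y - x) i) ((mem_ball_iff_norm.1 hy).trans_le hR)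
  rw [abs_lt] at h1
  constructor <;> linarith [h1.1, h1.2]

theorem lintegral_ball_toTorus_le {f : T3 → ℝ≥0∞} (hf : AEMeasurable f) {R : ℝ} {m : ℕ}
    (hR : R ≤ m) (x : E3) :
    ∫⁻ y in Metric.ball x R, f (toTorus y) ≤ (2 * m) ^ 3 * ∫⁻ z, f z := by
  have hsub : Metric.ball x R ⊆ ⋃ n : Fin 3 → Fin (2 * m),
      cube (fun i => x i - m + (n i : ℕ)) := by
    intro y hy
    have h1 : ∀ i, |y i - x i| < m := fun i =>
      lt_of_le_of_lt (by simpa using PiLp.norm_apply_le (y - x) i)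
        ((mem_ball_iff_norm.1 hy).trans_le hR)
    have h2 : ∀ i, ∃ k : Fin (2 * m), y i ∈ Ioc (x i - m + (k : ℕ)) (x i - m + (k : ℕ) + 1) := by
      intro i
      have h3 := abs_lt.1 (h1 i)
      obtain ⟨j, hj⟩ : ∃ j : ℕ, ⌈y i - x i + m⌉ = (j : ℤ) + 1 := by
        have : 0 < ⌈y i - x i + m⌉ := Int.ceil_pos.2 (by linarith)
        exact ⟨(⌈y i - x i + m⌉ - 1).toNat, by omega⟩
      have h4 := Int.ceil_lt_add_one (y i - x i + m)
      have h5 := Int.le_ceil (y i - x i + m)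
      rw [hj] at h4 h5
      push_cast at h4 h5
      have h6 : (j : ℝ) < (2 * m : ℕ) := by push_cast; linarith
      refine ⟨⟨j, by exact_mod_cast h6⟩, ?_, ?_⟩ <;> simp only <;> linarith
    choose k hk using h2
    exact mem_iUnion.2 ⟨k, hk⟩
  calc ∫⁻ y in Metric.ball x R, f (toTorus y)
      ≤ ∫⁻ y in ⋃ n : Fin 3 → Fin (2 * m), cube (fun i => x i - m + (n i : ℕ)),
          f (toTorus y) := lintegral_mono_set hsub
    _ ≤ ∑' n : Fin 3 → Fin (2 * m), ∫⁻ y in cube (fun i => x i - m + (n i : ℕ)),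
          f (toTorus y) := lintegral_iUnion_le _ _
    _ = (2 * m) ^ 3 * ∫⁻ z, f z := by
        simp_rw [lintegral_cube hf]
        rw [tsum_fintype]
        simp

theorem setLIntegral_ball_sub_toTorus (f : T3 → ℝ≥0∞) (x : E3) (R : ℝ) :
    ∫⁻ y in Metric.ball 0 R, f (toTorus x - toTorus y)
      = ∫⁻ y in Metric.ball x R, f (toTorus y) := by
  have h := (measurePreserving_sub_left_E3 x).setLIntegral_comp_preimage_emb
    (Homeomorph.subLeft x).measurableEmbedding (fun y => f (toTorus y)) (Metric.ball x R)
  rw [← h]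
  have : (fun y => x - y) ⁻¹' Metric.ball x R = Metric.ball 0 R := by
    ext y; simp
  rw [this]
  simp only [toTorus_sub]

theorem lintegral_ball_sub_toTorus_le_of_le_half {f : T3 → ℝ≥0∞} (hf : AEMeasurable f) {R : ℝ}
    (hR : R ≤ 1 / 2) (x : T3) :
    ∫⁻ y in Metric.ball 0 R, f (x - toTorus y) ≤ ∫⁻ z, f z := by
  obtain ⟨x, rfl⟩ := surjective_toTorus x
  rw [setLIntegral_ball_sub_toTorus]
  exact lintegral_ball_toTorus_le_of_le_half hf hR x

theorem integrableOn_ball_lift {F : Type*} [NormedAddCommGroup F] {f : T3 → F}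
    (hf : Integrable f) (x : E3) (R : ℝ) :
    IntegrableOn (fun y => f (toTorus y)) (Metric.ball x R) := by
  refine ⟨(hf.1.comp_quasiMeasurePreserving quasiMeasurePreserving_toTorus).restrict, ?_⟩
  obtain ⟨m, hm⟩ := exists_nat_ge R
  refine (lintegral_ball_toTorus_le hf.1.enorm hm x).trans_lt ?_
  exact ENNReal.mul_lt_top (by finiteness) hf.2

theorem locallyIntegrable_lift {F : Type*} [NormedAddCommGroup F] {f : T3 → F}
    (hf : Integrable f) : LocallyIntegrable (fun y => f (toTorus y)) := fun x =>
  ⟨Metric.ball x 1, Metric.ball_mem_nhds x one_pos, integrableOn_ball_lift hf x 1⟩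

/-! ### Calculus of smooth functions on the torus -/

/-- The `j`-th standard basis vector of `ℝ³`. -/
abbrev basisVec (j : Fin 3) : E3 := EuclideanSpace.single j 1

theorem single_eq_smul (j : Fin 3) (s : ℝ) :
    (EuclideanSpace.single j s : E3) = s • basisVec j := by
  ext i
  by_cases h : i = j <;> simp [h]

theorem two_le_smooth : (2 : WithTop ℕ∞) ≤ ((⊤ : ℕ∞) : WithTop ℕ∞) :=
  WithTop.coe_le_coe.2 (le_top : (2 : ℕ∞) ≤ ⊤)

theorem toTorus_single_zero (j : Fin 3) : toTorus (EuclideanSpace.single j (0 : ℝ)) = 0 := by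
  rw [single_eq_smul, zero_smul, toTorus_zero]

theorem memLp_of_continuous {F : Type*} [NormedAddCommGroup F] {f : T3 → F}
    (hf : Continuous f) (p : ℝ≥0∞) : MemLp f p volume := by
  obtain ⟨C, hC⟩ := isCompact_univ.exists_bound_of_continuousOn hf.continuousOn
  exact MemLp.of_bound hf.aestronglyMeasurable C
    (Eventually.of_forall fun x => hC x trivial)

theorem integrable_of_continuous {F : Type*} [NormedAddCommGroup F] {f : T3 → F}
    (hf : Continuous f) : Integrable f :=
  memLp_one_iff_integrable.1 (memLp_of_continuous hf 1)

section General

variable {F : Type*} [NormedAddCommGroup F] [NormedSpace ℝ F] {f g : T3 → F}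

theorem SmoothOnTorus.differentiable (hf : SmoothOnTorus f) :
    Differentiable ℝ (fun x : E3 => f (toTorus x)) :=
  ContDiff.differentiable hf (by simp)

theorem SmoothOnTorus.continuous (hf : SmoothOnTorus f) : Continuous f :=
  continuous_of_lift (ContDiff.continuous hf)

theorem SmoothOnTorus.hasDerivAt_line (hf : SmoothOnTorus f) (j : Fin 3) (x : E3) (s : ℝ) :
    HasDerivAt (fun s : ℝ => f (toTorus x + toTorus (EuclideanSpace.single j s)))
      (fderiv ℝ (fun x : E3 => f (toTorus x)) (x + s • basisVec j) (basisVec j)) s := by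
  have h1 : HasDerivAt (fun s : ℝ => x + s • basisVec j) (basisVec j) s := by
    simpa using ((hasDerivAt_id s).smul_const (basisVec j)).const_add x
  have h2 := (hf.differentiable (x + s • basisVec j)).hasFDerivAt.comp_hasDerivAt s h1
  have h3 : (fun s : ℝ => f (toTorus x + toTorus (EuclideanSpace.single j s)))
      = fun s => f (toTorus (x + s • basisVec j)) := by
    ext s
    rw [single_eq_smul, toTorus_add]
  rw [h3]
  exact h2

theorem SmoothOnTorus.pderiv_toTorus (hf : SmoothOnTorus f) (j : Fin 3) (x : E3) :
    pderiv j f (toTorus x) = fderiv ℝ (fun x : E3 => f (toTorus x)) x (basisVec j) := by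
  have h := (hf.hasDerivAt_line j x 0).deriv
  rwa [zero_smul, add_zero] at h

theorem SmoothOnTorus.hasDerivAt_pderiv (hf : SmoothOnTorus f) (j : Fin 3) (x : T3) (s : ℝ) :
    HasDerivAt (fun s : ℝ => f (x + toTorus (EuclideanSpace.single j s)))
      (pderiv j f (x + toTorus (EuclideanSpace.single j s))) s := by
  obtain ⟨x, rfl⟩ := surjective_toTorus x
  rw [single_eq_smul, ← toTorus_add, hf.pderiv_toTorus]
  exact hf.hasDerivAt_line j x s

theorem SmoothOnTorus.hasDerivAt_pderiv_zero (hf : SmoothOnTorus f) (j : Fin 3) (x : T3) :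
    HasDerivAt (fun s : ℝ => f (x + toTorus (EuclideanSpace.single j s)))
      (EulerTorus.pderiv j f x) 0 := by
  have h := hf.hasDerivAt_pderiv j x 0
  rwa [toTorus_single_zero, add_zero] at h

theorem SmoothOnTorus.pderiv (hf : SmoothOnTorus f) (j : Fin 3) :
    SmoothOnTorus (pderiv j f) := by
  have : (fun x : E3 => EulerTorus.pderiv j f (toTorus x))
      = fun x => fderiv ℝ (fun x : E3 => f (toTorus x)) x (basisVec j) :=
    funext fun x => hf.pderiv_toTorus j x
  rw [SmoothOnTorus, this]
  exact (ContDiff.fderiv_right hf (by simp)).clm_apply contDiff_const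

theorem SmoothOnTorus.sub (hf : SmoothOnTorus f) (hg : SmoothOnTorus g) :
    SmoothOnTorus (fun x => f x - g x) := ContDiff.sub hf hg

theorem SmoothOnTorus.mul {c d : T3 → ℝ} (hc : SmoothOnTorus c) (hd : SmoothOnTorus d) :
    SmoothOnTorus (fun x => c x * d x) := ContDiff.mul hc hd

theorem SmoothOnTorus.sum {ι : Type*} (s : Finset ι) {f : ι → T3 → F}
    (hf : ∀ i ∈ s, SmoothOnTorus (f i)) : SmoothOnTorus (fun x => ∑ i ∈ s, f i x) :=
  ContDiff.sum hf

theorem SmoothOnTorus.clm {G : Type*} [NormedAddCommGroup G] [NormedSpace ℝ G] (L : F →L[ℝ] G)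
    (hf : SmoothOnTorus f) : SmoothOnTorus (fun x => L (f x)) := L.contDiff.comp hf

theorem SmoothOnTorus.pderiv_clm {G : Type*} [NormedAddCommGroup G] [NormedSpace ℝ G]
    (L : F →L[ℝ] G) (hf : SmoothOnTorus f) (j : Fin 3) (x : T3) :
    EulerTorus.pderiv j (fun x => L (f x)) x = L (EulerTorus.pderiv j f x) := by
  exact (L.hasFDerivAt.comp_hasDerivAt (0 : ℝ) (hf.hasDerivAt_pderiv_zero j x)).deriv

theorem SmoothOnTorus.pderiv_sub (hf : SmoothOnTorus f) (hg : SmoothOnTorus g) (j : Fin 3)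
    (x : T3) : EulerTorus.pderiv j (fun x => f x - g x) x
      = EulerTorus.pderiv j f x - EulerTorus.pderiv j g x := by
  exact ((hf.hasDerivAt_pderiv_zero j x).sub (hg.hasDerivAt_pderiv_zero j x)).deriv

theorem SmoothOnTorus.pderiv_mul {f g : T3 → ℝ} (hf : SmoothOnTorus f) (hg : SmoothOnTorus g)
    (j : Fin 3) (x : T3) : EulerTorus.pderiv j (fun x => f x * g x) x
      = EulerTorus.pderiv j f x * g x + f x * EulerTorus.pderiv j g x := by
  have h := ((hf.hasDerivAt_pderiv_zero j x).mul (hg.hasDerivAt_pderiv_zero j x)).deriv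
  rwa [toTorus_single_zero, add_zero] at h

theorem SmoothOnTorus.pderiv_comm (hf : SmoothOnTorus f) (i j : Fin 3) (x : T3) :
    EulerTorus.pderiv i (EulerTorus.pderiv j f) x
      = EulerTorus.pderiv j (EulerTorus.pderiv i f) x := by
  obtain ⟨x, rfl⟩ := surjective_toTorus x
  have key : ∀ a b : Fin 3, EulerTorus.pderiv a (EulerTorus.pderiv b f) (toTorus x)
      = fderiv ℝ (fderiv ℝ (fun x : E3 => f (toTorus x))) x (basisVec a) (basisVec b) := by
    intro a b
    rw [(hf.pderiv b).pderiv_toTorus a]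
    simp_rw [hf.pderiv_toTorus b]
    rw [fderiv_clm_apply]
    · simp
    · exact ((ContDiff.fderiv_right (m := 1) hf
        (one_add_one_eq_two (R := WithTop ℕ∞) ▸ two_le_smooth)).differentiable one_ne_zero) x
    · fun_prop
  rw [key, key]
  refine (ContDiffAt.isSymmSndFDerivAt (ContDiff.contDiffAt hf) ?_) _ _
  simpa using two_le_smooth

theorem SmoothOnTorus.integrable (hf : SmoothOnTorus f) : Integrable f :=
  integrable_of_continuous hf.continuous

theorem SmoothOnTorus.integral_pderiv (hf : SmoothOnTorus f) (j : Fin 3) :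
    ∫ x, EulerTorus.pderiv j f x = 0 := by
  obtain ⟨C, hC⟩ := isCompact_univ.exists_bound_of_continuousOn
    (hf.pderiv j).continuous.continuousOn
  have h := (hasDerivAt_integral_of_dominated_loc_of_deriv_le (μ := (volume : Measure T3))
    (F := fun (s : ℝ) x => f (x + toTorus (EuclideanSpace.single j s)))
    (F' := fun (s : ℝ) x => EulerTorus.pderiv j f (x + toTorus (EuclideanSpace.single j s)))
    (x₀ := (0 : ℝ)) (bound := fun _ => C) (s := univ) univ_mem
    (Eventually.of_forall fun s =>
      (integrable_of_continuous (hf.continuous.comp (continuous_add_const _))).1)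
    (integrable_of_continuous (hf.continuous.comp (continuous_add_const _)))
    (integrable_of_continuous ((hf.pderiv j).continuous.comp (continuous_add_const _))).1
    (Eventually.of_forall fun x s _ => hC _ trivial) (integrable_const _)
    (Eventually.of_forall fun x s _ => hf.hasDerivAt_pderiv j x s)).2
  have h2 : (fun s : ℝ => ∫ x, f (x + toTorus (EuclideanSpace.single j s)))
      = fun _ => ∫ x, f x := by
    ext s
    exact integral_add_right_eq_self f _
  rw [h2] at h
  simpa only [toTorus_single_zero, add_zero] using h.unique (hasDerivAt_const _ _)

theorem SmoothOnTorus.integral_mul_pderiv {f g : T3 → ℝ} (hf : SmoothOnTorus f)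
    (hg : SmoothOnTorus g) (j : Fin 3) :
    ∫ x, f x * EulerTorus.pderiv j g x = -∫ x, EulerTorus.pderiv j f x * g x := by
  have h := (hf.mul hg).integral_pderiv j
  simp_rw [hf.pderiv_mul hg] at h
  rw [integral_add ((hf.pderiv j).mul hg).integrable (hf.mul (hg.pderiv j)).integrable] at h
  linarith

end General

theorem SmoothOnTorus.coord {φ : T3 → E3} (hφ : SmoothOnTorus φ) (i : Fin 3) :
    SmoothOnTorus (fun x => φ x i) :=
  hφ.clm (EuclideanSpace.proj i)

theorem SmoothOnTorus.pderiv_coord {φ : T3 → E3} (hφ : SmoothOnTorus φ) (i j : Fin 3) (x : T3) :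
    EulerTorus.pderiv j (fun x => φ x i) x = EulerTorus.pderiv j φ x i :=
  hφ.pderiv_clm (EuclideanSpace.proj i) j x

theorem smoothOnTorus_of_coord {φ : T3 → E3} (hφ : ∀ i, SmoothOnTorus (fun x => φ x i)) :
    SmoothOnTorus φ := contDiff_euclidean.2 hφ

theorem SmoothOnTorus.curl {φ : T3 → E3} (hφ : SmoothOnTorus φ) : SmoothOnTorus (curl φ) := by
  refine smoothOnTorus_of_coord fun i => ?_
  fin_cases i
  · exact ((hφ.coord 2).pderiv 1).sub ((hφ.coord 1).pderiv 2)
  · exact ((hφ.coord 0).pderiv 2).sub ((hφ.coord 2).pderiv 0)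
  · exact ((hφ.coord 1).pderiv 0).sub ((hφ.coord 0).pderiv 1)

theorem inner_E3 (a b : E3) : (inner ℝ a b : ℝ) = a 0 * b 0 + a 1 * b 1 + a 2 * b 2 := by
  simp [PiLp.inner_apply, Fin.sum_univ_three, mul_comm]

theorem divergence_curl {φ : T3 → E3} (hφ : SmoothOnTorus φ) (x : T3) :
    divergence (EulerTorus.curl φ) x = 0 := by
  have h0 : (fun y => EulerTorus.curl φ y 0) = fun y => pderiv 1 (fun y => φ y 2) y
      - pderiv 2 (fun y => φ y 1) y := rfl
  have h1 : (fun y => EulerTorus.curl φ y 1) = fun y => pderiv 2 (fun y => φ y 0) y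
      - pderiv 0 (fun y => φ y 2) y := rfl
  have h2 : (fun y => EulerTorus.curl φ y 2) = fun y => pderiv 0 (fun y => φ y 1) y
      - pderiv 1 (fun y => φ y 0) y := rfl
  have hs := fun i j => (hφ.coord i).pderiv j
  rw [divergence, Fin.sum_univ_three, h0, h1, h2, (hs 2 1).pderiv_sub (hs 1 2),
    (hs 0 2).pderiv_sub (hs 2 0), (hs 1 0).pderiv_sub (hs 0 1),
    (hφ.coord 2).pderiv_comm 0 1, (hφ.coord 1).pderiv_comm 0 2, (hφ.coord 0).pderiv_comm 1 2]
  ring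

/-! ### Convolution of functions on the torus with test functions on `ℝ³` -/

/-- Smooth compactly supported convolution kernels on `ℝ³`. -/
structure IsTestKernel (k : E3 → ℝ) : Prop where
  contDiff : ContDiff ℝ ((⊤ : ℕ∞) : WithTop ℕ∞) k
  hasCompactSupport : HasCompactSupport k

/-- The partial derivative of a kernel on `ℝ³`. -/
def kderiv (j : Fin 3) (k : E3 → ℝ) (y : E3) : ℝ := fderiv ℝ k y (basisVec j)

theorem IsTestKernel.kderiv {k : E3 → ℝ} (hk : IsTestKernel k) (j : Fin 3) :
    IsTestKernel (kderiv j k) :=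
  ⟨(ContDiff.fderiv_right hk.contDiff (by simp)).clm_apply contDiff_const,
    (hk.hasCompactSupport.fderiv ℝ).comp_left (g := fun L : E3 →L[ℝ] ℝ => L (basisVec j)) rfl⟩

theorem IsTestKernel.neg {k : E3 → ℝ} (hk : IsTestKernel k) : IsTestKernel (fun y => k (-y)) :=
  ⟨hk.contDiff.comp contDiff_neg, hk.hasCompactSupport.comp_homeomorph (Homeomorph.neg E3)⟩

theorem IsTestKernel.continuous {k : E3 → ℝ} (hk : IsTestKernel k) : Continuous k :=
  hk.contDiff.continuous

theorem IsTestKernel.integrable {k : E3 → ℝ} (hk : IsTestKernel k) : Integrable k :=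
  hk.continuous.integrable_of_hasCompactSupport hk.hasCompactSupport

section General

variable {F : Type*} [NormedAddCommGroup F] [NormedSpace ℝ F] {f g : T3 → F} {k : E3 → ℝ}

/-- The convolution of a function on the torus with a kernel on `ℝ³`. -/
def mollify (k : E3 → ℝ) (f : T3 → F) (x : T3) : F := ∫ y, k y • f (x - toTorus y)

theorem mollify_toTorus (k : E3 → ℝ) (f : T3 → F) (x : E3) :
    mollify k f (toTorus x) = convolution k (fun y => f (toTorus y))
      (ContinuousLinearMap.lsmul ℝ ℝ) volume x := by
  simp [mollify, convolution, toTorus_sub]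

theorem integrable_mollify_integrand (hk : IsTestKernel k) (hf : Integrable f) (x : T3) :
    Integrable (fun y => k y • f (x - toTorus y)) := by
  obtain ⟨x, rfl⟩ := surjective_toTorus x
  have := hk.hasCompactSupport.convolutionExists_left (ContinuousLinearMap.lsmul ℝ ℝ)
    hk.continuous (locallyIntegrable_lift hf) x
  simpa only [ConvolutionExistsAt, toTorus_sub, ContinuousLinearMap.lsmul_apply] using this

theorem smoothOnTorus_mollify [CompleteSpace F] (hk : IsTestKernel k) (hf : Integrable f) :
    SmoothOnTorus (mollify k f) := by
  rw [SmoothOnTorus]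
  simp_rw [mollify_toTorus]
  exact hk.hasCompactSupport.contDiff_convolution_left _ hk.contDiff (locallyIntegrable_lift hf)

theorem pderiv_mollify [CompleteSpace F] (hk : IsTestKernel k) (hf : Integrable f) (j : Fin 3)
    (x : T3) : pderiv j (mollify k f) x = mollify (kderiv j k) f x := by
  obtain ⟨x, rfl⟩ := surjective_toTorus x
  rw [(smoothOnTorus_mollify hk hf).pderiv_toTorus]
  simp_rw [mollify_toTorus]
  have hk1 : ContDiff ℝ 1 k := hk.contDiff.of_le (by exact_mod_cast le_top)
  rw [(hk.hasCompactSupport.hasFDerivAt_convolution_left (ContinuousLinearMap.lsmul ℝ ℝ)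
    hk1 (locallyIntegrable_lift hf) x).fderiv]
  have hi := (hk.hasCompactSupport.fderiv ℝ).convolutionExists_left
    ((ContinuousLinearMap.lsmul ℝ ℝ : ℝ →L[ℝ] F →L[ℝ] F).precompL E3)
    (hk1.continuous_fderiv one_ne_zero) (locallyIntegrable_lift hf) x
  rw [convolution, ContinuousLinearMap.integral_apply hi]
  simp [convolution, kderiv]

theorem mollify_add (hk : IsTestKernel k) (hf : Integrable f) (hg : Integrable g) (x : T3) :
    mollify k (fun x => f x + g x) x = mollify k f x + mollify k g x := by
  simp only [mollify, smul_add]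
  exact integral_add (integrable_mollify_integrand hk hf x) (integrable_mollify_integrand hk hg x)

theorem mollify_sub (hk : IsTestKernel k) (hf : Integrable f) (hg : Integrable g) (x : T3) :
    mollify k (fun x => f x - g x) x = mollify k f x - mollify k g x := by
  simp only [mollify, smul_sub]
  exact integral_sub (integrable_mollify_integrand hk hf x) (integrable_mollify_integrand hk hg x)

theorem mollify_clm [CompleteSpace F] {G : Type*} [NormedAddCommGroup G] [NormedSpace ℝ G]
    [CompleteSpace G] (L : F →L[ℝ] G) (hk : IsTestKernel k) (hf : Integrable f) (x : T3) :
    mollify k (fun x => L (f x)) x = L (mollify k f x) := by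
  simp only [mollify]
  rw [← L.integral_comp_comm (integrable_mollify_integrand hk hf x)]
  simp

theorem pderiv_mollify_eq_mollify_pderiv (hk : IsTestKernel k) (hf : SmoothOnTorus f)
    (j : Fin 3) (x : T3) : pderiv j (mollify k f) x = mollify k (pderiv j f) x := by
  obtain ⟨C, hC⟩ := isCompact_univ.exists_bound_of_continuousOn
    (hf.pderiv j).continuous.continuousOn
  have hs : ∀ (s : ℝ) y, x + toTorus (EuclideanSpace.single j s) - toTorus y
      = (x - toTorus y) + toTorus (EuclideanSpace.single j s) := fun s y => by abel
  have hd : ∀ (s : ℝ) y, HasDerivAt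
      (fun s : ℝ => f (x + toTorus (EuclideanSpace.single j s) - toTorus y))
      (pderiv j f (x + toTorus (EuclideanSpace.single j s) - toTorus y)) s := by
    intro s y
    simp_rw [hs]
    exact hf.hasDerivAt_pderiv j _ s
  have h := (hasDerivAt_integral_of_dominated_loc_of_deriv_le (μ := (volume : Measure E3))
    (F := fun (s : ℝ) y => k y • f (x + toTorus (EuclideanSpace.single j s) - toTorus y))
    (F' := fun (s : ℝ) y => k y • pderiv j f (x + toTorus (EuclideanSpace.single j s) - toTorus y))
    (x₀ := (0 : ℝ)) (bound := fun y => ‖k y‖ * C) (s := univ) univ_mem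
    (Eventually.of_forall fun s => (integrable_mollify_integrand hk hf.integrable _).1)
    (integrable_mollify_integrand hk hf.integrable _)
    (integrable_mollify_integrand hk (hf.pderiv j).integrable _).1
    (Eventually.of_forall fun y s _ => by
      rw [norm_smul]
      exact mul_le_mul_of_nonneg_left (hC _ trivial) (norm_nonneg _))
    (hk.integrable.norm.mul_const C)
    (Eventually.of_forall fun y s _ => (hd s y).const_smul (k y))).2
  simp only [toTorus_single_zero, add_zero] at h
  exact h.deriv

theorem enorm_mollify_le (k : E3 → ℝ) (f : T3 → F) (x : T3) :
    ‖mollify k f x‖ₑ ≤ ∫⁻ y, ‖k y‖ₑ * ‖f (x - toTorus y)‖ₑ := by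
  refine (enorm_integral_le_lintegral_enorm _).trans_eq ?_
  simp [enorm_smul]

end General

theorem aestronglyMeasurable_sub_toTorus {F : Type*} [TopologicalSpace F] {f : T3 → F}
    (hf : AEStronglyMeasurable f) :
    AEStronglyMeasurable (fun z : T3 × E3 => f (z.1 - toTorus z.2))
      ((volume : Measure T3).prod volume) :=
  hf.comp_quasiMeasurePreserving quasiMeasurePreserving_sub_toTorus_prod

section Inner

variable {F : Type*} [NormedAddCommGroup F] [InnerProductSpace ℝ F]
  {f g : T3 → F} {k : E3 → ℝ}

/-- Convolution with the reflected kernel is the adjoint of convolution with the kernel. -/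
theorem integral_inner_mollify [CompleteSpace F] (hk : IsTestKernel k) (hf : Integrable f) (hg : Continuous g) :
    ∫ x, (inner ℝ (mollify k f x) (g x) : ℝ)
      = ∫ x, (inner ℝ (f x) (mollify (fun y => k (-y)) g x) : ℝ) := by
  obtain ⟨C, hC⟩ := isCompact_univ.exists_bound_of_continuousOn hg.continuousOn
  have hgi := integrable_of_continuous hg
  have e1 : ∀ x, (inner ℝ (mollify k f x) (g x) : ℝ)
      = ∫ y, k y * inner ℝ (f (x - toTorus y)) (g x) := by
    intro x
    rw [mollify, real_inner_comm, ← integral_inner (integrable_mollify_integrand hk hf x)]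
    simp [inner_smul_right, real_inner_comm]
  have e2 : ∀ x, (inner ℝ (f x) (mollify (fun y => k (-y)) g x) : ℝ)
      = ∫ y, k y * inner ℝ (f x) (g (x + toTorus y)) := by
    intro x
    rw [mollify, ← integral_inner (integrable_mollify_integrand hk.neg hgi x),
      ← integral_neg_eq_self _ (volume : Measure E3)]
    simp [inner_smul_right, toTorus_neg]
  simp_rw [e1, e2]
  have hmeas : AEStronglyMeasurable
      (fun z : T3 × E3 => k z.2 * (inner ℝ (f (z.1 - toTorus z.2)) (g z.1) : ℝ))
      ((volume : Measure T3).prod volume) :=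
    (hk.continuous.comp continuous_snd).aestronglyMeasurable.mul
      ((aestronglyMeasurable_sub_toTorus hf.1).inner
        (hg.comp continuous_fst).aestronglyMeasurable)
  have hint : Integrable
      (fun z : T3 × E3 => k z.2 * (inner ℝ (f (z.1 - toTorus z.2)) (g z.1) : ℝ))
      ((volume : Measure T3).prod volume) := by
    refine ⟨hmeas, ?_⟩
    have hb : ∀ z : T3 × E3, ‖k z.2 * (inner ℝ (f (z.1 - toTorus z.2)) (g z.1) : ℝ)‖ₑ
        ≤ ‖k z.2‖ₑ * ‖f (z.1 - toTorus z.2)‖ₑ * ENNReal.ofReal C := by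
      intro z
      rw [enorm_mul, mul_assoc]
      gcongr
      have hC0 : 0 ≤ C := (norm_nonneg _).trans (hC 0 trivial)
      rw [← ofReal_norm, ← ofReal_norm, ← ENNReal.ofReal_mul (norm_nonneg _)]
      refine ENNReal.ofReal_le_ofReal ((norm_inner_le_norm _ _).trans ?_)
      gcongr
      exact hC _ trivial
    refine (lintegral_mono hb).trans_lt ?_
    rw [lintegral_mul_const' _ _ ENNReal.ofReal_ne_top, lintegral_prod_symm]
    · have : ∀ y : E3, ∫⁻ x : T3, ‖k y‖ₑ * ‖f (x - toTorus y)‖ₑ = ‖k y‖ₑ * ∫⁻ x, ‖f x‖ₑ := by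
        intro y
        rw [lintegral_const_mul' _ _ enorm_ne_top,
          lintegral_sub_right_eq_self (fun x => ‖f x‖ₑ)]
      simp_rw [this]
      rw [lintegral_mul_const' _ _ hf.2.ne]
      exact ENNReal.mul_lt_top (ENNReal.mul_lt_top hk.integrable.2 hf.2) ENNReal.ofReal_lt_top
    · exact ((hk.continuous.comp continuous_snd).aestronglyMeasurable (μ :=
        (volume : Measure T3).prod volume)).enorm.mul
        (aestronglyMeasurable_sub_toTorus hf.1).enorm
  rw [integral_integral_swap hint]
  have e3 : ∀ y : E3, ∫ x : T3, k y * (inner ℝ (f (x - toTorus y)) (g x) : ℝ)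
      = ∫ x : T3, k y * (inner ℝ (f x) (g (x + toTorus y)) : ℝ) := by
    intro y
    rw [← integral_add_right_eq_self _ (toTorus y)]
    simp
  simp_rw [e3]
  rw [integral_integral_swap]
  have hmp : MeasurePreserving (fun z : E3 × T3 => (z.2 + toTorus z.1, z.1))
      ((volume : Measure E3).prod (volume : Measure T3))
      ((volume : Measure T3).prod (volume : Measure E3)) := by
    have := MeasurePreserving.skew_product (μa := (volume : Measure E3))
      (μb := (volume : Measure E3)) (μc := (volume : Measure T3)) (μd := (volume : Measure T3))
      (f := id) (g := fun (y : E3) (x : T3) => x + toTorus y) (MeasurePreserving.id volume)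
      (by fun_prop)
      (Eventually.of_forall fun y => (measurePreserving_add_right_T3 (toTorus y)).map_eq)
    exact Measure.measurePreserving_swap.comp this
  have := hmp.integrable_comp_of_integrable hint
  simpa [Function.comp_def, Function.uncurry_def] using this

/-- Continuous functions are determined by their pairings with smooth functions, provided that
they are smooth themselves. -/
theorem eq_of_integral_inner_smooth (hf : SmoothOnTorus f) (hg : SmoothOnTorus g)
    (h : ∀ ψ : T3 → F, SmoothOnTorus ψ →
      ∫ x, (inner ℝ (f x) (ψ x) : ℝ) = ∫ x, (inner ℝ (g x) (ψ x) : ℝ)) : f = g := by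
  have hs := hf.sub hg
  have h1 := h _ hs
  have hc1 : Continuous fun x => (inner ℝ (f x) (f x - g x) : ℝ) := hf.continuous.inner hs.continuous
  have hc2 : Continuous fun x => (inner ℝ (g x) (f x - g x) : ℝ) := hg.continuous.inner hs.continuous
  have h2 : ∫ x, ‖f x - g x‖ ^ 2 = 0 := by
    rw [← sub_eq_zero, ← integral_sub (integrable_of_continuous hc1)
      (integrable_of_continuous hc2)] at h1
    simpa [← inner_sub_left] using h1
  have hc : Continuous fun x => ‖f x - g x‖ ^ 2 := (hs.continuous.norm).pow 2
  rw [integral_eq_zero_iff_of_nonneg (fun x => by positivity) (integrable_of_continuous hc)] at h2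
  have h3 := (Continuous.ae_eq_iff_eq volume hc continuous_const).1 h2
  ext x
  have h4 : ‖f x - g x‖ ^ 2 = 0 := congrFun h3 x
  simpa [sub_eq_zero] using h4

end Inner

/-! ### Mollification of weak derivatives -/

/-- The vector field `u` is divergence free in the sense of distributions. -/
def IsWeakDivFree (u : T3 → E3) : Prop :=
  ∀ ψ : T3 → ℝ, SmoothOnTorus ψ → ∫ x, ∑ i, u x i * pderiv i ψ x = 0

/-- The gradient of a function on the torus. -/
def grad (ψ : T3 → ℝ) (x : T3) : E3 := !₂[pderiv 0 ψ x, pderiv 1 ψ x, pderiv 2 ψ x]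

theorem grad_apply (ψ : T3 → ℝ) (x : T3) (i : Fin 3) : grad ψ x i = pderiv i ψ x := by
  fin_cases i <;> rfl

theorem SmoothOnTorus.grad {ψ : T3 → ℝ} (hψ : SmoothOnTorus ψ) : SmoothOnTorus (grad ψ) :=
  smoothOnTorus_of_coord fun i => by
    simp_rw [grad_apply]
    exact hψ.pderiv i

theorem inner_grad (a : E3) (ψ : T3 → ℝ) (x : T3) :
    (inner ℝ a (grad ψ x) : ℝ) = ∑ i, a i * pderiv i ψ x := by
  simp [inner_E3, Fin.sum_univ_three, grad_apply]

theorem curl_apply_zero (φ : T3 → E3) (x : T3) : curl φ x 0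
    = pderiv 1 (fun y => φ y 2) x - pderiv 2 (fun y => φ y 1) x := rfl

theorem curl_apply_one (φ : T3 → E3) (x : T3) : curl φ x 1
    = pderiv 2 (fun y => φ y 0) x - pderiv 0 (fun y => φ y 2) x := rfl

theorem curl_apply_two (φ : T3 → E3) (x : T3) : curl φ x 2
    = pderiv 0 (fun y => φ y 1) x - pderiv 1 (fun y => φ y 0) x := rfl

theorem integral_add_sub_three {a b c d e f : T3 → ℝ} (ha : Integrable a) (hb : Integrable b)
    (hc : Integrable c) (hd : Integrable d) (he : Integrable e) (hf : Integrable f) :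
    ∫ x, (a x - b x + (c x - d x) + (e x - f x))
      = (∫ x, a x) - (∫ x, b x) + ((∫ x, c x) - ∫ x, d x) + ((∫ x, e x) - ∫ x, f x) := by
  rw [integral_add (f := fun x => a x - b x + (c x - d x))
      (g := fun x => e x - f x) ((ha.sub hb).add (hc.sub hd)) (he.sub hf),
    integral_add (f := fun x => a x - b x) (g := fun x => c x - d x) (ha.sub hb) (hc.sub hd),
    integral_sub ha hb, integral_sub hc hd, integral_sub he hf]

theorem integral_mollify_mul {k : E3 → ℝ} {f g : T3 → ℝ} (hk : IsTestKernel k)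
    (hf : Integrable f) (hg : Continuous g) :
    ∫ x, mollify k f x * g x = ∫ x, f x * mollify (fun y => k (-y)) g x := by
  simpa [mul_comm] using integral_inner_mollify hk hf hg

theorem eq_of_integral_mul_smooth {f g : T3 → ℝ} (hf : SmoothOnTorus f) (hg : SmoothOnTorus g)
    (h : ∀ ψ : T3 → ℝ, SmoothOnTorus ψ → ∫ x, f x * ψ x = ∫ x, g x * ψ x) : f = g :=
  eq_of_integral_inner_smooth hf hg fun ψ hψ => by simpa [mul_comm] using h ψ hψ

theorem integral_inner_curl {φ ψ : T3 → E3} (hφ : SmoothOnTorus φ) (hψ : SmoothOnTorus ψ) :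
    ∫ x, (inner ℝ (curl φ x) (ψ x) : ℝ) = ∫ x, (inner ℝ (φ x) (curl ψ x) : ℝ) := by
  have ibp : ∀ i j l : Fin 3, ∫ x, pderiv j (fun y => φ y i) x * ψ x l
      = -∫ x, φ x i * pderiv j (fun y => ψ y l) x := fun i j l => by
    rw [(hφ.coord i).integral_mul_pderiv (hψ.coord l), neg_neg]
  have i1 : ∀ i j l : Fin 3, Integrable fun x => pderiv j (fun y => φ y i) x * ψ x l :=
    fun i j l => (((hφ.coord i).pderiv j).mul (hψ.coord l)).integrable
  have i2 : ∀ i j l : Fin 3, Integrable fun x => φ x i * pderiv j (fun y => ψ y l) x :=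
    fun i j l => ((hφ.coord i).mul ((hψ.coord l).pderiv j)).integrable
  simp only [inner_E3, curl_apply_zero, curl_apply_one, curl_apply_two, sub_mul, mul_sub]
  rw [integral_add_sub_three (i1 _ _ _) (i1 _ _ _) (i1 _ _ _) (i1 _ _ _) (i1 _ _ _) (i1 _ _ _),
    integral_add_sub_three (i2 _ _ _) (i2 _ _ _) (i2 _ _ _) (i2 _ _ _) (i2 _ _ _) (i2 _ _ _)]
  simp only [ibp]
  ring

theorem _root_.MeasureTheory.Integrable.coord {u : T3 → E3} (hu : Integrable u) (i : Fin 3) :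
    Integrable fun y => u y i :=
  (EuclideanSpace.proj (𝕜 := ℝ) i : E3 →L[ℝ] ℝ).integrable_comp hu

theorem mollify_coord {k : E3 → ℝ} {u : T3 → E3} (hk : IsTestKernel k) (hu : Integrable u)
    (i : Fin 3) (x : T3) : mollify k (fun y => u y i) x = mollify k u x i :=
  mollify_clm (EuclideanSpace.proj i) hk hu x

theorem curl_mollify_of_smooth {k : E3 → ℝ} {ψ : T3 → E3} (hk : IsTestKernel k)
    (hψ : SmoothOnTorus ψ) (x : T3) : curl (mollify k ψ) x = mollify k (curl ψ) x := by
  have h : ∀ i j, pderiv j (fun y => mollify k ψ y i) x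
      = mollify k (pderiv j (fun y => ψ y i)) x := by
    intro i j
    rw [← pderiv_mollify_eq_mollify_pderiv hk (hψ.coord i)]
    congr 1
    ext y
    exact (mollify_coord hk hψ.integrable i y).symm
  have hd := fun i j => ((hψ.coord i).pderiv j).integrable
  ext i
  rw [← mollify_coord hk hψ.curl.integrable]
  fin_cases i
  · change curl (mollify k ψ) x 0 = mollify k (fun y => curl ψ y 0) x
    simp only [curl_apply_zero, h]
    exact (mollify_sub hk (hd 2 1) (hd 1 2) x).symm
  · change curl (mollify k ψ) x 1 = mollify k (fun y => curl ψ y 1) x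
    simp only [curl_apply_one, h]
    exact (mollify_sub hk (hd 0 2) (hd 2 0) x).symm
  · change curl (mollify k ψ) x 2 = mollify k (fun y => curl ψ y 2) x
    simp only [curl_apply_two, h]
    exact (mollify_sub hk (hd 1 0) (hd 0 1) x).symm

theorem IsWeakCurl.curl_mollify {u w : T3 → E3} (h : IsWeakCurl u w) {k : E3 → ℝ}
    (hk : IsTestKernel k) : EulerTorus.curl (mollify k u) = mollify k w := by
  refine eq_of_integral_inner_smooth (smoothOnTorus_mollify hk h.1).curl
    (smoothOnTorus_mollify hk h.2.1) fun ψ hψ => ?_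
  have hs := smoothOnTorus_mollify hk.neg hψ.integrable
  rw [integral_inner_curl (smoothOnTorus_mollify hk h.1) hψ,
    integral_inner_mollify hk h.1 hψ.curl.continuous,
    integral_inner_mollify hk h.2.1 hψ.continuous, h.2.2 _ hs]
  simp_rw [curl_mollify_of_smooth hk.neg hψ]

theorem IsWeakPartial.pderiv_mollify {j : Fin 3} {u g : T3 → E3} (h : IsWeakPartial j u g)
    {k : E3 → ℝ} (hk : IsTestKernel k) : pderiv j (mollify k u) = mollify k g := by
  have hui : ∀ i : Fin 3, Integrable fun y => u y i := h.1.coord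
  have hgi : ∀ i : Fin 3, Integrable fun y => g y i := h.2.1.coord
  have hu := smoothOnTorus_mollify hk h.1
  have key : ∀ i : Fin 3, pderiv j (mollify k fun y => u y i) = mollify k (fun y => g y i) := by
    intro i
    refine eq_of_integral_mul_smooth ((smoothOnTorus_mollify hk (hui i)).pderiv j)
      (smoothOnTorus_mollify hk (hgi i)) fun ψ hψ => ?_
    have hs := smoothOnTorus_mollify hk.neg hψ.integrable
    have h2 := congrArg (fun a : E3 => a i) (h.2.2 _ hs)
    have hb : ∀ {η : T3 → ℝ} {f : T3 → E3}, Continuous η → Integrable f →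
        (∫ x, η x • f x) i = ∫ x, η x * f x i := by
      intro η f hη hf
      obtain ⟨C, hC⟩ := isCompact_univ.exists_bound_of_continuousOn hη.continuousOn
      have hi : Integrable fun x => η x • f x :=
        hf.bdd_smul C hη.aestronglyMeasurable (Eventually.of_forall fun x => hC x trivial)
      exact ((EuclideanSpace.proj (𝕜 := ℝ) i : E3 →L[ℝ] ℝ).integral_comp_comm hi).symm
    simp only [PiLp.neg_apply] at h2
    rw [hb hs.continuous h.2.1, hb (hs.pderiv j).continuous h.1] at h2
    rw [integral_mollify_mul hk (hgi i) hψ.continuous]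
    have e1 := (smoothOnTorus_mollify hk (hui i)).integral_mul_pderiv hψ j
    rw [integral_mollify_mul hk (hui i) (hψ.pderiv j).continuous] at e1
    simp_rw [← pderiv_mollify_eq_mollify_pderiv hk.neg hψ] at e1
    simp_rw [mul_comm (g _ i), h2, mul_comm (pderiv j (mollify (fun y => k (-y)) ψ) _), e1,
      neg_neg]
  ext x i
  have := congrFun (key i) x
  rw [← mollify_coord hk h.2.1, ← this, ← hu.pderiv_coord]
  congr 1
  ext y
  exact (mollify_coord hk h.1 i y).symm

theorem IsWeakDivFree.divergence_mollify {u : T3 → E3} (h : IsWeakDivFree u) (hu : Integrable u)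
    {k : E3 → ℝ} (hk : IsTestKernel k) (x : T3) : divergence (mollify k u) x = 0 := by
  have hs := smoothOnTorus_mollify hk hu
  have hd : SmoothOnTorus (divergence (mollify k u)) :=
    SmoothOnTorus.sum _ fun i _ => (hs.coord i).pderiv i
  have hz : SmoothOnTorus (fun _ : T3 => (0 : ℝ)) := contDiff_const
  refine congrFun (eq_of_integral_mul_smooth hd hz fun ψ hψ => ?_) x
  have hψs := smoothOnTorus_mollify hk.neg hψ.integrable
  simp only [zero_mul, integral_zero, divergence, Finset.sum_mul]
  rw [integral_finsetSum _ fun i _ => (((hs.coord i).pderiv i).mul hψ).integrable]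
  have e : ∀ i, ∫ x, pderiv i (fun y => mollify k u y i) x * ψ x
      = - ∫ x, mollify k u x i * pderiv i ψ x := fun i => by
    rw [(hs.coord i).integral_mul_pderiv hψ, neg_neg]
  simp_rw [e]
  rw [Finset.sum_neg_distrib, ← integral_finsetSum _ fun i _ =>
    ((hs.coord i).mul (hψ.pderiv i)).integrable]
  simp_rw [← inner_grad]
  rw [integral_inner_mollify hk hu hψ.grad.continuous]
  have e2 : ∀ x, mollify (fun y => k (-y)) (grad ψ) x = grad (mollify (fun y => k (-y)) ψ) x := by
    intro x
    ext i
    rw [grad_apply, pderiv_mollify_eq_mollify_pderiv hk.neg hψ,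
      ← mollify_coord hk.neg hψ.grad.integrable]
    simp_rw [grad_apply]
  simp_rw [e2, inner_grad]
  rw [h _ hψs, neg_zero]

/-! ### Minkowski's and Hölder's inequalities -/

section Inequalities

variable {α β : Type*} [MeasurableSpace α] [MeasurableSpace β] {μ : Measure α} {ν : Measure β}

/-- A generalized Hölder inequality with weights, allowing infinite exponents. -/
theorem lintegral_prod_rpow_le_prod_eLpNorm {ι : Type*} (s : Finset ι) {f : ι → α → ℝ≥0∞}
    (hf : ∀ i ∈ s, AEMeasurable (f i) μ) {w : ι → ℝ} (hw : ∀ i ∈ s, 0 ≤ w i)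
    {p : ι → ℝ≥0∞} (hp0 : ∀ i ∈ s, p i ≠ 0)
    (hp : ∑ i ∈ s, ENNReal.ofReal (w i) / p i = 1) :
    ∫⁻ a, ∏ i ∈ s, f i a ^ w i ∂μ ≤ ∏ i ∈ s, eLpNorm (f i) (p i) μ ^ w i := by
  classical
  set s₁ := s.filter fun i => p i = ⊤ with hs₁
  set s₂ := s.filter fun i => ¬ p i = ⊤ with hs₂
  have hsum : ∑ i ∈ s₂, w i / (p i).toReal = 1 := by
    have h1 : ∑ i ∈ s₂, ENNReal.ofReal (w i / (p i).toReal) = 1 := by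
      rw [← hp, ← Finset.sum_filter_add_sum_filter_not s (fun i => p i = ⊤)]
      rw [Finset.sum_eq_zero (s := s.filter fun i => p i = ⊤), zero_add]
      · refine Finset.sum_congr rfl fun i hi => ?_
        obtain ⟨hi1, hi2⟩ := Finset.mem_filter.1 hi
        have h0 := ENNReal.toReal_pos (hp0 i hi1) hi2
        rw [ENNReal.ofReal_div_of_pos h0, ENNReal.ofReal_toReal hi2]
      · intro i hi
        rw [(Finset.mem_filter.1 hi).2, ENNReal.div_top]
    rw [← ENNReal.ofReal_sum_of_nonneg] at h1
    · simpa using h1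
    · intro i hi
      have := hw i (Finset.mem_filter.1 hi).1
      positivity
  have hae : ∀ᵐ a ∂μ, ∏ i ∈ s₁, f i a ^ w i ≤ ∏ i ∈ s₁, eLpNorm (f i) (p i) μ ^ w i := by
    have : ∀ i ∈ s₁, ∀ᵐ a ∂μ, f i a ≤ eLpNorm (f i) (p i) μ := by
      intro i hi
      rw [(Finset.mem_filter.1 hi).2, eLpNorm_exponent_top]
      simpa using enorm_ae_le_eLpNormEssSup (f i) μ
    filter_upwards [(Finset.eventually_all s₁).2 this] with a ha
    refine Finset.prod_le_prod' fun i hi => ?_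
    exact ENNReal.rpow_le_rpow (ha i hi) (hw i (Finset.mem_filter.1 hi).1)
  have hfin : ∫⁻ a, ∏ i ∈ s₂, f i a ^ w i ∂μ ≤ ∏ i ∈ s₂, eLpNorm (f i) (p i) μ ^ w i := by
    have key := ENNReal.lintegral_prod_norm_pow_le (μ := μ) s₂
      (f := fun i a => f i a ^ (p i).toReal) (p := fun i => w i / (p i).toReal)
      (fun i hi => (hf i (Finset.mem_filter.1 hi).1).pow_const _) hsum
      (fun i hi => div_nonneg (hw i (Finset.mem_filter.1 hi).1) ENNReal.toReal_nonneg)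
    refine (lintegral_mono fun a => le_of_eq ?_).trans (key.trans_eq ?_)
    · refine Finset.prod_congr rfl fun i hi => ?_
      obtain ⟨hi1, hi2⟩ := Finset.mem_filter.1 hi
      rw [← ENNReal.rpow_mul, mul_div_cancel₀ _ (ENNReal.toReal_pos (hp0 i hi1) hi2).ne']
    · refine Finset.prod_congr rfl fun i hi => ?_
      obtain ⟨hi1, hi2⟩ := Finset.mem_filter.1 hi
      rw [eLpNorm_eq_lintegral_rpow_enorm_toReal (hp0 i hi1) hi2, ← ENNReal.rpow_mul]
      simp [div_eq_inv_mul]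
  calc ∫⁻ a, ∏ i ∈ s, f i a ^ w i ∂μ
      ≤ ∫⁻ a, (∏ i ∈ s₁, eLpNorm (f i) (p i) μ ^ w i) * ∏ i ∈ s₂, f i a ^ w i ∂μ := by
        refine lintegral_mono_ae ?_
        filter_upwards [hae] with a ha
        rw [← Finset.prod_filter_mul_prod_filter_not s (fun i => p i = ⊤)]
        gcongr
    _ ≤ _ := by
        rw [lintegral_const_mul'' _ (s₂.aemeasurable_fun_prod fun i hi =>
          (hf i (Finset.mem_filter.1 hi).1).pow_const _),
          ← Finset.prod_filter_mul_prod_filter_not s (fun i => p i = ⊤)]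
        gcongr

/-- Minkowski's integral inequality. -/
theorem eLpNorm_lintegral_le [IsFiniteMeasure μ] [SFinite ν] {g : α → β → ℝ≥0∞}
    (hg : AEMeasurable (Function.uncurry g) (μ.prod ν)) {p : ℝ} (hp : 1 ≤ p) :
    eLpNorm (fun x => ∫⁻ y, g x y ∂ν) (ENNReal.ofReal p) μ
      ≤ ∫⁻ y, eLpNorm (fun x => g x y) (ENNReal.ofReal p) μ ∂ν := by
  have hp0 : ENNReal.ofReal p ≠ 0 := by simp; linarith
  have hG : AEMeasurable (fun x => ∫⁻ y, g x y ∂ν) μ := hg.lintegral_prod_right'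
  rcases hp.eq_or_lt with rfl | hp1
  · simp only [ENNReal.ofReal_one, eLpNorm_one_eq_lintegral_enorm, enorm_eq_self]
    rw [lintegral_lintegral_swap hg]
  set G := fun x => ∫⁻ y, g x y ∂ν with hGdef
  set I := ∫⁻ y, eLpNorm (fun x => g x y) (ENNReal.ofReal p) μ ∂ν
  have hpq := Real.HolderConjugate.conjExponent hp1
  set q := Real.conjExponent p
  have hpos : 0 < p := by linarith
  have hnorm : ∀ f : α → ℝ≥0∞, eLpNorm f (ENNReal.ofReal p) μ = (∫⁻ x, f x ^ p ∂μ) ^ (1 / p) := by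
    intro f
    rw [eLpNorm_eq_lintegral_rpow_enorm_toReal hp0 ENNReal.ofReal_ne_top,
      ENNReal.toReal_ofReal hpos.le]
    simp
  have step : ∀ n : ℕ, (∫⁻ x, (min (G x) n) ^ p ∂μ) ^ (1 / p) ≤ I := by
    intro n
    set A := ∫⁻ x, (min (G x) n) ^ p ∂μ with hA
    have hAtop : A ≠ ⊤ := by
      refine ((lintegral_mono (g := fun _ => (n : ℝ≥0∞) ^ p) fun x =>
        ENNReal.rpow_le_rpow (min_le_right _ _) hpos.le).trans_lt ?_).ne
      rw [lintegral_const]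
      exact ENNReal.mul_lt_top (by finiteness) (measure_lt_top _ _)
    have hm : AEMeasurable (fun x => min (G x) n) μ := hG.min aemeasurable_const
    have h1 : A ≤ A ^ (1 / q) * I := by
      calc A ≤ ∫⁻ x, (min (G x) n) ^ (p - 1) * G x ∂μ := by
            refine lintegral_mono fun x => ?_
            dsimp only
            rcases eq_or_ne (min (G x) n) 0 with h0 | h0
            · rw [h0, ENNReal.zero_rpow_of_pos hpos]; exact zero_le
            · have ht : min (G x) (n : ℝ≥0∞) ≠ ⊤ :=
                ((min_le_right _ _).trans_lt (ENNReal.natCast_lt_top n)).ne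
              rw [ENNReal.rpow_sub _ _ h0 ht, ENNReal.rpow_one]
              calc (min (G x) (n : ℝ≥0∞)) ^ p
                  = (min (G x) (n : ℝ≥0∞)) ^ p / min (G x) n * min (G x) n :=
                    (ENNReal.div_mul_cancel h0 ht).symm
                _ ≤ _ := by gcongr; exact min_le_left _ _
        _ = ∫⁻ x, ∫⁻ y, (min (G x) n) ^ (p - 1) * g x y ∂ν ∂μ := by
            refine lintegral_congr fun x => ?_
            rw [lintegral_const_mul']
            exact (ENNReal.rpow_lt_top_of_nonneg (by linarith)
              ((min_le_right _ _).trans_lt (ENNReal.natCast_lt_top n)).ne).ne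
        _ = ∫⁻ y, ∫⁻ x, (min (G x) n) ^ (p - 1) * g x y ∂μ ∂ν := by
            refine lintegral_lintegral_swap ?_
            exact ((hm.pow_const _).comp_quasiMeasurePreserving
              Measure.quasiMeasurePreserving_fst).mul hg
        _ ≤ ∫⁻ y, A ^ (1 / q) * eLpNorm (fun x => g x y) (ENNReal.ofReal p) μ ∂ν := by
            have hgy : ∀ᵐ y ∂ν, AEMeasurable (fun x => g x y) μ := by
              have h1 : AEMeasurable (Function.uncurry g ∘ Prod.swap) (ν.prod μ) :=
                hg.comp_quasiMeasurePreserving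
                  (Measure.measurePreserving_swap (μ := ν) (ν := μ)).quasiMeasurePreserving
              exact h1.aestronglyMeasurable.prodMk_left.mono fun y hy => hy.aemeasurable
            refine lintegral_mono_ae ?_
            filter_upwards [hgy] with y hy
            have := ENNReal.lintegral_mul_le_Lp_mul_Lq μ hpq.symm (hm.pow_const (p - 1)) hy
            rw [hnorm]
            refine this.trans_eq ?_
            simp_rw [← ENNReal.rpow_mul]
            rw [hpq.sub_one_mul_conj]
        _ = A ^ (1 / q) * I := lintegral_const_mul' _ _
            (ENNReal.rpow_lt_top_of_nonneg (one_div_nonneg.2 hpq.symm.nonneg) hAtop).ne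
    rcases eq_or_ne A 0 with h0 | h0
    · rw [h0, ENNReal.zero_rpow_of_pos (by positivity)]; exact zero_le
    have hA1 : A ^ (1 / p) * A ^ (1 / q) = A := by
      rw [← ENNReal.rpow_add _ _ h0 hAtop]
      have := hpq.inv_add_inv_eq_one
      simp [one_div, this]
    have hq0 : A ^ (1 / q) ≠ 0 := by
      simp [ENNReal.rpow_eq_zero_iff, h0, hAtop]
    have hqt : A ^ (1 / q) ≠ ⊤ :=
      (ENNReal.rpow_lt_top_of_nonneg (one_div_nonneg.2 hpq.symm.nonneg) hAtop).ne
    rw [← ENNReal.mul_le_mul_iff_right hq0 hqt, mul_comm, hA1]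
    exact h1
  rw [hnorm]
  have hlim := lintegral_tendsto_of_tendsto_of_monotone (μ := μ)
    (f := fun (n : ℕ) x => (min (G x) n) ^ p) (F := fun x => G x ^ p)
    (fun n => (hG.min aemeasurable_const).pow_const p)
    (Eventually.of_forall fun x m n hmn => by dsimp only; gcongr)
    (Eventually.of_forall fun x => by
      have h1 : Tendsto (fun n : ℕ => min (G x) (n : ℝ≥0∞)) atTop (𝓝 (min (G x) ⊤)) :=
        tendsto_const_nhds.min ENNReal.tendsto_nat_nhds_top
      rw [min_top_right] at h1
      exact (ENNReal.continuous_rpow_const.tendsto _).comp h1)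
  exact le_of_tendsto' ((ENNReal.continuous_rpow_const.tendsto _).comp hlim) step

end Inequalities

/-! ### The standard mollifier -/

/-- A smooth even nonnegative bump function of integral one supported in the unit ball. -/
def unitBump : E3 → ℝ :=
  ContDiffBump.normed (c := (0 : E3)) ⟨1 / 2, 1, by norm_num, by norm_num⟩ volume

theorem isTestKernel_unitBump : IsTestKernel unitBump :=
  ⟨ContDiffBump.contDiff_normed _, ContDiffBump.hasCompactSupport_normed _⟩

theorem unitBump_nonneg (y : E3) : 0 ≤ unitBump y := ContDiffBump.nonneg_normed _ _

theorem unitBump_neg (y : E3) : unitBump (-y) = unitBump y := ContDiffBump.normed_neg _ _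

theorem integral_unitBump : ∫ y, unitBump y = 1 := ContDiffBump.integral_normed _

theorem support_unitBump : Function.support unitBump = Metric.ball 0 1 :=
  ContDiffBump.support_normed_eq _

theorem kderiv_const_mul_comp_smul {k : E3 → ℝ} (hk : IsTestKernel k) (c a : ℝ) (j : Fin 3)
    (y : E3) : kderiv j (fun y => c * k (a • y)) y = c * a * kderiv j k (a • y) := by
  have hd := (hk.contDiff.differentiable (by simp)) (a • y)
  have h1 : HasFDerivAt (fun y : E3 => a • y) (a • ContinuousLinearMap.id ℝ E3) y :=
    (hasFDerivAt_id y).const_smul a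
  have h2 := (hd.hasFDerivAt.comp y h1).const_mul c
  rw [kderiv, show (fun y => c * k (a • y)) = fun y => c * (k ∘ fun y => a • y) y from rfl,
    h2.fderiv]
  simp [kderiv, mul_assoc]

theorem IsTestKernel.const_mul_comp_smul {k : E3 → ℝ} (hk : IsTestKernel k) (c : ℝ) {a : ℝ}
    (ha : a ≠ 0) : IsTestKernel (fun y => c * k (a • y)) :=
  ⟨contDiff_const.mul (hk.contDiff.comp (contDiff_id.const_smul a)),
    (hk.hasCompactSupport.comp_smul ha).mul_left⟩

/-- The mollifier at scale `ε`. -/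
def eta (ε : ℝ) (y : E3) : ℝ := (ε ^ 3)⁻¹ * unitBump (ε⁻¹ • y)

theorem eta_neg (ε : ℝ) (y : E3) : eta ε (-y) = eta ε y := by
  simp [eta, unitBump_neg]

theorem eta_nonneg {ε : ℝ} (hε : 0 < ε) (y : E3) : 0 ≤ eta ε y :=
  mul_nonneg (by positivity) (unitBump_nonneg _)

theorem isTestKernel_eta {ε : ℝ} (hε : 0 < ε) : IsTestKernel (eta ε) :=
  isTestKernel_unitBump.const_mul_comp_smul _ (inv_ne_zero hε.ne')

theorem integral_eta {ε : ℝ} (hε : 0 < ε) : ∫ y, eta ε y = 1 := by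
  simp only [eta]
  rw [integral_const_mul, Measure.integral_comp_inv_smul_of_nonneg _ _ hε.le, integral_unitBump]
  simp
  field_simp

theorem lintegral_enorm_eta {ε : ℝ} (hε : 0 < ε) : ∫⁻ y, ‖eta ε y‖ₑ = 1 := by
  have h := ofReal_integral_norm_eq_lintegral_enorm (isTestKernel_eta hε).integrable
  rw [← h]
  simp_rw [Real.norm_of_nonneg (eta_nonneg hε _)]
  simp [integral_eta hε]

theorem kderiv_eta (ε : ℝ) (j : Fin 3) :
    kderiv j (eta ε) = fun y => (ε ^ 4)⁻¹ * kderiv j unitBump (ε⁻¹ • y) := by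
  ext y
  have h := kderiv_const_mul_comp_smul isTestKernel_unitBump (ε ^ 3)⁻¹ ε⁻¹ j y
  have h2 : (ε ^ 3)⁻¹ * ε⁻¹ = (ε ^ 4)⁻¹ := by rw [← mul_inv, ← pow_succ]
  rw [h2] at h
  exact h

theorem kderiv_kderiv_eta (ε : ℝ) (i j : Fin 3) :
    kderiv i (kderiv j (eta ε))
      = fun y => (ε ^ 5)⁻¹ * kderiv i (kderiv j unitBump) (ε⁻¹ • y) := by
  ext y
  rw [kderiv_eta]
  have h := kderiv_const_mul_comp_smul (isTestKernel_unitBump.kderiv j) (ε ^ 4)⁻¹ ε⁻¹ i y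
  have h2 : (ε ^ 4)⁻¹ * ε⁻¹ = (ε ^ 5)⁻¹ := by rw [← mul_inv, ← pow_succ]
  rw [h2] at h
  exact h

theorem IsTestKernel.exists_bound {k : E3 → ℝ} (hk : IsTestKernel k) :
    ∃ C : ℝ, ∀ y, ‖k y‖ ≤ C :=
  hk.continuous.bounded_above_of_compact_support hk.hasCompactSupport

theorem support_kderiv_subset {k : E3 → ℝ} {s : Set E3} (hs : IsClosed s)
    (h : Function.support k ⊆ s) (j : Fin 3) : Function.support (kderiv j k) ⊆ s := by
  intro y hy
  have h1 : y ∈ tsupport (fderiv ℝ k) := by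
    refine subset_tsupport _ fun h0 => hy ?_
    rw [kderiv, h0]; rfl
  exact closure_minimal h hs (tsupport_fderiv_subset ℝ h1)

/-- Bounds for the mollifier and its derivatives. -/
theorem exists_eta_bound : ∃ C : ℝ, 0 < C ∧ ∀ ε : ℝ, 0 < ε →
    (∀ y, ‖eta ε y‖ ≤ C * (ε ^ 3)⁻¹) ∧ (∀ j y, ‖kderiv j (eta ε) y‖ ≤ C * (ε ^ 4)⁻¹) ∧
    (∀ i j y, ‖kderiv i (kderiv j (eta ε)) y‖ ≤ C * (ε ^ 5)⁻¹) := by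
  obtain ⟨C0, h0⟩ := isTestKernel_unitBump.exists_bound
  choose C1 h1 using fun j => (isTestKernel_unitBump.kderiv j).exists_bound
  choose C2 h2 using fun i j => ((isTestKernel_unitBump.kderiv j).kderiv i).exists_bound
  have p0 : 0 ≤ C0 := (norm_nonneg _).trans (h0 0)
  have p1 : ∀ j, 0 ≤ C1 j := fun j => (norm_nonneg _).trans (h1 j 0)
  have p2 : ∀ i j, 0 ≤ C2 i j := fun i j => (norm_nonneg _).trans (h2 i j 0)
  have s1 : 0 ≤ ∑ j, C1 j := Finset.sum_nonneg fun j _ => p1 j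
  have s2 : 0 ≤ ∑ i, ∑ j, C2 i j := Finset.sum_nonneg fun i _ => Finset.sum_nonneg fun j _ => p2 i j
  have t1 : ∀ j, C1 j ≤ ∑ j, C1 j := fun j =>
    Finset.single_le_sum (fun j _ => p1 j) (Finset.mem_univ j)
  have t2 : ∀ i j, C2 i j ≤ ∑ i, ∑ j, C2 i j := fun i j =>
    (Finset.single_le_sum (f := fun j => C2 i j) (fun j _ => p2 i j) (Finset.mem_univ j)).trans
      (Finset.single_le_sum (f := fun i => ∑ j, C2 i j)
        (fun i _ => Finset.sum_nonneg fun j _ => p2 i j) (Finset.mem_univ i))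
  refine ⟨C0 + ∑ j, C1 j + ∑ i, ∑ j, C2 i j + 1, by positivity, fun ε hε => ⟨?_, ?_, ?_⟩⟩
  · intro y
    rw [eta, norm_mul, mul_comm, Real.norm_of_nonneg (by positivity : (0 : ℝ) ≤ (ε ^ 3)⁻¹)]
    gcongr
    linarith [h0 (ε⁻¹ • y)]
  · intro j y
    rw [kderiv_eta, norm_mul, mul_comm,
      Real.norm_of_nonneg (by positivity : (0 : ℝ) ≤ (ε ^ 4)⁻¹)]
    gcongr
    linarith [h1 j (ε⁻¹ • y), t1 j]
  · intro i j y
    rw [kderiv_kderiv_eta, norm_mul, mul_comm,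
      Real.norm_of_nonneg (by positivity : (0 : ℝ) ≤ (ε ^ 5)⁻¹)]
    gcongr
    linarith [h2 i j (ε⁻¹ • y), t2 i j]

theorem support_eta {ε : ℝ} (hε : 0 < ε) : Function.support (eta ε) ⊆ Metric.closedBall 0 ε := by
  intro y hy
  have h1 : ε⁻¹ • y ∈ Function.support unitBump := fun h => hy (by simp [eta, h])
  rw [support_unitBump, mem_ball_zero_iff, norm_smul, Real.norm_of_nonneg (by positivity),
    inv_mul_lt_iff₀ hε, mul_one] at h1
  simpa using h1.le

section General

variable {F : Type*} [NormedAddCommGroup F] [NormedSpace ℝ F] {f g : T3 → F} {k : E3 → ℝ}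

theorem mollify_const [CompleteSpace F] (k : E3 → ℝ) (c : F) (x : T3) :
    mollify k (fun _ => c) x = (∫ y, k y) • c := by
  simp only [mollify]
  exact integral_smul_const _ _

theorem integral_kderiv (hk : IsTestKernel k) (j : Fin 3) : ∫ y, kderiv j k y = 0 := by
  have h := pderiv_mollify hk (f := fun _ : T3 => (1 : ℝ)) (integrable_const _) j 0
  have h2 : mollify k (fun _ : T3 => (1 : ℝ)) = fun _ => ∫ y, k y := by
    ext x; simp [mollify_const]
  rw [mollify_const, h2] at h
  simpa [pderiv] using h.symm

theorem enorm_mollify_sub_le [CompleteSpace F] (hk : IsTestKernel k) (hf : Integrable f) (x : T3) (c : F) :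
    ‖mollify k f x - (∫ y, k y) • c‖ₑ ≤ ∫⁻ y, ‖k y‖ₑ * ‖f (x - toTorus y) - c‖ₑ := by
  rw [← mollify_const k c x, ← mollify_sub hk hf (integrable_const c)]
  exact enorm_mollify_le k _ x

theorem lintegral_enorm_mul_le_of_support {K ε : ℝ} (hK : ∀ y, ‖k y‖ ≤ K)
    (hs : Function.support k ⊆ Metric.closedBall 0 ε) (h : E3 → ℝ≥0∞) :
    ∫⁻ y, ‖k y‖ₑ * h y ≤ ENNReal.ofReal K * ∫⁻ y in Metric.ball 0 ε, h y := by
  have h1 : ∫⁻ y, ‖k y‖ₑ * h y ≤ ∫⁻ y in Metric.closedBall 0 ε, ‖k y‖ₑ * h y := by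
    rw [← lintegral_indicator measurableSet_closedBall]
    refine lintegral_mono fun y => ?_
    by_cases hy : k y = 0
    · simp [hy]
    · rw [indicator_of_mem (hs hy)]
  refine h1.trans ?_
  rw [← lintegral_const_mul' _ _ ENNReal.ofReal_ne_top]
  have hae : (Metric.closedBall (0 : E3) ε : Set E3) =ᵐ[volume] Metric.ball 0 ε := by
    refine ae_eq_set.2 ⟨?_, ?_⟩
    · rw [Metric.closedBall_sdiff_ball]
      exact Measure.addHaar_sphere _ _ _
    · rw [sdiff_eq_empty.2 Metric.ball_subset_closedBall, measure_empty]
  rw [Measure.restrict_congr_set hae]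
  refine lintegral_mono fun y => ?_
  gcongr
  rw [← ofReal_norm]
  exact ENNReal.ofReal_le_ofReal (hK y)

theorem eLpNorm_mollify_le (hf : AEStronglyMeasurable f) (hk : Continuous k) {p : ℝ}
    (hp : 1 ≤ p) : eLpNorm (mollify k f) (ENNReal.ofReal p) volume
      ≤ (∫⁻ y, ‖k y‖ₑ) * eLpNorm f (ENNReal.ofReal p) volume := by
  have h1 : eLpNorm (mollify k f) (ENNReal.ofReal p) volume
      ≤ eLpNorm (fun x => ∫⁻ y, ‖k y‖ₑ * ‖f (x - toTorus y)‖ₑ) (ENNReal.ofReal p) volume :=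
    eLpNorm_mono_enorm fun x => by simpa using enorm_mollify_le k f x
  have hm : AEMeasurable (Function.uncurry fun (x : T3) (y : E3) => ‖k y‖ₑ * ‖f (x - toTorus y)‖ₑ)
      ((volume : Measure T3).prod volume) :=
    ((hk.comp continuous_snd).aestronglyMeasurable.enorm).mul
      (aestronglyMeasurable_sub_toTorus hf).enorm
  refine (h1.trans (eLpNorm_lintegral_le hm hp)).trans ?_
  have h2 : ∀ y : E3, eLpNorm (fun x => ‖k y‖ₑ * ‖f (x - toTorus y)‖ₑ) (ENNReal.ofReal p) volume
      = ‖k y‖ₑ * eLpNorm f (ENNReal.ofReal p) volume := by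
    intro y
    have h3 : eLpNorm (fun x => ‖k y‖ₑ * ‖f (x - toTorus y)‖ₑ) (ENNReal.ofReal p) volume
        = eLpNorm (k y • fun x => f (x - toTorus y)) (ENNReal.ofReal p) volume :=
      eLpNorm_congr_enorm_ae (Eventually.of_forall fun x => by simp [enorm_smul])
    rw [h3, eLpNorm_const_smul]
    congr 1
    exact eLpNorm_comp_measurePreserving hf (measurePreserving_sub_right_T3 (toTorus y))
  simp_rw [h2]
  rw [lintegral_mul_const _ hk.measurable.enorm]

theorem eLpNorm_mollify_eta_le (hf : AEStronglyMeasurable f) {ε p : ℝ} (hε : 0 < ε)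
    (hp : 1 ≤ p) : eLpNorm (mollify (eta ε) f) (ENNReal.ofReal p) volume
      ≤ eLpNorm f (ENNReal.ofReal p) volume := by
  simpa [lintegral_enorm_eta hε] using eLpNorm_mollify_le hf (isTestKernel_eta hε).continuous hp

theorem tendsto_eLpNorm_mollify_eta_sub [CompleteSpace F] {p : ℝ} (hp : 1 ≤ p)
    (hf : MemLp f (ENNReal.ofReal p) volume) :
    Tendsto (fun ε => eLpNorm (fun x => mollify (eta ε) f x - f x) (ENNReal.ofReal p) volume)
      (𝓝[>] 0) (𝓝 0) := by
  have hp1 : 1 ≤ ENNReal.ofReal p := by simpa using ENNReal.ofReal_le_ofReal hp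
  rw [ENNReal.tendsto_nhds_zero]
  intro δ hδ
  rcases eq_or_ne δ ⊤ with rfl | hδt
  · simp
  have hδ3 : δ / 3 ≠ 0 := by simp [hδ.ne']
  obtain ⟨g, hg, hgp⟩ := hf.exists_boundedContinuous_eLpNorm_sub_le ENNReal.ofReal_ne_top hδ3
  have huc : UniformContinuous g := CompactSpace.uniformContinuous_of_continuous g.continuous
  have hr : 0 < (δ / 3).toReal := ENNReal.toReal_pos hδ3 (by finiteness)
  obtain ⟨r, hr0, hrg⟩ := Metric.uniformContinuous_iff.1 huc _ hr
  have hfg := hf.sub hgp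
  have hfgi : Integrable (f - (g : T3 → F)) := memLp_one_iff_integrable.1 (hfg.mono_exponent hp1)
  have hgi : Integrable g := integrable_of_continuous g.continuous
  obtain ⟨r', hr'0, hr'⟩ : ∃ r' > 0, ∀ y : E3, ‖y‖ ≤ r' → ‖toTorus y‖ < r := by
    have := (continuous_toTorus.norm).tendsto 0
    rw [toTorus_zero, norm_zero] at this
    obtain ⟨s, hs, hs'⟩ := Metric.eventually_nhds_iff.1 (this.eventually (gt_mem_nhds hr0))
    refine ⟨s / 2, by positivity, fun y hy => hs' (by rw [dist_zero_right]; linarith)⟩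
  filter_upwards [Ioc_mem_nhdsGT hr'0] with ε hε
  have hk := isTestKernel_eta hε.1
  have e : (fun x => mollify (eta ε) f x - f x) = (fun x => mollify (eta ε) (f - (g : T3 → F)) x)
      + ((fun x => mollify (eta ε) g x - g x) + (g - f)) := by
    ext x
    have : f = fun x => (f - (g : T3 → F)) x + g x := by ext; simp
    simp only [Pi.add_apply, Pi.sub_apply]
    conv_lhs => rw [this, mollify_add hk hfgi hgi]
    simp only [Pi.sub_apply]
    abel_nf
  have hsm := fun {f : T3 → F} (hf : Integrable f) => (smoothOnTorus_mollify hk hf).continuous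
  have b1 : eLpNorm (fun x => mollify (eta ε) (f - (g : T3 → F)) x) (ENNReal.ofReal p) volume ≤ δ / 3 :=
    (eLpNorm_mollify_eta_le hfg.1 hε.1 hp).trans hg
  have b3 : eLpNorm ((g : T3 → F) - f) (ENNReal.ofReal p) volume ≤ δ / 3 := by
    rwa [eLpNorm_sub_comm]
  have b2 : eLpNorm (fun x => mollify (eta ε) g x - g x) (ENNReal.ofReal p) volume ≤ δ / 3 := by
    have hb : ∀ x, ‖mollify (eta ε) g x - g x‖ₑ ≤ δ / 3 := by
      intro x
      have h1 := enorm_mollify_sub_le hk hgi x (g x)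
      rw [integral_eta hε.1, one_smul] at h1
      refine h1.trans ?_
      calc ∫⁻ y, ‖eta ε y‖ₑ * ‖g (x - toTorus y) - g x‖ₑ ≤ ∫⁻ y, ‖eta ε y‖ₑ * (δ / 3) := by
            refine lintegral_mono fun y => ?_
            by_cases hy : eta ε y = 0
            · simp [hy]
            gcongr
            have h2 : ‖y‖ ≤ ε := by simpa using support_eta hε.1 hy
            have h3 := hrg (a := x - toTorus y) (b := x)
              (by simpa [dist_eq_norm] using hr' y (h2.trans hε.2))
            rw [← ofReal_norm, ← dist_eq_norm]
            exact (ENNReal.ofReal_le_ofReal h3.le).trans ENNReal.ofReal_toReal_le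
        _ = δ / 3 := by
            rw [lintegral_mul_const' _ _ (by finiteness), lintegral_enorm_eta hε.1, one_mul]
    refine (eLpNorm_mono_enorm (g := fun _ => δ / 3) (by simpa using hb)).trans ?_
    rw [eLpNorm_const _ (by simp; linarith) (NeZero.ne _)]
    simp
  rw [e]
  have m2 : AEStronglyMeasurable (fun x => mollify (eta ε) g x - g x) volume :=
    ((hsm hgi).sub g.continuous).aestronglyMeasurable
  refine (eLpNorm_add_le (hsm hfgi).aestronglyMeasurable (m2.add (hgp.1.sub hf.1)) hp1).trans ?_
  refine (add_le_add le_rfl (eLpNorm_add_le m2 (hgp.1.sub hf.1) hp1)).trans ?_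
  refine (add_le_add b1 (add_le_add b2 b3)).trans_eq ?_
  rw [← add_assoc]
  exact ENNReal.add_thirds δ

end General

/-! ### The Hardy–Littlewood–Sobolev inequality for the kernel `|x|⁻²` on `ℝ³` -/

/-- The kernel `|z|⁻²`. -/
def rieszKernel (z : E3) : ℝ≥0∞ := ENNReal.ofReal (‖z‖ ^ 2)⁻¹

theorem measurable_rieszKernel : Measurable rieszKernel := by
  unfold rieszKernel; fun_prop

theorem rieszKernel_smul {ρ : ℝ} (hρ : 0 < ρ) (z : E3) :
    rieszKernel (ρ • z) = ENNReal.ofReal (ρ ^ 2)⁻¹ * rieszKernel z := by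
  rw [rieszKernel, rieszKernel, ← ENNReal.ofReal_mul (by positivity), norm_smul,
    Real.norm_of_nonneg hρ.le, mul_pow, mul_inv]

theorem lintegral_eq_scale {h : E3 → ℝ≥0∞} (hh : Measurable h) {ρ : ℝ} (hρ : 0 < ρ) :
    ∫⁻ z, h z = ENNReal.ofReal (ρ ^ 3) * ∫⁻ z, h (ρ • z) := by
  have h1 : ∫⁻ z, h (ρ • z) = ∫⁻ z, h z ∂(Measure.map (fun z : E3 => ρ • z) volume) :=
    (lintegral_map hh (by fun_prop)).symm
  have h2 := Measure.map_addHaar_smul (volume : Measure E3) hρ.ne'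
  rw [h1, h2, lintegral_smul_measure, smul_eq_mul, ← mul_assoc,
    ← ENNReal.ofReal_mul (by positivity)]
  have : ρ ^ 3 * |(ρ ^ Module.finrank ℝ E3)⁻¹| = 1 := by
    rw [finrank_euclideanSpace_fin, abs_of_pos (by positivity)]
    exact mul_inv_cancel₀ (by positivity)
  rw [this]; simp

theorem lintegral_rieszKernel_unitBall_lt_top :
    ∫⁻ z in Metric.ball 0 1, rieszKernel z < ⊤ := by
  have h1 : IntegrableOn (fun z : E3 => (‖z‖ ^ 2)⁻¹) (Metric.ball 0 1) := by
    rw [integrableOn_fun_norm_addHaar volume (f := fun r : ℝ => (r ^ 2)⁻¹)]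
    refine (integrableOn_const (C := (1 : ℝ)) (s := Ioo (0 : ℝ) 1) (by simp)).congr_fun ?_
      measurableSet_Ioo
    intro r hr
    have : r ≠ 0 := hr.1.ne'
    simp [this]
  have h2 := h1.2
  rw [hasFiniteIntegral_iff_ofReal (Eventually.of_forall fun z => by positivity)] at h2
  exact h2

theorem lintegral_rieszKernel_compl_lt_top :
    ∫⁻ z in (Metric.ball 0 1)ᶜ, rieszKernel z ^ (3 : ℝ) < ⊤ := by
  have h1 := integrable_rpow_neg_one_add_norm_sq (μ := (volume : Measure E3)) (r := 6)
    (by rw [finrank_euclideanSpace_fin]; norm_num)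
  have h2 := (h1.const_mul 8).2
  rw [hasFiniteIntegral_iff_ofReal (Eventually.of_forall fun z => by positivity)] at h2
  refine lt_of_le_of_lt ?_ h2
  rw [← lintegral_indicator measurableSet_ball.compl]
  refine lintegral_mono fun z => ?_
  by_cases hz : z ∈ (Metric.ball (0 : E3) 1)ᶜ
  · rw [indicator_of_mem hz, rieszKernel, ENNReal.ofReal_rpow_of_nonneg (by positivity) (by norm_num)]
    refine ENNReal.ofReal_le_ofReal ?_
    have hz1 : 1 ≤ ‖z‖ := by simpa using hz
    have e1 : ((‖z‖ ^ 2)⁻¹ : ℝ) ^ (3 : ℝ) = ((‖z‖ ^ 2) ^ 3)⁻¹ := by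
      rw [show (3 : ℝ) = (3 : ℕ) by norm_num, Real.rpow_natCast, inv_pow]
    have e2 : ((1 : ℝ) + ‖z‖ ^ 2) ^ (-6 / 2 : ℝ) = ((1 + ‖z‖ ^ 2) ^ 3)⁻¹ := by
      rw [show (-6 / 2 : ℝ) = -((3 : ℕ) : ℝ) by norm_num, Real.rpow_neg (by positivity),
        Real.rpow_natCast]
    rw [e1, e2]
    have h3 : 1 + ‖z‖ ^ 2 ≤ 2 * ‖z‖ ^ 2 := by nlinarith
    have h4 : (1 + ‖z‖ ^ 2) ^ 3 ≤ 8 * (‖z‖ ^ 2) ^ 3 := by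
      calc (1 + ‖z‖ ^ 2) ^ 3 ≤ (2 * ‖z‖ ^ 2) ^ 3 := by gcongr
        _ = 8 * (‖z‖ ^ 2) ^ 3 := by ring
    rw [inv_le_comm₀ (by positivity) (by positivity), mul_inv, inv_inv]
    linarith
  · rw [indicator_of_notMem hz]; exact zero_le

/-- The near and far field constant of the kernel `|z|⁻²`. -/
def rieszConst : ℝ≥0∞ := (∫⁻ z in Metric.ball 0 1, rieszKernel z)
  + (∫⁻ z in (Metric.ball 0 1)ᶜ, rieszKernel z ^ (3 : ℝ)) ^ (1 / 3 : ℝ)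

theorem rieszConst_lt_top : rieszConst < ⊤ :=
  ENNReal.add_lt_top.2 ⟨lintegral_rieszKernel_unitBall_lt_top,
    ENNReal.rpow_lt_top_of_nonneg (by norm_num) lintegral_rieszKernel_compl_lt_top.ne⟩

theorem mem_ball_smul_iff {ρ : ℝ} (hρ : 0 < ρ) (z : E3) :
    ρ • z ∈ Metric.ball (0 : E3) ρ ↔ z ∈ Metric.ball (0 : E3) 1 := by
  rw [mem_ball_zero_iff, mem_ball_zero_iff, norm_smul, Real.norm_of_nonneg hρ.le]
  constructor <;> intro h <;> nlinarith

theorem lintegral_rieszKernel_ball {ρ : ℝ} (hρ : 0 < ρ) :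
    ∫⁻ z in Metric.ball 0 ρ, rieszKernel z
      = ENNReal.ofReal ρ * ∫⁻ z in Metric.ball 0 1, rieszKernel z := by
  rw [← lintegral_indicator measurableSet_ball, lintegral_eq_scale
    (measurable_rieszKernel.indicator measurableSet_ball) hρ, ← lintegral_indicator measurableSet_ball]
  have : ∀ z : E3, (Metric.ball (0 : E3) ρ).indicator rieszKernel (ρ • z)
      = ENNReal.ofReal (ρ ^ 2)⁻¹ * (Metric.ball (0 : E3) 1).indicator rieszKernel z := by
    intro z
    by_cases hz : z ∈ Metric.ball (0 : E3) 1
    · rw [indicator_of_mem hz, indicator_of_mem ((mem_ball_smul_iff hρ z).2 hz),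
        rieszKernel_smul hρ]
    · rw [indicator_of_notMem hz, indicator_of_notMem (fun h => hz ((mem_ball_smul_iff hρ z).1 h)),
        mul_zero]
  simp_rw [this]
  rw [lintegral_const_mul' _ _ ENNReal.ofReal_ne_top, ← mul_assoc,
    ← ENNReal.ofReal_mul (by positivity)]
  congr 2
  field_simp

theorem lintegral_rieszKernel_compl_ball {ρ : ℝ} (hρ : 0 < ρ) :
    ∫⁻ z in (Metric.ball 0 ρ)ᶜ, rieszKernel z ^ (3 : ℝ)
      = ENNReal.ofReal ρ⁻¹ ^ (3 : ℝ) * ∫⁻ z in (Metric.ball 0 1)ᶜ, rieszKernel z ^ (3 : ℝ) := by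
  have hm : Measurable fun z => rieszKernel z ^ (3 : ℝ) := measurable_rieszKernel.pow_const _
  rw [← lintegral_indicator measurableSet_ball.compl, lintegral_eq_scale
    (hm.indicator measurableSet_ball.compl) hρ, ← lintegral_indicator measurableSet_ball.compl]
  have : ∀ z : E3, (Metric.ball (0 : E3) ρ)ᶜ.indicator (fun z => rieszKernel z ^ (3 : ℝ)) (ρ • z)
      = ENNReal.ofReal (ρ ^ 2)⁻¹ ^ (3 : ℝ)
        * (Metric.ball (0 : E3) 1)ᶜ.indicator (fun z => rieszKernel z ^ (3 : ℝ)) z := by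
    intro z
    by_cases hz : z ∈ Metric.ball (0 : E3) 1
    · rw [indicator_of_notMem (s := (Metric.ball (0 : E3) ρ)ᶜ)
          (fun h => h ((mem_ball_smul_iff hρ z).2 hz)),
        indicator_of_notMem (s := (Metric.ball (0 : E3) 1)ᶜ) (fun h => h hz), mul_zero]
    · rw [indicator_of_mem (s := (Metric.ball (0 : E3) 1)ᶜ) hz,
        indicator_of_mem (s := (Metric.ball (0 : E3) ρ)ᶜ) (fun h => hz ((mem_ball_smul_iff hρ z).1 h)),
        rieszKernel_smul hρ, ENNReal.mul_rpow_of_nonneg _ _ (by norm_num)]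
  simp_rw [this]
  rw [lintegral_const_mul' _ _ (by finiteness), ← mul_assoc]
  congr 1
  rw [ENNReal.ofReal_rpow_of_nonneg (by positivity) (by norm_num),
    ENNReal.ofReal_rpow_of_nonneg (by positivity) (by norm_num),
    ← ENNReal.ofReal_mul (by positivity)]
  congr 1
  rw [show (3 : ℝ) = (3 : ℕ) by norm_num, Real.rpow_natCast, Real.rpow_natCast]
  field_simp

/-- The Riesz potential of a function bounded by `a` and of unit `L^{3/2}` norm. -/
theorem lintegral_rieszKernel_mul_le {g : E3 → ℝ≥0∞} (hg : Measurable g)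
    (hg1 : ∫⁻ y, g y ^ (3 / 2 : ℝ) ≤ 1) {a : ℝ} (ha : 0 < a)
    (hga : ∀ y, g y ≤ ENNReal.ofReal a) (x : E3) :
    ∫⁻ y, rieszKernel (x - y) * g y ≤ rieszConst * ENNReal.ofReal a ^ (1 / 2 : ℝ) := by
  set ρ : ℝ := a ^ (-(1 / 2) : ℝ) with hρdef
  have hρ : 0 < ρ := by positivity
  have hmp := measurePreserving_sub_left_E3 x
  have e0 : ∫⁻ y, rieszKernel (x - y) * g y = ∫⁻ z, rieszKernel z * g (x - z) := by
    rw [← hmp.lintegral_comp (f := fun z => rieszKernel z * g (x - z))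
      (measurable_rieszKernel.mul (hg.comp (by fun_prop)))]
    simp
  have hg1' : ∫⁻ z, g (x - z) ^ (3 / 2 : ℝ) ≤ 1 := by
    rwa [hmp.lintegral_comp (f := fun z => g z ^ (3 / 2 : ℝ)) (hg.pow_const _)]
  have near : ∫⁻ z in Metric.ball 0 ρ, rieszKernel z * g (x - z)
      ≤ (∫⁻ z in Metric.ball 0 1, rieszKernel z) * ENNReal.ofReal a ^ (1 / 2 : ℝ) := by
    calc _ ≤ ∫⁻ z in Metric.ball 0 ρ, rieszKernel z * ENNReal.ofReal a :=
          lintegral_mono fun z => mul_le_mul_right (hga _) _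
      _ = (∫⁻ z in Metric.ball 0 1, rieszKernel z) * (ENNReal.ofReal ρ * ENNReal.ofReal a) := by
          rw [lintegral_mul_const' _ _ ENNReal.ofReal_ne_top, lintegral_rieszKernel_ball hρ]
          ring
      _ = _ := by
          rw [← ENNReal.ofReal_mul hρ.le, ENNReal.ofReal_rpow_of_pos ha]
          congr 2
          calc ρ * a = a ^ (-(1 / 2) : ℝ) * a ^ (1 : ℝ) := by rw [Real.rpow_one]
            _ = _ := by rw [← Real.rpow_add ha]; norm_num
  have far : ∫⁻ z in (Metric.ball 0 ρ)ᶜ, rieszKernel z * g (x - z)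
      ≤ (∫⁻ z in (Metric.ball 0 1)ᶜ, rieszKernel z ^ (3 : ℝ)) ^ (1 / 3 : ℝ)
        * ENNReal.ofReal a ^ (1 / 2 : ℝ) := by
    have hpq : (3 : ℝ).HolderConjugate (3 / 2) := by
      rw [Real.holderConjugate_iff]; norm_num
    have hgm : Measurable fun z => g (x - z) := hg.comp (by fun_prop)
    refine (ENNReal.lintegral_mul_le_Lp_mul_Lq _ hpq measurable_rieszKernel.aemeasurable
      hgm.aemeasurable).trans ?_
    rw [lintegral_rieszKernel_compl_ball hρ, ENNReal.mul_rpow_of_nonneg _ _ (by norm_num),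
      ← ENNReal.rpow_mul]
    norm_num only [one_div, ENNReal.rpow_one]
    have h1 : (∫⁻ z in (Metric.ball 0 ρ)ᶜ, g (x - z) ^ (3 / 2 : ℝ)) ^ (2 / 3 : ℝ) ≤ 1 :=
      ENNReal.rpow_le_one ((setLIntegral_le_lintegral _ _).trans hg1') (by norm_num)
    have h2 : ENNReal.ofReal ρ⁻¹ = ENNReal.ofReal a ^ (1 / 2 : ℝ) := by
      rw [ENNReal.ofReal_rpow_of_pos ha, hρdef, ← Real.rpow_neg ha.le, neg_neg]
    rw [h2]
    calc _ ≤ _ := mul_le_mul_right h1 _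
      _ = _ := by ring
  rw [e0, ← lintegral_add_compl _ measurableSet_ball, rieszConst, add_mul]
  exact add_le_add near far

theorem lintegral_hls_half {f g : E3 → ℝ≥0∞} (hg : Measurable g)
    (hft : ∀ x, f x ≠ ⊤) (hf1 : ∫⁻ y, f y ^ (3 / 2 : ℝ) ≤ 1)
    (hg1 : ∫⁻ y, g y ^ (3 / 2 : ℝ) ≤ 1) :
    ∫⁻ x, ∫⁻ y, {y | g y ≤ f x}.indicator (fun y => f x * (rieszKernel (x - y) * g y)) y
      ≤ rieszConst := by
  have key : ∀ x, ∫⁻ y, {y | g y ≤ f x}.indicator (fun y => f x * (rieszKernel (x - y) * g y)) y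
      ≤ rieszConst * f x ^ (3 / 2 : ℝ) := by
    intro x
    have hs : MeasurableSet {y | g y ≤ f x} := measurableSet_le hg measurable_const
    rcases eq_or_ne (f x) 0 with h0 | h0
    · simp [h0, indicator_apply]
    have hpos : 0 < (f x).toReal := ENNReal.toReal_pos h0 (hft x)
    have h1 := lintegral_rieszKernel_mul_le (g := {y | g y ≤ f x}.indicator g) (hg.indicator hs)
      ((lintegral_mono fun y => ENNReal.rpow_le_rpow (indicator_le_self _ _ y)
        (by norm_num)).trans hg1) hpos
      (fun y => by
        rw [ENNReal.ofReal_toReal (hft x)]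
        by_cases hy : g y ≤ f x
        · rwa [indicator_of_mem (s := {y | g y ≤ f x}) hy]
        · rw [indicator_of_notMem (s := {y | g y ≤ f x}) hy]; exact zero_le) x
    rw [ENNReal.ofReal_toReal (hft x)] at h1
    calc _ = ∫⁻ y, f x * (rieszKernel (x - y) * {y | g y ≤ f x}.indicator g y) := by
          refine lintegral_congr fun y => ?_
          by_cases hy : g y ≤ f x <;> simp [hy]
      _ = f x * ∫⁻ y, rieszKernel (x - y) * {y | g y ≤ f x}.indicator g y :=
          lintegral_const_mul' _ _ (hft x)
      _ ≤ f x * (rieszConst * f x ^ (1 / 2 : ℝ)) := by gcongr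
      _ = rieszConst * (f x ^ (1 : ℝ) * f x ^ (1 / 2 : ℝ)) := by rw [ENNReal.rpow_one]; ring
      _ = _ := by
          rw [← ENNReal.rpow_add _ _ h0 (hft x)]
          norm_num
  refine (lintegral_mono key).trans ?_
  rw [lintegral_const_mul' _ _ rieszConst_lt_top.ne]
  exact (mul_le_mul_right hf1 _).trans_eq (mul_one _)

/-- The Hardy–Littlewood–Sobolev inequality in the diagonal case, for normalized functions. -/
theorem lintegral_hls {f g : E3 → ℝ≥0∞} (hf : Measurable f) (hg : Measurable g)
    (hft : ∀ x, f x ≠ ⊤) (hgt : ∀ x, g x ≠ ⊤) (hf1 : ∫⁻ y, f y ^ (3 / 2 : ℝ) ≤ 1)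
    (hg1 : ∫⁻ y, g y ^ (3 / 2 : ℝ) ≤ 1) :
    ∫⁻ x, f x * ∫⁻ y, rieszKernel (x - y) * g y ≤ 2 * rieszConst := by
  have hm : Measurable fun z : E3 × E3 => rieszKernel (z.1 - z.2) :=
    measurable_rieszKernel.comp (by fun_prop)
  have hm1 : Measurable fun z : E3 × E3 => {y | g y ≤ f z.1}.indicator
      (fun y => f z.1 * (rieszKernel (z.1 - y) * g y)) z.2 := by
    have : MeasurableSet {z : E3 × E3 | g z.2 ≤ f z.1} :=
      measurableSet_le (hg.comp measurable_snd) (hf.comp measurable_fst)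
    exact ((hf.comp measurable_fst).mul (hm.mul (hg.comp measurable_snd))).indicator this
  have hm2 : Measurable fun z : E3 × E3 => {x | f x ≤ g z.2}.indicator
      (fun x => g z.2 * (rieszKernel (z.2 - x) * f x)) z.1 := by
    have : MeasurableSet {z : E3 × E3 | f z.1 ≤ g z.2} :=
      measurableSet_le (hf.comp measurable_fst) (hg.comp measurable_snd)
    have hm' : Measurable fun z : E3 × E3 => rieszKernel (z.2 - z.1) :=
      measurable_rieszKernel.comp (by fun_prop)
    exact ((hg.comp measurable_snd).mul (hm'.mul (hf.comp measurable_fst))).indicator this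
  calc ∫⁻ x, f x * ∫⁻ y, rieszKernel (x - y) * g y
      = ∫⁻ x, ∫⁻ y, f x * (rieszKernel (x - y) * g y) :=
        lintegral_congr fun x => (lintegral_const_mul' _ _ (hft x)).symm
    _ ≤ ∫⁻ x, ∫⁻ y, ({y | g y ≤ f x}.indicator (fun y => f x * (rieszKernel (x - y) * g y)) y
          + {x | f x ≤ g y}.indicator (fun x => g y * (rieszKernel (y - x) * f x)) x) := by
        refine lintegral_mono fun x => lintegral_mono fun y => ?_
        rcases le_total (g y) (f x) with h | h
        · rw [indicator_of_mem (s := {y | g y ≤ f x}) h]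
          exact le_self_add
        · rw [indicator_of_mem (s := {x | f x ≤ g y}) h]
          refine le_of_eq_of_le ?_ le_add_self
          have : rieszKernel (x - y) = rieszKernel (y - x) := by
            rw [rieszKernel, rieszKernel, norm_sub_rev]
          rw [this]; ring
    _ = (∫⁻ x, ∫⁻ y, {y | g y ≤ f x}.indicator (fun y => f x * (rieszKernel (x - y) * g y)) y)
          + ∫⁻ x, ∫⁻ y, {x | f x ≤ g y}.indicator
            (fun x => g y * (rieszKernel (y - x) * f x)) x := by
        rw [← lintegral_add_left hm1.lintegral_prod_right']
        refine lintegral_congr fun x => lintegral_add_left (hm1.comp measurable_prodMk_left) _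
    _ ≤ rieszConst + rieszConst := by
        refine add_le_add (lintegral_hls_half hg hft hf1 hg1) ?_
        rw [lintegral_lintegral_swap hm2.aemeasurable]
        exact lintegral_hls_half hf hgt hg1 hf1
    _ = _ := (two_mul _).symm

/-! ### Vector fields on `ℝ³` are controlled by their curl and divergence -/

theorem integrable_mul_isTestKernel {k l : E3 → ℝ} (hk : Continuous k) (hl : IsTestKernel l) :
    Integrable (fun y => k y * l y) :=
  (hk.mul hl.continuous).integrable_of_hasCompactSupport hl.hasCompactSupport.mul_left

theorem contDiff_kderiv {K : E3 → ℝ} (hK : ContDiff ℝ ((⊤ : ℕ∞) : WithTop ℕ∞) K) (j : Fin 3) :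
    ContDiff ℝ ((⊤ : ℕ∞) : WithTop ℕ∞) (kderiv j K) :=
  (ContDiff.fderiv_right hK (by simp)).clm_apply contDiff_const

theorem integral_mul_kderiv {K w : E3 → ℝ} (hK : ContDiff ℝ ((⊤ : ℕ∞) : WithTop ℕ∞) K)
    (hw : IsTestKernel w) (j : Fin 3) :
    ∫ y, K y * kderiv j w y = -∫ y, kderiv j K y * w y :=
  integral_mul_fderiv_eq_neg_fderiv_mul_of_integrable
    (integrable_mul_isTestKernel (contDiff_kderiv hK j).continuous hw)
    (integrable_mul_isTestKernel hK.continuous (hw.kderiv j))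
    (integrable_mul_isTestKernel hK.continuous hw)
    (fun x _ => hK.differentiable (by simp) x)
    (fun x _ => hw.contDiff.differentiable (by simp) x)

/-- The smoothed gradient `yᵢ (1 + |y|²)^{-3/2}` of the Newtonian potential. -/
def smoothedKernel (i : Fin 3) (y : E3) : ℝ := y i * (1 + ‖y‖ ^ 2) ^ (-(3 / 2) : ℝ)

/-- The divergence `3 (1 + |y|²)^{-5/2}` of the smoothed kernel. -/
def smoothedDelta (y : E3) : ℝ := 3 * (1 + ‖y‖ ^ 2) ^ (-(5 / 2) : ℝ)

theorem contDiff_smoothedKernel (i : Fin 3) :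
    ContDiff ℝ ((⊤ : ℕ∞) : WithTop ℕ∞) (smoothedKernel i) := by
  have h1 : ContDiff ℝ ((⊤ : ℕ∞) : WithTop ℕ∞) (fun y : E3 => 1 + ‖y‖ ^ 2) :=
    contDiff_const.add (contDiff_norm_sq ℝ)
  refine ContDiff.mul ?_ (h1.rpow_const_of_ne fun y => by positivity)
  exact (EuclideanSpace.proj (𝕜 := ℝ) i : E3 →L[ℝ] ℝ).contDiff

theorem kderiv_smoothedKernel (i j : Fin 3) (y : E3) : kderiv j (smoothedKernel i) y
    = (basisVec j) i * (1 + ‖y‖ ^ 2) ^ (-(3 / 2) : ℝ)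
      - 3 * (y i * y j) * (1 + ‖y‖ ^ 2) ^ (-(5 / 2) : ℝ) := by
  have h1 : HasFDerivAt (fun y : E3 => 1 + ‖y‖ ^ 2) (2 • innerSL ℝ y) y :=
    ((hasStrictFDerivAt_norm_sq y).hasFDerivAt).const_add 1
  have h2 := h1.rpow_const (p := (-(3 / 2) : ℝ)) (Or.inl (by positivity))
  have h3 : HasFDerivAt (fun y : E3 => y i) (EuclideanSpace.proj (𝕜 := ℝ) i : E3 →L[ℝ] ℝ) y :=
    (EuclideanSpace.proj (𝕜 := ℝ) i : E3 →L[ℝ] ℝ).hasFDerivAt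
  have h4 := h3.mul h2
  have h5 : kderiv j (smoothedKernel i) y = _ := congrArg (fun L : E3 →L[ℝ] ℝ => L (basisVec j))
    h4.fderiv
  rw [h5]
  have e : (-(3 / 2) - 1 : ℝ) = -(5 / 2) := by norm_num
  rw [e]
  have e2 : (inner ℝ y (basisVec j) : ℝ) = y j := by
    simp [EuclideanSpace.inner_single_right]
  simp only [add_apply, smul_apply, innerSL_apply_apply,
    e2, smul_eq_mul, nsmul_eq_mul]
  rw [show (EuclideanSpace.proj i : E3 →L[ℝ] ℝ) (basisVec j) = (basisVec j) i from rfl]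
  push_cast
  ring

theorem kderiv_smoothedKernel_comm (i j : Fin 3) (y : E3) :
    kderiv j (smoothedKernel i) y = kderiv i (smoothedKernel j) y := by
  rw [kderiv_smoothedKernel, kderiv_smoothedKernel]
  have : (basisVec j) i = (basisVec i) j := by simp [eq_comm]
  rw [this]; ring

theorem sum_kderiv_smoothedKernel (y : E3) :
    ∑ i, kderiv i (smoothedKernel i) y = smoothedDelta y := by
  simp only [kderiv_smoothedKernel]
  have hp : 0 < 1 + ‖y‖ ^ 2 := by positivity
  have e : (1 + ‖y‖ ^ 2) ^ (-(3 / 2) : ℝ)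
      = (1 + ‖y‖ ^ 2) * (1 + ‖y‖ ^ 2) ^ (-(5 / 2) : ℝ) := by
    nth_rw 2 [← Real.rpow_one (1 + ‖y‖ ^ 2)]
    rw [← Real.rpow_add hp]; norm_num
  have e2 : ‖y‖ ^ 2 = y 0 * y 0 + y 1 * y 1 + y 2 * y 2 := by
    rw [EuclideanSpace.norm_sq_eq, Fin.sum_univ_three]; simp [pow_two]
  rw [Fin.sum_univ_three, e, smoothedDelta]
  have hb : ∀ i, (basisVec i) i = 1 := fun i => by simp
  rw [hb, hb, hb]
  set X := (1 + ‖y‖ ^ 2) ^ (-(5 / 2) : ℝ)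
  rw [e2]; ring

theorem abs_smoothedKernel_le (i : Fin 3) (y : E3) : |smoothedKernel i y| ≤ (‖y‖ ^ 2)⁻¹ := by
  rcases eq_or_ne y 0 with rfl | hy
  · simp [smoothedKernel]
  have hn : 0 < ‖y‖ := norm_pos_iff.2 hy
  have h1 : |y i| ≤ ‖y‖ := by simpa using PiLp.norm_apply_le y i
  have h2 : (1 + ‖y‖ ^ 2) ^ (-(3 / 2) : ℝ) ≤ (‖y‖ ^ 2) ^ (-(3 / 2) : ℝ) :=
    Real.rpow_le_rpow_of_nonpos (by positivity) (by linarith) (by norm_num)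
  have h3 : (‖y‖ ^ 2) ^ (-(3 / 2) : ℝ) = (‖y‖ ^ 3)⁻¹ := by
    rw [← Real.rpow_natCast, ← Real.rpow_mul hn.le]
    rw [← Real.rpow_natCast, ← Real.rpow_neg hn.le]
    norm_num
  rw [smoothedKernel, abs_mul, abs_of_pos (by positivity : 0 < (1 + ‖y‖ ^ 2) ^ (-(3 / 2) : ℝ))]
  calc _ ≤ ‖y‖ * (‖y‖ ^ 3)⁻¹ := by
        rw [← h3]; gcongr
    _ = _ := by field_simp

theorem integrable_smoothedDelta : Integrable smoothedDelta := by
  have := integrable_rpow_neg_one_add_norm_sq (μ := (volume : Measure E3)) (r := 5)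
    (by rw [finrank_euclideanSpace_fin]; norm_num)
  have h := this.const_mul 3
  rw [neg_div] at h
  exact h

theorem smoothedDelta_pos (y : E3) : 0 < smoothedDelta y := by
  unfold smoothedDelta; positivity

theorem integral_smoothedDelta_pos : 0 < ∫ y, smoothedDelta y := by
  rw [integral_pos_iff_support_of_nonneg (fun y => (smoothedDelta_pos y).le)
    integrable_smoothedDelta]
  have : Function.support smoothedDelta = univ :=
    eq_univ_of_forall fun y => (smoothedDelta_pos y).ne'
  rw [this]
  simp

theorem tendsto_norm_pow_mul_smoothedDelta :
    Tendsto (fun y : E3 => ‖y‖ ^ 3 * smoothedDelta y) (Bornology.cobounded E3) (𝓝 0) := by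
  have h1 : Tendsto (fun y : E3 => 3 * ‖y‖⁻¹) (Bornology.cobounded E3) (𝓝 0) := by
    simpa using (tendsto_inv_atTop_zero.comp (tendsto_norm_cobounded_atTop (E := E3))).const_mul 3
  refine squeeze_zero' (Eventually.of_forall fun y =>
    mul_nonneg (by positivity) (smoothedDelta_pos y).le) ?_ h1
  filter_upwards [(tendsto_norm_cobounded_atTop (E := E3)).eventually_ge_atTop 1] with y hy
  have hn : 0 < ‖y‖ := by linarith
  have h2 : (1 + ‖y‖ ^ 2) ^ (-(5 / 2) : ℝ) ≤ (‖y‖ ^ 2) ^ (-(5 / 2) : ℝ) :=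
    Real.rpow_le_rpow_of_nonpos (by positivity) (by linarith) (by norm_num)
  have h3 : (‖y‖ ^ 2) ^ (-(5 / 2) : ℝ) = (‖y‖ ^ 5)⁻¹ := by
    rw [← Real.rpow_natCast, ← Real.rpow_mul hn.le]
    rw [← Real.rpow_natCast, ← Real.rpow_neg hn.le]
    norm_num
  rw [smoothedDelta]
  calc _ ≤ ‖y‖ ^ 3 * (3 * (‖y‖ ^ 5)⁻¹) := by rw [← h3]; gcongr
    _ = 3 * ‖y‖⁻¹ * ‖y‖⁻¹ := by field_simp
    _ ≤ 3 * ‖y‖⁻¹ * 1 := by gcongr; exact inv_le_one_of_one_le₀ hy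
    _ = _ := mul_one _

/-- The size of the curl and the divergence of a vector field on `ℝ³`. -/
def curlDivSize (w : Fin 3 → E3 → ℝ) (y : E3) : ℝ :=
  (∑ i, ∑ j, |kderiv i (w j) y - kderiv j (w i) y|) + |∑ i, kderiv i (w i) y|

theorem integral_smoothedDelta_mul_eq {w : Fin 3 → E3 → ℝ} (hw : ∀ i, IsTestKernel (w i))
    {K : Fin 3 → E3 → ℝ} (hK : ∀ i, ContDiff ℝ ((⊤ : ℕ∞) : WithTop ℕ∞) (K i))
    (hKc : ∀ i j y, kderiv j (K i) y = kderiv i (K j) y) (j : Fin 3) :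
    ∫ y, (∑ i, kderiv i (K i) y) * w j y
      = -∫ y, ((∑ i, K i y * (kderiv i (w j) y - kderiv j (w i) y))
        + K j y * ∑ i, kderiv i (w i) y) := by
  have i1 : ∀ a b c, Integrable fun y => K a y * kderiv b (w c) y := fun a b c =>
    integrable_mul_isTestKernel (hK a).continuous ((hw c).kderiv b)
  have i2 : ∀ a b c, Integrable fun y => kderiv b (K a) y * w c y := fun a b c =>
    integrable_mul_isTestKernel (contDiff_kderiv (hK a) b).continuous (hw c)
  have ibp : ∀ a b c, ∫ y, K a y * kderiv b (w c) y = -∫ y, kderiv b (K a) y * w c y :=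
    fun a b c => integral_mul_kderiv (hK a) (hw c) b
  simp only [Finset.sum_mul, Finset.mul_sum, mul_sub]
  rw [integral_finsetSum _ fun i _ => i2 i i j,
    integral_add (f := fun y => ∑ i, (K i y * kderiv i (w j) y - K i y * kderiv j (w i) y))
      (g := fun y => ∑ i, K j y * kderiv i (w i) y)
      (integrable_finsetSum _ fun i _ => (i1 i i j).sub (i1 i j i))
      (integrable_finsetSum _ fun i _ => i1 j i i),
    integral_finsetSum (f := fun i y => K i y * kderiv i (w j) y - K i y * kderiv j (w i) y)
      _ fun i _ => (i1 i i j).sub (i1 i j i),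
    integral_finsetSum _ fun i _ => i1 j i i]
  have e : ∀ i, ∫ y, (K i y * kderiv i (w j) y - K i y * kderiv j (w i) y)
      = (∫ y, K i y * kderiv i (w j) y) - ∫ y, K i y * kderiv j (w i) y := fun i =>
    integral_sub (i1 i i j) (i1 i j i)
  simp_rw [e, ibp, hKc _ j]
  rw [Finset.sum_sub_distrib]
  simp

theorem abs_sum_mul_add_le {w : Fin 3 → E3 → ℝ} {k : Fin 3 → ℝ} {M : ℝ}
    (hk : ∀ i, |k i| ≤ M) (j : Fin 3) (y : E3) :
    |(∑ i, k i * (kderiv i (w j) y - kderiv j (w i) y)) + k j * ∑ i, kderiv i (w i) y|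
      ≤ M * curlDivSize w y := by
  have hM : 0 ≤ M := (abs_nonneg _).trans (hk 0)
  rw [curlDivSize, mul_add]
  refine (abs_add_le _ _).trans (add_le_add ?_ ?_)
  · rw [Finset.mul_sum]
    refine (Finset.abs_sum_le_sum_abs _ _).trans (Finset.sum_le_sum fun i _ => ?_)
    rw [abs_mul]
    refine mul_le_mul (hk i) ?_ (abs_nonneg _) hM
    exact Finset.single_le_sum (f := fun j => |kderiv i (w j) y - kderiv j (w i) y|)
      (fun j _ => abs_nonneg _) (Finset.mem_univ j)
  · rw [abs_mul]
    exact mul_le_mul_of_nonneg_right (hk j) (abs_nonneg _)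

theorem enorm_apply_zero_le {w : Fin 3 → E3 → ℝ} (hw : ∀ i, IsTestKernel (w i)) (j : Fin 3) :
    ‖(∫ y, smoothedDelta y) * w j 0‖ₑ
      ≤ ∫⁻ y, rieszKernel y * ENNReal.ofReal (curlDivSize w y) := by
  set m := ∫ y, smoothedDelta y with hm
  have hm0 : 0 < m := integral_smoothedDelta_pos
  have hlim := tendsto_integral_comp_smul_smul_of_integrable (μ := (volume : Measure E3))
    (φ := fun y => m⁻¹ * smoothedDelta y) (g := w j)
    (fun y => mul_nonneg (by positivity) (smoothedDelta_pos y).le)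
    (by rw [integral_const_mul, ← hm, inv_mul_cancel₀ hm0.ne'])
    (by
      rw [finrank_euclideanSpace_fin]
      have := tendsto_norm_pow_mul_smoothedDelta.const_mul m⁻¹
      rw [mul_zero] at this
      refine this.congr fun y => by ring)
    (hw j).integrable (hw j).continuous.continuousAt
  rw [finrank_euclideanSpace_fin] at hlim
  have hlim2 := (hlim.const_mul m).enorm
  refine le_of_tendsto hlim2 ?_
  filter_upwards [eventually_gt_atTop 0] with c hc
  set K : Fin 3 → E3 → ℝ := fun i y => c ^ 2 * smoothedKernel i (c • y) with hKdef
  have hK : ∀ i, ContDiff ℝ ((⊤ : ℕ∞) : WithTop ℕ∞) (K i) := fun i =>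
    contDiff_const.mul ((contDiff_smoothedKernel i).comp (contDiff_id.const_smul c))
  have hKd : ∀ i j y, kderiv j (K i) y = c ^ 3 * kderiv j (smoothedKernel i) (c • y) := by
    intro i j y
    have hd := ((contDiff_smoothedKernel i).differentiable (by simp)) (c • y)
    have h1 : HasFDerivAt (fun y : E3 => c • y) (c • ContinuousLinearMap.id ℝ E3) y :=
      (hasFDerivAt_id y).const_smul c
    have h2 := (hd.hasFDerivAt.comp y h1).const_mul (c ^ 2)
    rw [kderiv, show K i = fun y => c ^ 2 * (smoothedKernel i ∘ fun y => c • y) y from rfl,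
      h2.fderiv]
    simp [kderiv]; ring
  have hrep := integral_smoothedDelta_mul_eq hw hK
    (fun i j y => by rw [hKd, hKd, kderiv_smoothedKernel_comm]) j
  have hKb : ∀ i y, |K i y| ≤ (‖y‖ ^ 2)⁻¹ := by
    intro i y
    rw [hKdef]
    simp only [abs_mul, abs_of_pos (pow_pos hc 2)]
    calc _ ≤ c ^ 2 * (‖c • y‖ ^ 2)⁻¹ := by gcongr; exact abs_smoothedKernel_le i _
      _ = (‖y‖ ^ 2)⁻¹ := by
        rw [norm_smul, Real.norm_of_nonneg hc.le, mul_pow, mul_inv, ← mul_assoc,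
          mul_inv_cancel₀ (by positivity), one_mul]
  have e1 : m * ∫ y, (c ^ 3 * (m⁻¹ * smoothedDelta (c • y))) • w j y
      = ∫ y, (∑ i, kderiv i (K i) y) * w j y := by
    rw [← integral_const_mul]
    refine integral_congr_ae (Eventually.of_forall fun y => ?_)
    simp only [hKd, ← Finset.mul_sum, sum_kderiv_smoothedKernel, smul_eq_mul]
    field_simp
  rw [e1, hrep, enorm_neg]
  refine (enorm_integral_le_lintegral_enorm _).trans (lintegral_mono fun y => ?_)
  rw [rieszKernel, ← ENNReal.ofReal_mul (by positivity), Real.enorm_eq_ofReal_abs]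
  exact ENNReal.ofReal_le_ofReal (abs_sum_mul_add_le (fun i => hKb i y) j y)

theorem kderiv_comp_add (k : E3 → ℝ) (x : E3) (j : Fin 3) (y : E3) :
    kderiv j (fun y => k (x + y)) y = kderiv j k (x + y) := by
  rw [kderiv, kderiv, fderiv_comp_add_left]

theorem IsTestKernel.comp_add {k : E3 → ℝ} (hk : IsTestKernel k) (x : E3) :
    IsTestKernel (fun y => k (x + y)) :=
  ⟨hk.contDiff.comp (contDiff_const.add contDiff_id),
    hk.hasCompactSupport.comp_homeomorph (Homeomorph.addLeft x)⟩

theorem continuous_curlDivSize {w : Fin 3 → E3 → ℝ} (hw : ∀ i, IsTestKernel (w i)) :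
    Continuous (curlDivSize w) := by
  have := fun i j => ((hw j).kderiv i).continuous
  unfold curlDivSize
  fun_prop

theorem enorm_apply_le {w : Fin 3 → E3 → ℝ} (hw : ∀ i, IsTestKernel (w i)) (j : Fin 3) (x : E3) :
    ‖(∫ y, smoothedDelta y) * w j x‖ₑ
      ≤ ∫⁻ y, rieszKernel (x - y) * ENNReal.ofReal (curlDivSize w y) := by
  have h := enorm_apply_zero_le (fun i => (hw i).comp_add x) j
  rw [add_zero] at h
  refine h.trans_eq ?_
  rw [← lintegral_add_left_eq_self (fun y => rieszKernel (x - y) * _) x]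
  refine lintegral_congr fun y => ?_
  rw [sub_add_cancel_left]
  congr 1
  · simp [rieszKernel]
  · simp [curlDivSize, kderiv_comp_add]

/-- A compactly supported vector field on `ℝ³` is controlled in `L³` by the `L^{3/2}` norm of its
curl and divergence. -/
theorem exists_lintegral_le_curlDivSize : ∃ C : ℝ≥0∞, C ≠ ⊤ ∧
    ∀ w : Fin 3 → E3 → ℝ, (∀ i, IsTestKernel (w i)) → ∀ j,
      (∫⁻ x, ‖w j x‖ₑ ^ (3 : ℝ)) ^ (1 / 3 : ℝ)
        ≤ C * (∫⁻ x, ENNReal.ofReal (curlDivSize w x) ^ (3 / 2 : ℝ)) ^ (2 / 3 : ℝ) := by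
  set m := ∫ y, smoothedDelta y
  have hm0 : 0 < m := integral_smoothedDelta_pos
  have hme : ‖m‖ₑ ≠ 0 := by simpa using hm0.ne'
  have hmt : ‖m‖ₑ ≠ ⊤ := enorm_ne_top
  refine ⟨‖m‖ₑ⁻¹ * (2 * rieszConst) + 1, ?_, fun w hw j => ?_⟩
  · exact ENNReal.add_ne_top.2 ⟨(ENNReal.mul_lt_top (by simpa using hm0.ne')
      (ENNReal.mul_lt_top (by simp) rieszConst_lt_top)).ne, by simp⟩
  set A := fun x => ENNReal.ofReal (curlDivSize w x)
  set W := fun x => ‖w j x‖ₑ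
  have hA : Measurable A := (continuous_curlDivSize hw).measurable.ennreal_ofReal
  have hW : Measurable W := (hw j).continuous.measurable.enorm
  set X := (∫⁻ x, W x ^ (3 : ℝ)) ^ (1 / 3 : ℝ) with hX
  set G := (∫⁻ x, A x ^ (3 / 2 : ℝ)) ^ (2 / 3 : ℝ) with hG
  have hbd : ∀ x, ‖m‖ₑ * W x ≤ ∫⁻ y, rieszKernel (x - y) * A y := fun x => by
    rw [← enorm_mul]; exact enorm_apply_le hw j x
  have hXt : X ≠ ⊤ := by
    have h := ((hw j).continuous.memLp_of_hasCompactSupport (p := 3) (μ := volume)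
      (hw j).hasCompactSupport).2
    rw [eLpNorm_eq_lintegral_rpow_enorm_toReal (by norm_num) (by norm_num)] at h
    simpa [hX, W] using h.ne
  have hX3 : ∫⁻ x, W x ^ (3 : ℝ) = X ^ (3 : ℝ) := by
    rw [hX, ← ENNReal.rpow_mul]; norm_num
  have hG3 : ∫⁻ x, A x ^ (3 / 2 : ℝ) = G ^ (3 / 2 : ℝ) := by
    rw [hG, ← ENNReal.rpow_mul]; norm_num
  rcases eq_or_ne X 0 with hX0 | hX0
  · rw [hX0]; exact zero_le
  rcases eq_or_ne G ⊤ with hGt | hGt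
  · rw [hGt, ENNReal.mul_top (by simp)]; exact le_top
  have hG0 : G ≠ 0 := by
    intro h0
    refine hX0 ?_
    rw [h0, ENNReal.zero_rpow_of_pos (by norm_num), lintegral_eq_zero_iff (hA.pow_const _)] at hG3
    have hW0 : ∀ x, W x = 0 := by
      intro x
      have h1 : ∫⁻ y, rieszKernel (x - y) * A y = 0 := by
        refine lintegral_eq_zero_of_ae_eq_zero ?_
        filter_upwards [hG3] with y hy
        have hy' : A y ^ (3 / 2 : ℝ) = 0 := hy
        have : A y = 0 := by
          rcases ENNReal.rpow_eq_zero_iff.1 hy' with h | h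
          · exact h.1
          · exact absurd h.2 (by norm_num)
        simp [this]
      have h2 := hbd x
      rw [h1] at h2
      simpa [hme] using h2
    rw [hX]; simp [hW0]
  have hX2 : X ^ (2 : ℝ) ≠ 0 := by simp [hX0]
  have hX2t : X ^ (2 : ℝ) ≠ ⊤ := by simp [hXt]
  have hf1 : ∫⁻ x, (W x ^ (2 : ℝ) / X ^ (2 : ℝ)) ^ (3 / 2 : ℝ) ≤ 1 := by
    have : ∀ x, (W x ^ (2 : ℝ) / X ^ (2 : ℝ)) ^ (3 / 2 : ℝ) = W x ^ (3 : ℝ) * (X ^ (3 : ℝ))⁻¹ := by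
      intro x
      rw [ENNReal.div_rpow_of_nonneg _ _ (by norm_num), ← ENNReal.rpow_mul, ← ENNReal.rpow_mul,
        div_eq_mul_inv]
      norm_num
    simp_rw [this]
    rw [lintegral_mul_const _ (hW.pow_const _), hX3, ENNReal.mul_inv_cancel (by simp [hX0])
      (by simp [hXt])]
  have hg1 : ∫⁻ x, (A x / G) ^ (3 / 2 : ℝ) ≤ 1 := by
    simp_rw [ENNReal.div_rpow_of_nonneg _ _ (by norm_num : (0 : ℝ) ≤ 3 / 2), div_eq_mul_inv]
    rw [lintegral_mul_const _ (hA.pow_const _)]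
    simp only [← div_eq_mul_inv]
    rw [hG3, ENNReal.div_self (by simp [hG0, hGt]) (by simp [hGt, hG0])]
  have key := lintegral_hls (f := fun x => W x ^ (2 : ℝ) / X ^ (2 : ℝ)) (g := fun x => A x / G)
    ((hW.pow_const _).div_const _) (hA.div_const _)
    (fun x => (ENNReal.div_lt_top (by simp [W]) hX2).ne)
    (fun x => (ENNReal.div_lt_top (by simp [A]) hG0).ne) hf1 hg1
  have h1 : ‖m‖ₑ * X ≤ G * (2 * rieszConst) := by
    calc ‖m‖ₑ * X = ∫⁻ x, W x ^ (2 : ℝ) / X ^ (2 : ℝ) * (‖m‖ₑ * W x) := by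
          have : ∀ x, W x ^ (2 : ℝ) / X ^ (2 : ℝ) * (‖m‖ₑ * W x)
              = ‖m‖ₑ * (X ^ (2 : ℝ))⁻¹ * W x ^ (3 : ℝ) := by
            intro x
            have : W x ^ (3 : ℝ) = W x ^ (2 : ℝ) * W x := by
              rw [show (3 : ℝ) = 2 + 1 by norm_num,
                ENNReal.rpow_add_of_nonneg _ _ (by norm_num) (by norm_num), ENNReal.rpow_one]
            rw [this, div_eq_mul_inv]; ring
          simp_rw [this]
          rw [lintegral_const_mul _ (hW.pow_const _), hX3]
          have : X ^ (3 : ℝ) = X ^ (2 : ℝ) * X := by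
            rw [show (3 : ℝ) = 2 + 1 by norm_num,
              ENNReal.rpow_add_of_nonneg _ _ (by norm_num) (by norm_num), ENNReal.rpow_one]
          rw [this, mul_assoc, ← mul_assoc (X ^ (2 : ℝ))⁻¹, ENNReal.inv_mul_cancel hX2 hX2t,
            one_mul]
      _ ≤ ∫⁻ x, W x ^ (2 : ℝ) / X ^ (2 : ℝ) * ∫⁻ y, rieszKernel (x - y) * A y := by
          refine lintegral_mono fun x => ?_
          gcongr
          exact hbd x
      _ = ∫⁻ x, G * (W x ^ (2 : ℝ) / X ^ (2 : ℝ) * ∫⁻ y, rieszKernel (x - y) * (A y / G)) := by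
          refine lintegral_congr fun x => ?_
          have : ∫⁻ y, rieszKernel (x - y) * (A y / G)
              = (∫⁻ y, rieszKernel (x - y) * A y) * G⁻¹ := by
            rw [← lintegral_mul_const' _ _ (by simpa using hG0)]
            exact lintegral_congr fun y => by rw [div_eq_mul_inv, mul_assoc]
          rw [this]
          set Y := ∫⁻ y, rieszKernel (x - y) * A y
          rw [show G * (W x ^ (2 : ℝ) / X ^ (2 : ℝ) * (Y * G⁻¹))
            = (G * G⁻¹) * (W x ^ (2 : ℝ) / X ^ (2 : ℝ) * Y) by ring,
            ENNReal.mul_inv_cancel hG0 hGt, one_mul]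
      _ = G * ∫⁻ x, W x ^ (2 : ℝ) / X ^ (2 : ℝ) * ∫⁻ y, rieszKernel (x - y) * (A y / G) :=
          lintegral_const_mul' _ _ hGt
      _ ≤ _ := by gcongr
  calc X = ‖m‖ₑ⁻¹ * (‖m‖ₑ * X) := by
        rw [← mul_assoc, ENNReal.inv_mul_cancel hme hmt, one_mul]
    _ ≤ ‖m‖ₑ⁻¹ * (G * (2 * rieszConst)) := by gcongr
    _ = ‖m‖ₑ⁻¹ * (2 * rieszConst) * G := by ring
    _ ≤ _ := by gcongr; exact le_self_add

/-! ### Sobolev estimates on the torus -/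

theorem eLpNorm_ofReal {α : Type*} [MeasurableSpace α] {μ : Measure α} {F : Type*}
    [TopologicalSpace F] [ContinuousENorm F] {p : ℝ} (hp : 0 < p) (f : α → F) :
    eLpNorm f (ENNReal.ofReal p) μ = (∫⁻ x, ‖f x‖ₑ ^ p ∂μ) ^ (1 / p) := by
  rw [eLpNorm_eq_lintegral_rpow_enorm_toReal (by simpa using hp) ENNReal.ofReal_ne_top,
    ENNReal.toReal_ofReal hp.le]

/-- A cutoff function equal to one on the unit ball and supported in the ball of radius two. -/
def cutoff : E3 → ℝ := (⟨1, 2, by norm_num, by norm_num⟩ : ContDiffBump (0 : E3))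

theorem isTestKernel_cutoff : IsTestKernel cutoff :=
  ⟨ContDiffBump.contDiff _, ContDiffBump.hasCompactSupport _⟩

theorem cutoff_eq_one {y : E3} (hy : y ∈ Metric.closedBall (0 : E3) 1) : cutoff y = 1 :=
  ContDiffBump.one_of_mem_closedBall _ hy

theorem abs_cutoff_le (y : E3) : |cutoff y| ≤ 1 := by
  rw [cutoff, abs_of_nonneg (ContDiffBump.nonneg _)]
  exact ContDiffBump.le_one _

theorem support_cutoff : Function.support cutoff ⊆ Metric.closedBall 0 2 := by
  rw [cutoff, ContDiffBump.support_eq]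
  exact Metric.ball_subset_closedBall

theorem kderiv_cutoff_eq_zero {y : E3} (hy : y ∉ Metric.ball (0 : E3) 3) (j : Fin 3) :
    kderiv j cutoff y = 0 := by
  by_contra h
  have := support_kderiv_subset Metric.isClosed_closedBall support_cutoff j h
  simp at this hy
  linarith

theorem cutoff_eq_zero {y : E3} (hy : y ∉ Metric.ball (0 : E3) 3) : cutoff y = 0 := by
  by_contra h
  have := support_cutoff h
  simp at this hy
  linarith

theorem lintegral_T3_le_ball {f : T3 → ℝ≥0∞} (hf : AEMeasurable f) :
    ∫⁻ x, f x ≤ ∫⁻ y in Metric.closedBall (0 : E3) 1, f (toTorus y) := by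
  rw [← lintegral_cube hf (fun _ => -(1 / 2))]
  refine lintegral_mono_set fun y hy => ?_
  rw [mem_closedBall_zero_iff]
  have h1 : ‖y‖ ^ 2 ≤ 1 := by
    rw [EuclideanSpace.norm_sq_eq, Fin.sum_univ_three]
    have : ∀ i, ‖y i‖ ^ 2 ≤ 1 / 4 := by
      intro i
      have h := hy i
      simp only [mem_Ioc] at h
      rw [Real.norm_eq_abs, sq_abs]
      nlinarith [h.1, h.2]
    linarith [this 0, this 1, this 2]
  nlinarith [norm_nonneg y]

theorem eLpNorm_T3_le_of_lift {F G : Type*} [NormedAddCommGroup F] [NormedAddCommGroup G]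
    {H : T3 → F} {g : E3 → G} (hH : AEStronglyMeasurable H) {p : ℝ} (hp : 0 < p)
    (h : ∀ y ∈ Metric.closedBall (0 : E3) 1, ‖H (toTorus y)‖ₑ ≤ ‖g y‖ₑ) :
    eLpNorm H (ENNReal.ofReal p) volume ≤ eLpNorm g (ENNReal.ofReal p) volume := by
  rw [eLpNorm_ofReal hp, eLpNorm_ofReal hp]
  gcongr 1
  refine (lintegral_T3_le_ball (hH.enorm.pow_const p)).trans ?_
  refine (setLIntegral_mono' measurableSet_closedBall fun y hy => ?_).trans
    (setLIntegral_le_lintegral _ _)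
  exact ENNReal.rpow_le_rpow (h y hy) hp.le

theorem eLpNorm_lift_le {F G : Type*} [NormedAddCommGroup F] [NormedAddCommGroup G]
    {H : T3 → F} {g : E3 → G} (hH : AEStronglyMeasurable H) {p : ℝ} (hp : 1 ≤ p)
    (h : ∀ y ∈ Metric.ball (0 : E3) 3, ‖g y‖ₑ ≤ ‖H (toTorus y)‖ₑ)
    (h0 : ∀ y ∉ Metric.ball (0 : E3) 3, g y = 0) :
    eLpNorm g (ENNReal.ofReal p) volume ≤ 216 * eLpNorm H (ENNReal.ofReal p) volume := by
  have hp0 : 0 < p := by linarith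
  rw [eLpNorm_ofReal hp0, eLpNorm_ofReal hp0]
  have h1 : ∫⁻ y, ‖g y‖ₑ ^ p ≤ 216 * ∫⁻ x, ‖H x‖ₑ ^ p := by
    calc ∫⁻ y, ‖g y‖ₑ ^ p ≤ ∫⁻ y in Metric.ball (0 : E3) 3, ‖H (toTorus y)‖ₑ ^ p := by
          rw [← lintegral_indicator measurableSet_ball]
          refine lintegral_mono fun y => ?_
          by_cases hy : y ∈ Metric.ball (0 : E3) 3
          · rw [indicator_of_mem hy]
            exact ENNReal.rpow_le_rpow (h y hy) hp0.le
          · rw [h0 y hy]; simp [hp0]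
      _ ≤ _ := by
          have := lintegral_ball_toTorus_le (hH.enorm.pow_const p) (R := 3) (m := 3) (by norm_num) 0
          norm_num at this ⊢
          exact this
  calc _ ≤ (216 * ∫⁻ x, ‖H x‖ₑ ^ p) ^ (1 / p) := by gcongr
    _ = 216 ^ (1 / p) * (∫⁻ x, ‖H x‖ₑ ^ p) ^ (1 / p) :=
        ENNReal.mul_rpow_of_nonneg _ _ (by positivity)
    _ ≤ _ := by
        gcongr
        nth_rw 2 [← ENNReal.rpow_one 216]
        exact ENNReal.rpow_le_rpow_of_exponent_le (by norm_num)
          ((div_le_one hp0).2 hp)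

theorem kderiv_cutoff_mul {f : T3 → ℝ} (hf : SmoothOnTorus f) (j : Fin 3) (y : E3) :
    kderiv j (fun y => cutoff y * f (toTorus y)) y
      = kderiv j cutoff y * f (toTorus y) + cutoff y * pderiv j f (toTorus y) := by
  have h1 := (isTestKernel_cutoff.contDiff.differentiable (by simp)) y
  rw [kderiv, fderiv_fun_mul h1 (hf.differentiable y), hf.pderiv_toTorus]
  simp [kderiv]; ring

theorem isTestKernel_cutoff_mul {f : T3 → ℝ} (hf : SmoothOnTorus f) :
    IsTestKernel (fun y => cutoff y * f (toTorus y)) :=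
  ⟨isTestKernel_cutoff.contDiff.mul hf, isTestKernel_cutoff.hasCompactSupport.mul_right⟩

theorem exists_kderiv_cutoff_bound : ∃ B : ℝ, 1 ≤ B ∧ ∀ j y, |kderiv j cutoff y| ≤ B := by
  choose C hC using fun j => (isTestKernel_cutoff.kderiv j).exists_bound
  refine ⟨1 + ∑ j, |C j|, by simp [Finset.sum_nonneg], fun j y => (hC j y).trans ?_⟩
  have := Finset.single_le_sum (f := fun j => |C j|) (fun j _ => abs_nonneg _) (Finset.mem_univ j)
  linarith [le_abs_self (C j)]

theorem abs_coord_le_norm (a : E3) (i : Fin 3) : |a i| ≤ ‖a‖ := by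
  simpa using PiLp.norm_apply_le a i

theorem abs_pderiv_sub_pderiv_le_norm_curl (V : T3 → E3) (i j : Fin 3) (x : T3) :
    |pderiv i (fun y => V y j) x - pderiv j (fun y => V y i) x| ≤ ‖curl V x‖ := by
  have h0 := abs_coord_le_norm (curl V x) 0
  have h1 := abs_coord_le_norm (curl V x) 1
  have h2 := abs_coord_le_norm (curl V x) 2
  rw [curl_apply_zero] at h0
  rw [curl_apply_one] at h1
  rw [curl_apply_two] at h2
  have hn := norm_nonneg (curl V x)
  fin_cases i <;> fin_cases j <;> simp only [Fin.zero_eta, Fin.mk_one, Fin.reduceFinMk, sub_self,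
    abs_zero] <;> first | assumption | (rw [abs_sub_comm]; assumption)

theorem curlDivSize_cutoff_le {V : T3 → E3} (hV : SmoothOnTorus V)
    (hd : ∀ x, divergence V x = 0) {B : ℝ} (hB1 : 1 ≤ B)
    (hB : ∀ j y, |kderiv j cutoff y| ≤ B) (y : E3) :
    curlDivSize (fun i y => cutoff y * V (toTorus y) i) y
      ≤ 21 * B * (‖V (toTorus y)‖ + ‖curl V (toTorus y)‖) := by
  set x := toTorus y
  have hk : ∀ i j, kderiv j (fun y => cutoff y * V (toTorus y) i) y
      = kderiv j cutoff y * V x i + cutoff y * pderiv j (fun y => V y i) x :=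
    fun i j => kderiv_cutoff_mul (hV.coord i) j y
  have hn := norm_nonneg (V x)
  have h1 : ∀ i j, |kderiv i (fun y => cutoff y * V (toTorus y) j) y
      - kderiv j (fun y => cutoff y * V (toTorus y) i) y| ≤ 2 * B * ‖V x‖ + ‖curl V x‖ := by
    intro i j
    rw [hk, hk]
    have e : kderiv i cutoff y * V x j + cutoff y * pderiv i (fun y => V y j) x
        - (kderiv j cutoff y * V x i + cutoff y * pderiv j (fun y => V y i) x)
        = kderiv i cutoff y * V x j - kderiv j cutoff y * V x i
          + cutoff y * (pderiv i (fun y => V y j) x - pderiv j (fun y => V y i) x) := by ring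
    rw [e]
    refine (abs_add_le _ _).trans (add_le_add ((abs_sub _ _).trans ?_) ?_)
    · rw [abs_mul, abs_mul]
      have a1 := mul_le_mul (hB i y) (abs_coord_le_norm (V x) j) (abs_nonneg _) (by linarith)
      have a2 := mul_le_mul (hB j y) (abs_coord_le_norm (V x) i) (abs_nonneg _) (by linarith)
      linarith
    · rw [abs_mul]
      have a1 := mul_le_mul (abs_cutoff_le y) (abs_pderiv_sub_pderiv_le_norm_curl V i j x)
        (abs_nonneg _) zero_le_one
      linarith
  have h2 : |∑ i, kderiv i (fun y => cutoff y * V (toTorus y) i) y| ≤ 3 * B * ‖V x‖ := by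
    simp only [hk]
    rw [Finset.sum_add_distrib, ← Finset.mul_sum]
    have : ∑ i, pderiv i (fun y => V y i) x = 0 := hd x
    rw [this, mul_zero, add_zero, Fin.sum_univ_three]
    have a := fun i => mul_le_mul (hB i y) (abs_coord_le_norm (V x) i) (abs_nonneg _)
      (by linarith)
    refine (abs_add_three _ _ _).trans ?_
    simp only [abs_mul]
    linarith [a 0, a 1, a 2]
  rw [curlDivSize]
  have h3 : ∑ i, ∑ j, |kderiv i (fun y => cutoff y * V (toTorus y) j) y
      - kderiv j (fun y => cutoff y * V (toTorus y) i) y|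
      ≤ ∑ _i : Fin 3, ∑ _j : Fin 3, (2 * B * ‖V x‖ + ‖curl V x‖) :=
    Finset.sum_le_sum fun i _ => Finset.sum_le_sum fun j _ => h1 i j
  simp only [Finset.sum_const, Finset.card_univ, Fintype.card_fin, nsmul_eq_mul] at h3
  push_cast at h3
  have hc := norm_nonneg (curl V x)
  nlinarith [mul_nonneg (sub_nonneg.2 hB1) hc]

theorem eLpNorm_le_sum_coord {α : Type*} [MeasurableSpace α] {μ : Measure α} {f : α → E3}
    (hf : AEStronglyMeasurable f μ) {p : ℝ≥0∞} (hp : 1 ≤ p) :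
    eLpNorm f p μ ≤ ∑ i, eLpNorm (fun x => f x i) p μ := by
  have hm : ∀ i : Fin 3, AEStronglyMeasurable (fun x => f x i) μ := fun i =>
    (EuclideanSpace.proj (𝕜 := ℝ) i : E3 →L[ℝ] ℝ).continuous.comp_aestronglyMeasurable hf
  calc eLpNorm f p μ ≤ eLpNorm (∑ i, fun x => ‖f x i‖) p μ := by
        refine eLpNorm_mono_real fun x => ?_
        have e : f x = ∑ i, (f x i) • basisVec i := by
          ext j; simp [Pi.single_apply]
        conv_lhs => rw [e]
        refine (norm_sum_le _ _).trans_eq ?_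
        simp [norm_smul, Finset.sum_apply]
    _ ≤ ∑ i, eLpNorm (fun x => ‖f x i‖) p μ := eLpNorm_sum_le (fun i _ => (hm i).norm) hp
    _ = _ := by simp_rw [eLpNorm_norm]

/-- Divergence free vector fields on the torus are controlled in `L³` by their curl
in `L^{3/2}`. -/
theorem exists_eLpNorm_three_le_curl : ∃ C : ℝ≥0∞, C ≠ ⊤ ∧ ∀ V : T3 → E3, SmoothOnTorus V →
    (∀ x, divergence V x = 0) → eLpNorm V (ENNReal.ofReal 3) volume
      ≤ C * (eLpNorm V (ENNReal.ofReal (3 / 2)) volume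
        + eLpNorm (curl V) (ENNReal.ofReal (3 / 2)) volume) := by
  obtain ⟨C, hC, h⟩ := exists_lintegral_le_curlDivSize
  obtain ⟨B, hB1, hB⟩ := exists_kderiv_cutoff_bound
  refine ⟨3 * (C * (216 * ENNReal.ofReal (21 * B))), by finiteness, fun V hV hd => ?_⟩
  set w : Fin 3 → E3 → ℝ := fun i y => cutoff y * V (toTorus y) i with hwdef
  have hw : ∀ i, IsTestKernel (w i) := fun i => isTestKernel_cutoff_mul (hV.coord i)
  have h1 : eLpNorm (curlDivSize w) (ENNReal.ofReal (3 / 2)) volume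
      ≤ 216 * (ENNReal.ofReal (21 * B) * (eLpNorm V (ENNReal.ofReal (3 / 2)) volume
        + eLpNorm (curl V) (ENNReal.ofReal (3 / 2)) volume)) := by
    have hHc : Continuous fun x => (21 * B) • (‖V x‖ + ‖curl V x‖) := by
      have c1 := hV.continuous
      have c2 := hV.curl.continuous
      fun_prop
    refine (eLpNorm_lift_le (H := fun x => (21 * B) • (‖V x‖ + ‖curl V x‖))
      hHc.aestronglyMeasurable (by norm_num) (fun y _ => ?_) (fun y hy => ?_)).trans ?_
    · rw [enorm_le_iff_norm_le, Real.norm_of_nonneg, Real.norm_of_nonneg]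
      · exact curlDivSize_cutoff_le hV hd hB1 hB y
      · positivity
      · unfold curlDivSize; positivity
    · have h0 : ∀ i j, kderiv j (w i) y = 0 := by
        intro i j
        have := kderiv_cutoff_mul (hV.coord i) j y
        rw [kderiv_cutoff_eq_zero hy, cutoff_eq_zero hy] at this
        simpa using this
      simp [curlDivSize, h0]
    · gcongr
      have e : (fun x => (21 * B) • (‖V x‖ + ‖curl V x‖))
          = (21 * B) • ((fun x => ‖V x‖) + fun x => ‖curl V x‖) := rfl
      rw [e, eLpNorm_const_smul, ← eLpNorm_norm V, ← eLpNorm_norm (curl V)]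
      have hb : ‖(21 * B : ℝ)‖ₑ = ENNReal.ofReal (21 * B) :=
        Real.enorm_of_nonneg (by linarith)
      rw [hb]
      gcongr
      exact eLpNorm_add_le hV.continuous.norm.aestronglyMeasurable
        hV.curl.continuous.norm.aestronglyMeasurable (by
          rw [← ENNReal.ofReal_one]; exact ENNReal.ofReal_le_ofReal (by norm_num))
  have h2 : ∀ j, eLpNorm (fun x => V x j) (ENNReal.ofReal 3) volume
      ≤ C * eLpNorm (curlDivSize w) (ENNReal.ofReal (3 / 2)) volume := by
    intro j
    refine (eLpNorm_T3_le_of_lift (g := w j) (hV.coord j).continuous.aestronglyMeasurable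
      (by norm_num) fun y hy => ?_).trans ?_
    · rw [hwdef]; simp [cutoff_eq_one hy]
    · have := h w hw j
      rw [eLpNorm_ofReal (by norm_num), eLpNorm_ofReal (by norm_num)]
      have e : ∀ x, ‖curlDivSize w x‖ₑ = ENNReal.ofReal (curlDivSize w x) := fun x =>
        Real.enorm_of_nonneg (by unfold curlDivSize; positivity)
      simp_rw [e]
      norm_num at this ⊢
      exact this
  calc eLpNorm V (ENNReal.ofReal 3) volume
      ≤ ∑ j, eLpNorm (fun x => V x j) (ENNReal.ofReal 3) volume :=
        eLpNorm_le_sum_coord hV.continuous.aestronglyMeasurable (by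
          rw [← ENNReal.ofReal_one]; exact ENNReal.ofReal_le_ofReal (by norm_num))
    _ ≤ ∑ _j : Fin 3, C * (216 * (ENNReal.ofReal (21 * B)
          * (eLpNorm V (ENNReal.ofReal (3 / 2)) volume
        + eLpNorm (curl V) (ENNReal.ofReal (3 / 2)) volume))) :=
        Finset.sum_le_sum fun j _ => (h2 j).trans (by gcongr)
    _ = _ := by simp; ring

theorem eLpNorm_le_of_mollify_le {F : Type*} [NormedAddCommGroup F] [NormedSpace ℝ F]
    [CompleteSpace F] {f : T3 → F} (hf : Integrable f) {q K : ℝ≥0∞}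
    (h : ∀ ε : ℝ, 0 < ε → eLpNorm (mollify (eta ε) f) q volume ≤ K) :
    eLpNorm f q volume ≤ K := by
  have h1 := tendsto_eLpNorm_mollify_eta_sub (f := f) le_rfl
    (by rwa [ENNReal.ofReal_one, memLp_one_iff_integrable])
  have hseq : Tendsto (fun n : ℕ => (1 : ℝ) / (n + 1)) atTop (𝓝[>] 0) :=
    tendsto_nhdsWithin_iff.2 ⟨tendsto_one_div_add_atTop_nhds_zero_nat,
      Eventually.of_forall fun n => by simp only [mem_Ioi]; positivity⟩
  have hpos : ∀ n : ℕ, (0 : ℝ) < 1 / (n + 1) := fun n => by positivity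
  have hm : ∀ n : ℕ, AEStronglyMeasurable (mollify (eta (1 / (n + 1))) f) volume := fun n =>
    (smoothOnTorus_mollify (isTestKernel_eta (hpos n)) hf).continuous.aestronglyMeasurable
  have h2 := tendstoInMeasure_of_tendsto_eLpNorm (p := ENNReal.ofReal 1) (by simp) hm hf.1
    (h1.comp hseq)
  obtain ⟨ns, hns, hae⟩ := h2.exists_seq_tendsto_ae
  refine (Lp.eLpNorm_lim_le_liminf_eLpNorm (fun n => hm (ns n)) f hae).trans ?_
  refine liminf_le_of_frequently_le' (Frequently.of_forall fun n => h _ (hpos _))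

theorem one_le_ofReal {p : ℝ} (hp : 1 ≤ p) : 1 ≤ ENNReal.ofReal p := by
  rw [← ENNReal.ofReal_one]
  exact ENNReal.ofReal_le_ofReal hp

theorem norm_le_sum_norm_apply_basisVec {F : Type*} [NormedAddCommGroup F] [NormedSpace ℝ F]
    (L : E3 →L[ℝ] F) : ‖L‖ ≤ ∑ j, ‖L (basisVec j)‖ := by
  refine L.opNorm_le_bound (by positivity) fun x => ?_
  have e : x = ∑ j, (x j) • basisVec j := by
    ext j; simp [Pi.single_apply]
  conv_lhs => rw [e, map_sum]
  refine (norm_sum_le _ _).trans ?_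
  rw [Finset.sum_mul]
  refine Finset.sum_le_sum fun j _ => ?_
  rw [map_smul, norm_smul, mul_comm]
  gcongr
  exact abs_coord_le_norm x j

/-- The Gagliardo–Nirenberg–Sobolev inequality for smooth vector fields on the torus. -/
theorem exists_eLpNorm_le_pderiv {r s : ℝ} (hr : 1 ≤ r) (hs : 0 < s) (hrs : s⁻¹ = r⁻¹ - 3⁻¹) :
    ∃ C : ℝ≥0∞, C ≠ ⊤ ∧ ∀ V : T3 → E3, SmoothOnTorus V →
      eLpNorm V (ENNReal.ofReal s) volume
        ≤ C * (eLpNorm V (ENNReal.ofReal r) volume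
          + ∑ j, eLpNorm (pderiv j V) (ENNReal.ofReal r) volume) := by
  obtain ⟨B, hB1, hB⟩ := exists_kderiv_cutoff_bound
  refine ⟨SNormLESNormFDerivOfEqConst E3 (volume : Measure E3) r.toNNReal
    * (216 * ENNReal.ofReal (3 * B)), by finiteness, fun V hV => ?_⟩
  have hVd : ∀ j, Continuous (pderiv j V) := fun j => (hV.pderiv j).continuous
  set w : E3 → E3 := fun y => cutoff y • V (toTorus y) with hw
  have hwc : ContDiff ℝ ((⊤ : ℕ∞) : WithTop ℕ∞) w := isTestKernel_cutoff.contDiff.smul hV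
  have hws : HasCompactSupport w := isTestKernel_cutoff.hasCompactSupport.smul_right
  have hgns := eLpNorm_le_eLpNorm_fderiv_of_eq (volume : Measure E3) (u := w)
    (hwc.of_le (by simp)) hws (p := r.toNNReal) (p' := s.toNNReal) (by simpa using hr)
    (by simp) (by
      simp only [finrank_euclideanSpace, Fintype.card_fin]
      rw [NNReal.coe_inv, Real.coe_toNNReal s hs.le, Real.coe_toNNReal r (by linarith)]
      exact_mod_cast hrs)
  have hfd : ∀ y j, fderiv ℝ w y (basisVec j)
      = kderiv j cutoff y • V (toTorus y) + cutoff y • pderiv j V (toTorus y) := by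
    intro y j
    have h1 := (isTestKernel_cutoff.contDiff.differentiable (by simp)) y
    rw [hw, fderiv_fun_smul h1 (hV.differentiable y), hV.pderiv_toTorus]
    simp [kderiv, add_comm]
  set H : T3 → ℝ := fun x => (3 * B) • (‖V x‖ + ∑ j, ‖pderiv j V x‖) with hH
  have hHc : Continuous H := by
    have := hV.continuous
    fun_prop
  have h1 : eLpNorm (fderiv ℝ w) (ENNReal.ofReal r) volume
      ≤ 216 * eLpNorm H (ENNReal.ofReal r) volume := by
    refine eLpNorm_lift_le hHc.aestronglyMeasurable hr (fun y _ => ?_) (fun y hy => ?_)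
    · have hS : 0 ≤ ∑ j, ‖pderiv j V (toTorus y)‖ := by positivity
      rw [enorm_le_iff_norm_le, Real.norm_of_nonneg (by positivity)]
      calc ‖fderiv ℝ w y‖ ≤ ∑ j, ‖fderiv ℝ w y (basisVec j)‖ := norm_le_sum_norm_apply_basisVec _
        _ ≤ ∑ j : Fin 3, (B * ‖V (toTorus y)‖ + 1 * ‖pderiv j V (toTorus y)‖) := by
            refine Finset.sum_le_sum fun j _ => ?_
            rw [hfd]
            refine (norm_add_le _ _).trans ?_
            rw [norm_smul, norm_smul]
            gcongr
            · exact hB j y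
            · exact abs_cutoff_le y
        _ ≤ _ := by
            rw [Finset.sum_add_distrib]
            simp only [Finset.sum_const, Finset.card_univ, Fintype.card_fin, nsmul_eq_mul, one_mul]
            push_cast
            simp only [hH, smul_eq_mul]
            nlinarith
    · refine norm_le_zero_iff.1 ((norm_le_sum_norm_apply_basisVec _).trans_eq ?_)
      refine Finset.sum_eq_zero fun j _ => ?_
      rw [hfd, kderiv_cutoff_eq_zero hy, cutoff_eq_zero hy]
      simp
  have h2 : eLpNorm H (ENNReal.ofReal r) volume
      ≤ ENNReal.ofReal (3 * B) * (eLpNorm V (ENNReal.ofReal r) volume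
          + ∑ j, eLpNorm (pderiv j V) (ENNReal.ofReal r) volume) := by
    have e : H = (3 * B) • ((fun x => ‖V x‖) + ∑ j, fun x => ‖pderiv j V x‖) := by
      ext x; simp [hH, Finset.sum_apply]
    rw [e, eLpNorm_const_smul, Real.enorm_of_nonneg (by positivity)]
    gcongr
    refine (eLpNorm_add_le hV.continuous.norm.aestronglyMeasurable
      (Finset.aestronglyMeasurable_sum _ fun j _ => (hVd j).norm.aestronglyMeasurable)
      (one_le_ofReal hr)).trans ?_
    rw [eLpNorm_norm]
    gcongr
    refine (eLpNorm_sum_le (fun j _ => (hVd j).norm.aestronglyMeasurable)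
      (one_le_ofReal hr)).trans_eq ?_
    simp_rw [eLpNorm_norm]
  calc eLpNorm V (ENNReal.ofReal s) volume ≤ eLpNorm w (ENNReal.ofReal s) volume := by
        refine eLpNorm_T3_le_of_lift hV.continuous.aestronglyMeasurable hs fun y hy => ?_
        simp [hw, cutoff_eq_one hy]
    _ ≤ _ := hgns
    _ ≤ SNormLESNormFDerivOfEqConst E3 (volume : Measure E3) r.toNNReal
        * (216 * (ENNReal.ofReal (3 * B) * (eLpNorm V (ENNReal.ofReal r) volume
          + ∑ j, eLpNorm (pderiv j V) (ENNReal.ofReal r) volume))) := by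
        gcongr
        exact h1.trans (by gcongr)
    _ = _ := by ring

theorem exists_eLpNorm_le_weakPartial {r s : ℝ} (hr : 1 ≤ r) (hs : 0 < s)
    (hrs : s⁻¹ = r⁻¹ - 3⁻¹) :
    ∃ C : ℝ≥0∞, C ≠ ⊤ ∧ ∀ (u : T3 → E3) (g : Fin 3 → T3 → E3), (∀ j, IsWeakPartial j u (g j)) →
      eLpNorm u (ENNReal.ofReal s) volume
        ≤ C * (eLpNorm u (ENNReal.ofReal r) volume
          + ∑ j, eLpNorm (g j) (ENNReal.ofReal r) volume) := by
  obtain ⟨C, hC, h⟩ := exists_eLpNorm_le_pderiv hr hs hrs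
  refine ⟨C, hC, fun u g hg => eLpNorm_le_of_mollify_le (hg 0).1 fun ε hε => ?_⟩
  have hk := isTestKernel_eta hε
  refine (h _ (smoothOnTorus_mollify hk (hg 0).1)).trans ?_
  gcongr with j
  · exact eLpNorm_mollify_eta_le (hg 0).1.1 hε hr
  · rw [(hg j).pderiv_mollify hk]
    exact eLpNorm_mollify_eta_le (hg j).2.1.1 hε hr

theorem exists_eLpNorm_three_le_weakCurl :
    ∃ C : ℝ≥0∞, C ≠ ⊤ ∧ ∀ u w : T3 → E3, IsWeakCurl u w → IsWeakDivFree u →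
      eLpNorm u (ENNReal.ofReal 3) volume
        ≤ C * (eLpNorm u (ENNReal.ofReal (3 / 2)) volume
          + eLpNorm w (ENNReal.ofReal (3 / 2)) volume) := by
  obtain ⟨C, hC, h⟩ := exists_eLpNorm_three_le_curl
  refine ⟨C, hC, fun u w hc hd => eLpNorm_le_of_mollify_le hc.1 fun ε hε => ?_⟩
  have hk := isTestKernel_eta hε
  refine (h _ (smoothOnTorus_mollify hk hc.1) (hd.divergence_mollify hc.1 hk)).trans ?_
  rw [hc.curl_mollify hk]
  gcongr
  · exact eLpNorm_mollify_eta_le hc.1.1 hε (by norm_num)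
  · exact eLpNorm_mollify_eta_le hc.2.1.1 hε (by norm_num)

/-! ### Consequences of the weak formulation at fixed times -/

theorem eqOn_zero_of_integral_smooth_mul {T : ℝ} (hT : 0 < T) {F : ℝ → ℝ}
    (hF : ContinuousOn F (Icc 0 T))
    (h : ∀ g : ℝ → ℝ, ContDiff ℝ ((⊤ : ℕ∞) : WithTop ℕ∞) g → ∫ t in (0 : ℝ)..T, g t * F t = 0) :
    ∀ t ∈ Icc 0 T, F t = 0 := by
  have h1 : ∀ᵐ t, t ∈ Ioo 0 T → F t = 0 := by
    refine isOpen_Ioo.ae_eq_zero_of_integral_contDiff_smul_eq_zero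
      ((hF.mono Ioo_subset_Icc_self).locallyIntegrableOn measurableSet_Ioo) fun g hg _ hs => ?_
    rw [← h g hg, intervalIntegral.integral_of_le hT.le, integral_Ioc_eq_integral_Ioo,
      setIntegral_eq_integral_of_forall_compl_eq_zero]
    · simp
    · intro t ht
      rw [image_eq_zero_of_notMem_tsupport fun h' => ht (hs h'), zero_mul]
  have h2 : F =ᵐ[volume.restrict (Icc 0 T)] fun _ => 0 := by
    rw [Measure.restrict_congr_set Ioo_ae_eq_Icc.symm]
    exact (ae_restrict_iff' measurableSet_Ioo).2 h1
  exact fun t ht => Measure.eqOn_Icc_of_ae_eq volume hT.ne h2 hF continuousOn_const ht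

theorem contDiff_primitive {g : ℝ → ℝ} (hg : ContDiff ℝ ((⊤ : ℕ∞) : WithTop ℕ∞) g) :
    ContDiff ℝ ((⊤ : ℕ∞) : WithTop ℕ∞) (fun t => ∫ s in (0 : ℝ)..t, g s) := by
  rw [contDiff_infty_iff_deriv]
  have hd : ∀ t, HasDerivAt (fun t => ∫ s in (0 : ℝ)..t, g s) (g t) t := fun t =>
    intervalIntegral.integral_hasDerivAt_right (hg.continuous.intervalIntegrable _ _)
      (hg.continuous.stronglyMeasurableAtFilter _ _) hg.continuous.continuousAt
  refine ⟨fun t => (hd t).differentiableAt, ?_⟩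
  rwa [show deriv (fun t => ∫ s in (0 : ℝ)..t, g s) = g from funext fun t => (hd t).deriv]

theorem sub_eq_integral_of_weak_deriv {T : ℝ} (hT : 0 < T) {A b : ℝ → ℝ}
    (hA : ContinuousOn A (Icc 0 T)) (hb : IntervalIntegrable b volume 0 T)
    (h : ∀ χ : ℝ → ℝ, ContDiff ℝ ((⊤ : ℕ∞) : WithTop ℕ∞) χ →
      χ T * A T - χ 0 * A 0 = ∫ t in (0 : ℝ)..T, (deriv χ t * A t + χ t * b t)) :
    ∀ t ∈ Icc 0 T, A t - A 0 = ∫ s in (0 : ℝ)..t, b s := by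
  set B : ℝ → ℝ := fun t => ∫ s in (0 : ℝ)..t, b s with hB
  have hBac : AbsolutelyContinuousOnInterval B 0 T :=
    hb.absolutelyContinuousOnInterval_intervalIntegral (by simp)
  have hBc : ContinuousOn B (Icc 0 T) := by simpa [hT.le] using hBac.continuousOn
  have hAi : IntervalIntegrable A volume 0 T :=
    (by simpa [hT.le] using hA : ContinuousOn A (uIcc 0 T)).intervalIntegrable
  have hBi : IntervalIntegrable B volume 0 T := hBac.continuousOn.intervalIntegrable
  have hz : ∀ t ∈ Icc 0 T, A t - B t - (A T - B T) = 0 := by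
    refine eqOn_zero_of_integral_smooth_mul hT ((hA.sub hBc).sub continuousOn_const)
      fun g hg => ?_
    set χ : ℝ → ℝ := fun t => ∫ s in (0 : ℝ)..t, g s with hχ
    have hχs := contDiff_primitive hg
    have hd : ∀ t, HasDerivAt χ (g t) t := fun t =>
      intervalIntegral.integral_hasDerivAt_right (hg.continuous.intervalIntegrable _ _)
        (hg.continuous.stronglyMeasurableAtFilter _ _) hg.continuous.continuousAt
    have hχc : ContinuousOn χ (uIcc 0 T) := hχs.continuous.continuousOn
    have hχac : AbsolutelyContinuousOnInterval χ 0 T :=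
      ((hχs.of_le (by simp) : ContDiff ℝ 1 χ).contDiffOn).absolutelyContinuousOnInterval
    have h0 : χ 0 = 0 := by simp [hχ]
    have hχT : ∫ t in (0 : ℝ)..T, g t * (A T - B T) = χ T * (A T - B T) :=
      intervalIntegral.integral_mul_const _ _
    have e1 : ∫ t in (0 : ℝ)..T, χ t * b t = χ T * B T - ∫ t in (0 : ℝ)..T, g t * B t := by
      have := hχac.integral_mul_deriv_eq_deriv_mul hBac
      rw [h0, zero_mul, sub_zero] at this
      simp_rw [fun t => (hd t).deriv] at this
      rw [← this]
      refine intervalIntegral.integral_congr_ae ?_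
      filter_upwards [hb.ae_hasDerivAt_integral] with t ht htm
      rw [(ht (uIoc_subset_uIcc htm) 0 (by simp)).deriv]
    have gA : IntervalIntegrable (fun t => g t * A t) volume 0 T :=
      hAi.continuousOn_mul hg.continuous.continuousOn
    have gB : IntervalIntegrable (fun t => g t * B t) volume 0 T :=
      hBi.continuousOn_mul hg.continuous.continuousOn
    have gC : IntervalIntegrable (fun t => g t * (A T - B T)) volume 0 T :=
      (hg.continuous.mul continuous_const).intervalIntegrable _ _
    have h1 := h χ hχs
    simp_rw [fun t => (hd t).deriv] at h1
    rw [intervalIntegral.integral_add gA (hb.continuousOn_mul hχc), e1, h0] at h1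
    simp_rw [mul_sub] at hχT gC ⊢
    have e2 : ∀ t, g t * A t - g t * B t - (g t * A T - g t * B T)
        = (g t * A t - g t * B t) - (g t * A T - g t * B T) := fun t => rfl
    rw [intervalIntegral.integral_sub (gA.sub gB) gC, intervalIntegral.integral_sub gA gB, hχT]
    linarith
  intro t ht
  have h1 := hz t ht
  have h2 := hz 0 ⟨le_rfl, hT.le⟩
  have h3 : B 0 = 0 := by simp [hB]
  linarith

theorem SmoothOnTorus.smoothSpaceTime_smul {F : Type*} [NormedAddCommGroup F] [NormedSpace ℝ F]
    {ψ : T3 → F} (hψ : SmoothOnTorus ψ) {χ : ℝ → ℝ}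
    (hχ : ContDiff ℝ ((⊤ : ℕ∞) : WithTop ℕ∞) χ) : SmoothSpaceTime (fun t x => χ t • ψ x) :=
  (hχ.comp contDiff_fst).smul (hψ.comp contDiff_snd)

theorem SmoothOnTorus.pderiv_const_smul {F : Type*} [NormedAddCommGroup F] [NormedSpace ℝ F]
    {ψ : T3 → F} (hψ : SmoothOnTorus ψ) (c : ℝ) (j : Fin 3) (x : T3) :
    EulerTorus.pderiv j (fun y => c • ψ y) x = c • EulerTorus.pderiv j ψ x :=
  hψ.pderiv_clm (c • ContinuousLinearMap.id ℝ F) j x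

/-- The transport term `∫ u ⊗ u : ∇φ`. -/
def transport (u φ : T3 → E3) : ℝ := ∫ x, ∑ i, ∑ j, u x i * u x j * pderiv j (fun y => φ y i) x

theorem integrable_mul_continuous {f g : T3 → ℝ} (hf : Integrable f) (hg : Continuous g) :
    Integrable fun x => f x * g x := by
  obtain ⟨C, hC⟩ := isCompact_univ.exists_bound_of_continuousOn hg.continuousOn
  exact hf.mul_bdd hg.aestronglyMeasurable (Eventually.of_forall fun x => hC x (mem_univ x))

theorem integrable_inner_continuous {u φ : T3 → E3} (hu : Integrable u) (hφ : Continuous φ) :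
    Integrable fun x => (inner ℝ (u x) (φ x) : ℝ) := by
  have h : ∀ i, Continuous fun x => φ x i := fun i =>
    (EuclideanSpace.proj (𝕜 := ℝ) i : E3 →L[ℝ] ℝ).continuous.comp hφ
  simp_rw [inner_E3]
  exact ((integrable_mul_continuous (hu.coord 0) (h 0)).add
    (integrable_mul_continuous (hu.coord 1) (h 1))).add
    (integrable_mul_continuous (hu.coord 2) (h 2))

theorem MemLp.coord {u : T3 → E3} {p : ℝ≥0∞} (hu : MemLp u p volume) (i : Fin 3) :
    MemLp (fun x => u x i) p volume :=
  (EuclideanSpace.proj (𝕜 := ℝ) i : E3 →L[ℝ] ℝ).comp_memLp' hu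

theorem integrable_transport_term {u : T3 → E3} (hu : MemLp u 2 volume) {g : T3 → ℝ}
    (hg : Continuous g) (i j : Fin 3) : Integrable fun x => u x i * u x j * g x := by
  exact integrable_mul_continuous ((MemLp.coord hu i).integrable_mul (MemLp.coord hu j)) hg

theorem integrable_transport {u φ : T3 → E3} (hu : MemLp u 2 volume) (hφ : SmoothOnTorus φ) :
    Integrable fun x => ∑ i, ∑ j, u x i * u x j * pderiv j (fun y => φ y i) x :=
  integrable_finsetSum _ fun i _ => integrable_finsetSum _ fun j _ =>
    integrable_transport_term hu ((hφ.coord i).pderiv j).continuous i j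

theorem transport_sub {u φ ψ : T3 → E3} (hu : MemLp u 2 volume) (hφ : SmoothOnTorus φ)
    (hψ : SmoothOnTorus ψ) :
    transport u (fun x => φ x - ψ x) = transport u φ - transport u ψ := by
  rw [transport, transport, transport,
    ← integral_sub (integrable_transport hu hφ) (integrable_transport hu hψ)]
  congr 1
  ext x
  simp_rw [← Finset.sum_sub_distrib, ← mul_sub]
  refine Finset.sum_congr rfl fun i _ => Finset.sum_congr rfl fun j _ => ?_
  rw [← (hφ.coord i).pderiv_sub (hψ.coord i)]
  rfl

theorem abs_transport_le {u φ : T3 → E3} (hu : MemLp u 2 volume) {K : ℝ}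
    (hK : ∀ i j x, |pderiv j (fun y => φ y i) x| ≤ K) :
    |transport u φ| ≤ 9 * K * ∫ x, ‖u x‖ ^ 2 := by
  rw [transport, ← Real.norm_eq_abs, ← integral_const_mul]
  refine norm_integral_le_of_norm_le (hu.integrable_norm_pow (by norm_num) |>.const_mul _)
    (Eventually.of_forall fun x => ?_)
  have : ∀ i j, ‖u x i * u x j * pderiv j (fun y => φ y i) x‖ ≤ K * ‖u x‖ ^ 2 := by
    intro i j
    rw [Real.norm_eq_abs, abs_mul, abs_mul]
    have hn := norm_nonneg (u x)
    calc |u x i| * |u x j| * |pderiv j (fun y => φ y i) x|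
        ≤ ‖u x‖ * ‖u x‖ * K := by
          gcongr
          · exact abs_coord_le_norm _ _
          · exact abs_coord_le_norm _ _
          · exact hK i j x
      _ = _ := by ring
  refine (norm_sum_le _ _).trans ((Finset.sum_le_sum fun i _ => (norm_sum_le _ _).trans
    (Finset.sum_le_sum fun j _ => this i j)).trans_eq ?_)
  simp; ring

namespace IsWeakEulerSolution

variable {T : ℝ} {v : ℝ → T3 → E3} {P : ℝ → T3 → ℝ}

theorem isWeakDivFree (hv : IsWeakEulerSolution T v P) (hT : 0 < T) :
    ∀ t ∈ Icc 0 T, IsWeakDivFree (v t) := by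
  intro t ht ψ hψ
  have hg : ∀ t, ∫ x, ∑ i, v t x i * pderiv i ψ x = ∫ x, (inner ℝ (v t x) (grad ψ x) : ℝ) := by
    intro t; simp_rw [inner_grad]
  refine eqOn_zero_of_integral_smooth_mul (F := fun t => ∫ x, ∑ i, v t x i * pderiv i ψ x)
    hT ?_ (fun χ hχ => ?_) t ht
  · simp_rw [hg]
    exact hv.weak_continuous _ (memLp_of_continuous hψ.grad.continuous _)
  · refine Eq.trans ?_ (hv.div_free _ (hψ.smoothSpaceTime_smul hχ))
    refine intervalIntegral.integral_congr fun t _ => ?_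
    simp only
    rw [← integral_const_mul]
    congr 1; ext x
    rw [Finset.mul_sum]
    refine Finset.sum_congr rfl fun i _ => ?_
    rw [hψ.pderiv_const_smul, smul_eq_mul]
    ring

theorem exists_energy_bound (hv : IsWeakEulerSolution T v P) :
    ∃ M : ℝ, ∀ t ∈ Icc 0 T, ∫ x, ‖v t x‖ ^ 2 ≤ M := by
  have hb := banach_steinhaus (𝕜 := ℝ) (𝕜₂ := ℝ) (σ₁₂ := RingHom.id ℝ)
    (E := Lp E3 2 (volume : Measure T3)) (F := ℝ)
    (g := fun t : Icc 0 T => innerSL ℝ ((hv.memLp_two t t.2).toLp (v t))) (fun g => by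
      obtain ⟨C, hC⟩ := isCompact_Icc.exists_bound_of_continuousOn
        (hv.weak_continuous g (Lp.memLp g))
      refine ⟨C, fun t => ?_⟩
      have e : innerSL ℝ ((hv.memLp_two t t.2).toLp (v t)) g = ∫ x, inner ℝ (v t x) (g x) := by
        rw [innerSL_apply_apply, L2.inner_def]
        refine integral_congr_ae ?_
        filter_upwards [(hv.memLp_two t t.2).coeFn_toLp] with x hx
        rw [hx]
      rw [e]
      exact hC t t.2)
  obtain ⟨C, hC⟩ := hb
  refine ⟨C ^ 2, fun t ht => ?_⟩
  have h1 := hC ⟨t, ht⟩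
  rw [innerSL_apply_norm] at h1
  have h2 : ∫ x, ‖v t x‖ ^ 2 = ‖(hv.memLp_two t ht).toLp (v t)‖ ^ 2 := by
    rw [← real_inner_self_eq_norm_sq, L2.inner_def]
    refine integral_congr_ae ?_
    filter_upwards [(hv.memLp_two t ht).coeFn_toLp] with x hx
    rw [hx, real_inner_self_eq_norm_sq]
  rw [h2]
  gcongr

theorem aestronglyMeasurable_transport (hv : IsWeakEulerSolution T v P) {Φ : ℝ → T3 → E3}
    (hΦ : ∀ i j, AEStronglyMeasurable
      (fun z : ℝ × T3 => pderiv j (fun y => Φ z.1 y i) z.2)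
      ((volume.restrict (Icc 0 T)).prod volume)) :
    AEStronglyMeasurable (fun t => transport (v t) (Φ t)) (volume.restrict (Icc 0 T)) := by
  have hc : ∀ i : Fin 3, AEStronglyMeasurable (fun z : ℝ × T3 => v z.1 z.2 i)
      ((volume.restrict (Icc 0 T)).prod volume) := fun i =>
    (EuclideanSpace.proj (𝕜 := ℝ) i : E3 →L[ℝ] ℝ).continuous.comp_aestronglyMeasurable
      hv.measurable
  have : AEStronglyMeasurable (fun z : ℝ × T3 => ∑ i, ∑ j, v z.1 z.2 i * v z.1 z.2 j
      * pderiv j (fun y => Φ z.1 y i) z.2) ((volume.restrict (Icc 0 T)).prod volume) :=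
    Finset.aestronglyMeasurable_fun_sum _ fun i _ => Finset.aestronglyMeasurable_fun_sum _
      fun j _ => ((hc i).mul (hc j)).mul (hΦ i j)
  exact this.integral_prod_right'

theorem intervalIntegrable_transport (hv : IsWeakEulerSolution T v P) (hT : 0 < T)
    {Φ : ℝ → T3 → E3} (hΦ : ∀ i j, AEStronglyMeasurable
      (fun z : ℝ × T3 => pderiv j (fun y => Φ z.1 y i) z.2)
      ((volume.restrict (Icc 0 T)).prod volume)) {K : ℝ}
    (hK : ∀ t ∈ Icc 0 T, ∀ i j x, |pderiv j (fun y => Φ t y i) x| ≤ K) :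
    IntervalIntegrable (fun t => transport (v t) (Φ t)) volume 0 T := by
  obtain ⟨M, hM⟩ := hv.exists_energy_bound
  rw [intervalIntegrable_iff_integrableOn_Icc_of_le hT.le]
  refine Integrable.of_bound (hv.aestronglyMeasurable_transport hΦ) (9 * K * M) ?_
  refine (ae_restrict_iff' measurableSet_Icc).2 (Eventually.of_forall fun t ht => ?_)
  have hK0 : 0 ≤ K := (abs_nonneg _).trans (hK t ht 0 0 0)
  exact (abs_transport_le (hv.memLp_two t ht) (hK t ht)).trans (by gcongr; exact hM t ht)

theorem integral_inner_sub_eq (hv : IsWeakEulerSolution T v P) (hT : 0 < T) {φ : T3 → E3}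
    (hφ : SmoothOnTorus φ) (hd : ∀ x, divergence φ x = 0) {s t : ℝ} (hs : s ∈ Icc 0 T)
    (ht : t ∈ Icc 0 T) :
    (∫ x, (inner ℝ (v t x) (φ x) : ℝ)) - ∫ x, (inner ℝ (v s x) (φ x) : ℝ)
      = ∫ τ in s..t, transport (v τ) φ := by
  have hc : ∀ i j, Continuous (pderiv j (fun y => φ y i)) := fun i j =>
    ((hφ.coord i).pderiv j).continuous
  have hbd : ∃ K : ℝ, ∀ i j x, |pderiv j (fun y => φ y i) x| ≤ K := by
    choose C hC using fun i j => isCompact_univ.exists_bound_of_continuousOn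
      (hc i j).continuousOn
    refine ⟨∑ i, ∑ j, |C i j|, fun i j x => ((hC i j x (mem_univ x)).trans
      (le_abs_self _)).trans ?_⟩
    refine (Finset.single_le_sum (f := fun j => |C i j|) (fun _ _ => abs_nonneg _)
      (Finset.mem_univ j)).trans ?_
    exact Finset.single_le_sum (f := fun i => ∑ j, |C i j|)
      (fun _ _ => Finset.sum_nonneg fun _ _ => abs_nonneg _) (Finset.mem_univ i)
  obtain ⟨K, hK⟩ := hbd
  have hbi : IntervalIntegrable (fun t => transport (v t) φ) volume 0 T :=
    hv.intervalIntegrable_transport hT (Φ := fun _ => φ)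
      (fun i j => ((hc i j).comp continuous_snd).aestronglyMeasurable) (fun t _ => hK)
  have key := sub_eq_integral_of_weak_deriv hT
    (A := fun t => ∫ x, (inner ℝ (v t x) (φ x) : ℝ)) (b := fun t => transport (v t) φ)
    (hv.weak_continuous φ (memLp_of_continuous hφ.continuous _)) hbi (fun χ hχ => by
      have hm := hv.momentum _ (hφ.smoothSpaceTime_smul hχ)
      have hi : ∀ t ∈ Icc 0 T, Integrable fun x => (inner ℝ (v t x) (φ x) : ℝ) := fun t ht =>
        integrable_inner_continuous ((hv.memLp_two t ht).integrable (by norm_num)) hφ.continuous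
      have h0T : (0 : ℝ) ∈ Icc 0 T := ⟨le_rfl, hT.le⟩
      have hTT : T ∈ Icc 0 T := ⟨hT.le, le_rfl⟩
      simp only [inner_smul_right] at hm
      rw [integral_sub ((hi T hTT).const_mul _) ((hi 0 h0T).const_mul _), integral_const_mul,
        integral_const_mul] at hm
      rw [hm]
      refine intervalIntegral.integral_congr fun t ht => ?_
      rw [uIcc_of_le hT.le] at ht
      rw [transport, ← integral_const_mul, ← integral_const_mul,
        ← integral_add ((hi t ht).const_mul _)
          ((integrable_transport (hv.memLp_two t ht) hφ).const_mul _)]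
      congr 1; ext x
      have e1 : deriv (fun s => χ s • φ x) t = deriv χ t • φ x :=
        deriv_smul_const ((hχ.differentiable (by simp)) t) _
      have e2 : ∀ i j, pderiv j (fun y => (χ t • φ y) i) x
          = χ t * pderiv j (fun y => φ y i) x := fun i j => by
        have := (hφ.coord i).pderiv_const_smul (χ t) j x
        simpa using this
      have e3 : divergence (fun y => χ t • φ y) x = 0 := by
        have := hd x
        simp only [divergence] at this ⊢
        simp_rw [e2]
        rw [← Finset.mul_sum, this, mul_zero]
      rw [e1, e3, inner_smul_right]
      simp_rw [e2]
      rw [mul_zero, add_zero, Finset.mul_sum]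
      congr 1
      refine Finset.sum_congr rfl fun i _ => ?_
      rw [Finset.mul_sum]
      exact Finset.sum_congr rfl fun j _ => by ring)
  have hsub : ∀ t ∈ Icc 0 T, IntervalIntegrable (fun t => transport (v t) φ) volume 0 t :=
    fun t ht => hbi.mono_set (by
      rw [uIcc_of_le hT.le, uIcc_of_le ht.1]; exact Icc_subset_Icc_right ht.2)
  rw [← intervalIntegral.integral_interval_sub_left (hsub t ht) (hsub s hs), ← key t ht,
    ← key s hs]
  ring

end IsWeakEulerSolution

/-! ### The regularized helicity balance -/

theorem ofReal_three_halves : ENNReal.ofReal (3 / 2) = 3 / 2 := by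
  rw [ENNReal.ofReal_div_of_pos (by norm_num)]; norm_num

section General

variable {F : Type*} [NormedAddCommGroup F] [NormedSpace ℝ F] {f g : T3 → F}

theorem enorm_mollify_le_of_support {k : E3 → ℝ} {K ε : ℝ} (hK : ∀ y, ‖k y‖ ≤ K)
    (hs : Function.support k ⊆ Metric.closedBall 0 ε) (hε : ε ≤ 1 / 2)
    (hf : AEStronglyMeasurable f) (x : T3) :
    ‖mollify k f x‖ₑ ≤ ENNReal.ofReal K * ∫⁻ z, ‖f z‖ₑ :=
  (enorm_mollify_le k f x).trans ((lintegral_enorm_mul_le_of_support hK hs _).trans (by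
    gcongr
    exact lintegral_ball_sub_toTorus_le_of_le_half hf.enorm hε x))

/-- The mollification, applied twice. -/
def mollifyTwice (ε : ℝ) (f : T3 → F) : T3 → F := mollify (eta ε) (mollify (eta ε) f)

variable [CompleteSpace F]

theorem smoothOnTorus_mollify_eta {ε : ℝ} (hε : 0 < ε) (hf : Integrable f) :
    SmoothOnTorus (mollify (eta ε) f) :=
  smoothOnTorus_mollify (isTestKernel_eta hε) hf

theorem smoothOnTorus_mollifyTwice {ε : ℝ} (hε : 0 < ε) (hf : Integrable f) :
    SmoothOnTorus (mollifyTwice ε f) :=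
  smoothOnTorus_mollify_eta hε (smoothOnTorus_mollify_eta hε hf).integrable

theorem mollifyTwice_sub {ε : ℝ} (hε : 0 < ε) (hf : Integrable f) (hg : Integrable g) :
    mollifyTwice ε (fun x => f x - g x) = fun x => mollifyTwice ε f x - mollifyTwice ε g x := by
  ext x
  rw [mollifyTwice, show mollify (eta ε) (fun x => f x - g x) = fun x =>
    mollify (eta ε) f x - mollify (eta ε) g x from
      funext fun x => mollify_sub (isTestKernel_eta hε) hf hg x]
  exact mollify_sub (isTestKernel_eta hε) (smoothOnTorus_mollify_eta hε hf).integrable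
    (smoothOnTorus_mollify_eta hε hg).integrable x

theorem pderiv_mollifyTwice {ε : ℝ} (hε : 0 < ε) (hf : Integrable f) (j : Fin 3) (x : T3) :
    pderiv j (mollifyTwice ε f) x = mollify (kderiv j (eta ε)) (mollify (eta ε) f) x :=
  pderiv_mollify (isTestKernel_eta hε) (smoothOnTorus_mollify_eta hε hf).integrable j x

theorem exists_enorm_pderiv_mollifyTwice_le {ε : ℝ} (hε : 0 < ε) (hε2 : ε ≤ 1 / 2) :
    ∃ K : ℝ, 0 ≤ K ∧ ∀ f : T3 → F, Integrable f → ∀ j x,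
      ‖pderiv j (mollifyTwice ε f) x‖ₑ ≤ ENNReal.ofReal K * ∫⁻ z, ‖f z‖ₑ := by
  obtain ⟨C, hC, h⟩ := exists_eta_bound
  refine ⟨C * (ε ^ 4)⁻¹, by positivity, fun f hf j x => ?_⟩
  rw [pderiv_mollifyTwice hε hf]
  refine (enorm_mollify_le_of_support ((h ε hε).2.1 j)
    (support_kderiv_subset Metric.isClosed_closedBall (support_eta hε) j) hε2
    (smoothOnTorus_mollify_eta hε hf).integrable.1 x).trans ?_
  refine mul_le_mul' le_rfl ?_
  have := eLpNorm_mollify_eta_le hf.1 hε (p := 1) le_rfl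
  simpa [eLpNorm_one_eq_lintegral_enorm] using this

theorem tendsto_eLpNorm_mollifyTwice_sub {p : ℝ} (hp : 1 ≤ p)
    (hf : MemLp f (ENNReal.ofReal p) volume) :
    Tendsto (fun ε => eLpNorm (fun x => mollifyTwice ε f x - f x) (ENNReal.ofReal p) volume)
      (𝓝[>] 0) (𝓝 0) := by
  have hfi : Integrable f := hf.integrable (one_le_ofReal hp)
  have h := tendsto_eLpNorm_mollify_eta_sub hp hf
  have h2 := h.add h
  rw [add_zero] at h2
  refine tendsto_of_tendsto_of_tendsto_of_le_of_le' tendsto_const_nhds h2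
    (Eventually.of_forall fun _ => zero_le) ?_
  filter_upwards [self_mem_nhdsWithin] with ε hε
  have hs := smoothOnTorus_mollify_eta hε hfi
  have e : (fun x => mollifyTwice ε f x - f x)
      = (mollify (eta ε) fun x => mollify (eta ε) f x - f x)
        + fun x => mollify (eta ε) f x - f x := by
    ext x
    simp only [Pi.add_apply]
    rw [mollify_sub (isTestKernel_eta hε) hs.integrable hfi]
    simp [mollifyTwice]
  rw [e]
  have hm : AEStronglyMeasurable (fun x => mollify (eta ε) f x - f x) volume :=
    hs.integrable.1.sub hf.1
  refine (eLpNorm_add_le (smoothOnTorus_mollify_eta hε (hs.integrable.sub hfi)).integrable.1 hm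
    (one_le_ofReal hp)).trans ?_
  gcongr
  exact eLpNorm_mollify_eta_le hm hε hp

end General

theorem integral_inner_mollifyTwice_comm {f g : T3 → E3} {ε : ℝ} (hε : 0 < ε) (hf : Integrable f)
    (hg : Integrable g) : ∫ x, (inner ℝ (f x) (mollifyTwice ε g x) : ℝ)
      = ∫ x, (inner ℝ (g x) (mollifyTwice ε f x) : ℝ) := by
  have key : ∀ {f g : T3 → E3}, Integrable f → Integrable g →
      ∫ x, (inner ℝ (f x) (mollifyTwice ε g x) : ℝ)
        = ∫ x, (inner ℝ (mollify (eta ε) f x) (mollify (eta ε) g x) : ℝ) := by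
    intro f g hf hg
    rw [integral_inner_mollify (isTestKernel_eta hε) hf
      (smoothOnTorus_mollify_eta hε hg).continuous]
    simp_rw [eta_neg]
    rfl
  rw [key hf hg, key hg hf]
  simp_rw [real_inner_comm]

theorem IsWeakCurl.curl_mollifyTwice {u w : T3 → E3} (h : IsWeakCurl u w) {ε : ℝ} (hε : 0 < ε) :
    EulerTorus.curl (mollifyTwice ε u) = mollifyTwice ε w := by
  ext1 x
  rw [mollifyTwice, curl_mollify_of_smooth (isTestKernel_eta hε)
    (smoothOnTorus_mollify_eta hε h.1), h.curl_mollify (isTestKernel_eta hε)]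
  rfl

theorem IsWeakCurl.integral_inner_mollifyTwice_comm {u w u' w' : T3 → E3} (h : IsWeakCurl u w)
    (h' : IsWeakCurl u' w') {ε : ℝ} (hε : 0 < ε) :
    ∫ x, (inner ℝ (u x) (mollifyTwice ε w' x) : ℝ)
      = ∫ x, (inner ℝ (u' x) (mollifyTwice ε w x) : ℝ) := by
  rw [← h'.curl_mollifyTwice hε, ← h.2.2 _ (smoothOnTorus_mollifyTwice hε h'.1),
    EulerTorus.integral_inner_mollifyTwice_comm hε h.2.1 h'.1]

theorem IsWeakCurl.divergence_mollifyTwice {u w : T3 → E3} (h : IsWeakCurl u w) {ε : ℝ}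
    (hε : 0 < ε) (x : T3) : divergence (mollifyTwice ε w) x = 0 := by
  rw [← h.curl_mollifyTwice hε]
  exact divergence_curl (smoothOnTorus_mollifyTwice hε h.1) x

theorem aestronglyMeasurable_uncurry_of_edist_le {F : Type*} [NormedAddCommGroup F] {s : Set ℝ}
    (hs : MeasurableSet s) {G : ℝ → T3 → F} (hG : ∀ t ∈ s, Continuous (G t)) {d : ℝ → ℝ → ℝ≥0∞}
    (hd : ∀ t ∈ s, ∀ t₀ ∈ s, ∀ x, ‖G t x - G t₀ x‖ₑ ≤ d t t₀)
    (hd0 : ∀ t₀ ∈ s, Tendsto (fun t => d t t₀) (𝓝[s] t₀) (𝓝 0)) :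
    AEStronglyMeasurable (fun z : ℝ × T3 => G z.1 z.2) ((volume.restrict s).prod volume) := by
  have hc : ContinuousOn (fun z : ℝ × T3 => G z.1 z.2) (s ×ˢ univ) := by
    rintro ⟨t₀, x₀⟩ ⟨ht₀, -⟩
    rw [ContinuousWithinAt, tendsto_iff_edist_tendsto_0]
    have h1 : Tendsto (fun z : ℝ × T3 => d z.1 t₀) (𝓝[s ×ˢ univ] (t₀, x₀)) (𝓝 0) := by
      refine (hd0 t₀ ht₀).comp (tendsto_nhdsWithin_iff.2 ⟨?_, ?_⟩)
      · exact tendsto_fst.mono_left ((nhdsWithin_le_nhds).trans nhds_prod_eq.le)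
      · filter_upwards [self_mem_nhdsWithin] with z hz using hz.1
    have h2 : Tendsto (fun z : ℝ × T3 => edist (G t₀ z.2) (G t₀ x₀)) (𝓝[s ×ˢ univ] (t₀, x₀))
        (𝓝 0) := by
      rw [← tendsto_iff_edist_tendsto_0]
      exact ((hG t₀ ht₀).comp continuous_snd).continuousAt.continuousWithinAt
    have h3 := h1.add h2
    rw [add_zero] at h3
    refine tendsto_of_tendsto_of_tendsto_of_le_of_le' tendsto_const_nhds h3
      (Eventually.of_forall fun _ => zero_le) ?_
    filter_upwards [self_mem_nhdsWithin] with z hz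
    refine (edist_triangle _ (G t₀ z.2) _).trans ?_
    gcongr
    rw [edist_eq_enorm_sub]
    exact hd z.1 hz.1 t₀ ht₀ z.2
  have := hc.aestronglyMeasurable (μ := (volume : Measure ℝ).prod (volume : Measure T3))
    (hs.prod MeasurableSet.univ)
  rwa [← Measure.prod_restrict, Measure.restrict_univ] at this

namespace ContinuousInLq

variable {T : ℝ} {ω : ℝ → T3 → E3} {q : ℝ≥0∞}

theorem exists_bound (hω : ContinuousInLq T q ω) (hq : 1 ≤ q) :
    ∃ M : ℝ≥0∞, M ≠ ⊤ ∧ ∀ t ∈ Icc 0 T, eLpNorm (ω t) q volume ≤ M := by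
  refine isCompact_Icc.induction_on
    (p := fun s => ∃ M : ℝ≥0∞, M ≠ ⊤ ∧ ∀ t ∈ s, eLpNorm (ω t) q volume ≤ M)
    ⟨0, by simp, by simp⟩ (fun s t hst ⟨M, h1, h2⟩ => ⟨M, h1, fun x hx => h2 x (hst hx)⟩)
    (fun s t ⟨M, h1, h2⟩ ⟨M', h1', h2'⟩ => ⟨M + M', by finiteness, ?_⟩) fun t₀ ht₀ => ?_
  · rintro x (hx | hx)
    · exact (h2 x hx).trans le_self_add
    · exact (h2' x hx).trans le_add_self
  · have h := (hω.2 t₀ ht₀).eventually (gt_mem_nhds zero_lt_one)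
    refine ⟨_, inter_mem h self_mem_nhdsWithin, eLpNorm (ω t₀) q volume + 1,
      by simpa using (hω.1 t₀ ht₀).2.ne, fun t ht => ?_⟩
    have e : ω t = ω t₀ + fun x => ω t x - ω t₀ x := by ext1 x; simp
    rw [e]
    refine (eLpNorm_add_le (hω.1 t₀ ht₀).1 ((hω.1 t ht.2).1.sub (hω.1 t₀ ht₀).1) hq).trans ?_
    gcongr
    exact (mem_ofPred.1 ht.1).le

theorem tendsto_lintegral_enorm_sub (hω : ContinuousInLq T q ω) (hq : 1 ≤ q) {t₀ : ℝ}
    (ht₀ : t₀ ∈ Icc 0 T) :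
    Tendsto (fun t => ∫⁻ x, ‖ω t x - ω t₀ x‖ₑ) (𝓝[Icc 0 T] t₀) (𝓝 0) := by
  refine tendsto_of_tendsto_of_tendsto_of_le_of_le' tendsto_const_nhds (hω.2 t₀ ht₀)
    (Eventually.of_forall fun _ => zero_le) ?_
  filter_upwards [self_mem_nhdsWithin] with t ht
  rw [← eLpNorm_one_eq_lintegral_enorm]
  exact eLpNorm_le_eLpNorm_of_exponent_le hq ((hω.1 t ht).1.sub (hω.1 t₀ ht₀).1)

end ContinuousInLq

section Balance

variable {T : ℝ} {v : ℝ → T3 → E3} {P : ℝ → T3 → ℝ} {ω : ℝ → T3 → E3}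

/-- The helicity flux, which is half the time derivative of the regularized helicity. -/
def flux (ε : ℝ) (v ω : ℝ → T3 → E3) (t : ℝ) : ℝ := transport (v t) (mollifyTwice ε (ω t))

theorem abs_pderiv_coord_le {φ : T3 → E3} (hφ : SmoothOnTorus φ) (i j : Fin 3) (x : T3) :
    |pderiv j (fun y => φ y i) x| ≤ ‖pderiv j φ x‖ := by
  rw [hφ.pderiv_coord]
  exact abs_coord_le_norm _ _

theorem IsWeakEulerSolution.abs_transport_sub_le (hv : IsWeakEulerSolution T v P) {ε : ℝ}
    (hε : 0 < ε) (hε2 : ε ≤ 1 / 2) : ∃ C : ℝ, 0 ≤ C ∧ ∀ τ ∈ Icc 0 T, ∀ f g : T3 → E3,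
      Integrable f → Integrable g →
      |transport (v τ) (mollifyTwice ε f) - transport (v τ) (mollifyTwice ε g)|
        ≤ C * (∫⁻ x, ‖f x - g x‖ₑ).toReal := by
  obtain ⟨K, hK0, hK⟩ := exists_enorm_pderiv_mollifyTwice_le (F := E3) hε hε2
  obtain ⟨M, hM⟩ := hv.exists_energy_bound
  refine ⟨9 * K * |M|, by positivity, fun τ hτ f g hf hg => ?_⟩
  have hsub : Integrable fun x => f x - g x := hf.sub hg
  have hs := smoothOnTorus_mollifyTwice hε hsub
  have hfin : ∫⁻ x, ‖f x - g x‖ₑ ≠ ⊤ := hsub.2.ne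
  rw [← transport_sub (hv.memLp_two τ hτ) (smoothOnTorus_mollifyTwice hε hf)
    (smoothOnTorus_mollifyTwice hε hg), ← mollifyTwice_sub hε hf hg]
  refine (abs_transport_le (hv.memLp_two τ hτ)
    (K := K * (∫⁻ x, ‖f x - g x‖ₑ).toReal) fun i j x => ?_).trans ?_
  · refine (abs_pderiv_coord_le hs i j x).trans ?_
    have h := ENNReal.toReal_mono (by finiteness) (hK _ hsub j x)
    rwa [toReal_enorm, ENNReal.toReal_mul, ENNReal.toReal_ofReal hK0] at h
  · have := (hM τ hτ).trans (le_abs_self M)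
    calc _ ≤ 9 * (K * (∫⁻ x, ‖f x - g x‖ₑ).toReal) * |M| := by gcongr
      _ = _ := by ring

theorem IsWeakEulerSolution.intervalIntegrable_flux (hv : IsWeakEulerSolution T v P) (hT : 0 < T)
    {q : ℝ≥0∞} (hq : 1 ≤ q) (hω : ContinuousInLq T q ω) {ε : ℝ} (hε : 0 < ε) (hε2 : ε ≤ 1 / 2) :
    IntervalIntegrable (flux ε v ω) volume 0 T := by
  obtain ⟨K, hK0, hK⟩ := exists_enorm_pderiv_mollifyTwice_le (F := E3) hε hε2
  obtain ⟨M, hM, hMb⟩ := hω.exists_bound hq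
  have hi : ∀ t ∈ Icc 0 T, Integrable (ω t) := fun t ht => (hω.1 t ht).integrable hq
  refine hv.intervalIntegrable_transport hT (K := K * M.toReal) (fun i j => ?_)
    fun t ht i j x => ?_
  · have := aestronglyMeasurable_uncurry_of_edist_le measurableSet_Icc (s := Icc 0 T)
      (G := fun t => pderiv j (mollifyTwice ε (ω t)))
      (d := fun t t₀ => ENNReal.ofReal K * ∫⁻ x, ‖ω t x - ω t₀ x‖ₑ)
      (fun t ht => ((smoothOnTorus_mollifyTwice hε (hi t ht)).pderiv j).continuous)
      (fun t ht t₀ ht₀ x => by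
        rw [← (smoothOnTorus_mollifyTwice hε (hi t ht)).pderiv_sub
          (smoothOnTorus_mollifyTwice hε (hi t₀ ht₀)),
          ← mollifyTwice_sub hε (hi t ht) (hi t₀ ht₀)]
        exact hK _ ((hi t ht).sub (hi t₀ ht₀)) j x)
      (fun t₀ ht₀ => by
        have := ENNReal.Tendsto.const_mul (a := ENNReal.ofReal K)
          (hω.tendsto_lintegral_enorm_sub hq ht₀) (Or.inr ENNReal.ofReal_ne_top)
        rwa [mul_zero] at this)
    have h2 := (EuclideanSpace.proj (𝕜 := ℝ) i : E3 →L[ℝ] ℝ).continuous.comp_aestronglyMeasurable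
      this
    refine h2.congr ?_
    have : ∀ᵐ z ∂((volume.restrict (Icc 0 T)).prod (volume : Measure T3)), z.1 ∈ Icc 0 T :=
      Measure.quasiMeasurePreserving_fst.ae (ae_restrict_mem measurableSet_Icc)
    filter_upwards [this] with z hz
    exact ((smoothOnTorus_mollifyTwice hε (hi z.1 hz)).pderiv_coord i j z.2).symm
  · refine (abs_pderiv_coord_le (smoothOnTorus_mollifyTwice hε (hi t ht)) i j x).trans ?_
    have h1 : ∫⁻ x, ‖ω t x‖ₑ ≤ M := by
      rw [← eLpNorm_one_eq_lintegral_enorm]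
      exact (eLpNorm_le_eLpNorm_of_exponent_le hq (hω.1 t ht).1).trans (hMb t ht)
    have h := ENNReal.toReal_mono (by finiteness) ((hK _ (hi t ht) j x).trans
      (mul_le_mul_right h1 _))
    rwa [toReal_enorm, ENNReal.toReal_mul, ENNReal.toReal_ofReal hK0] at h

/-- The balance of the regularized helicity. -/
theorem IsWeakEulerSolution.regularized_helicity_sub (hv : IsWeakEulerSolution T v P) (hT : 0 < T)
    (hcurl : ∀ t ∈ Icc 0 T, IsWeakCurl (v t) (ω t)) {q : ℝ≥0∞} (hq : 1 ≤ q)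
    (hω : ContinuousInLq T q ω) {ε : ℝ} (hε : 0 < ε) (hε2 : ε ≤ 1 / 2) :
    ∀ t ∈ Icc 0 T, (∫ x, (inner ℝ (v t x) (mollifyTwice ε (ω t) x) : ℝ))
      - ∫ x, (inner ℝ (v 0 x) (mollifyTwice ε (ω 0) x) : ℝ)
        = 2 * ∫ τ in (0 : ℝ)..t, flux ε v ω τ := by
  obtain ⟨C, hC0, hC⟩ := hv.abs_transport_sub_le hε hε2
  have hi : ∀ t ∈ Icc 0 T, Integrable (ω t) := fun t ht => (hcurl t ht).2.1
  have hs : ∀ t ∈ Icc 0 T, SmoothOnTorus (mollifyTwice ε (ω t)) := fun t ht =>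
    smoothOnTorus_mollifyTwice hε (hi t ht)
  have hF := hv.intervalIntegrable_flux hT hq hω hε hε2
  have hF' : ∀ t ∈ Icc 0 T, IntervalIntegrable (flux ε v ω) volume 0 t := fun t ht =>
    hF.mono_set (by rw [uIcc_of_le hT.le, uIcc_of_le ht.1]; exact Icc_subset_Icc_right ht.2)
  set N : ℝ → ℝ → ℝ := fun t s => (∫⁻ x, ‖ω t x - ω s x‖ₑ).toReal with hN
  have hfin : ∀ t ∈ Icc 0 T, ∀ s ∈ Icc 0 T, ∫⁻ x, ‖ω t x - ω s x‖ₑ ≠ ⊤ := fun t ht s hs =>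
    ((hi t ht).sub (hi s hs)).2.ne
  have hNtri : ∀ t ∈ Icc 0 T, ∀ s ∈ Icc 0 T, ∀ r ∈ Icc 0 T, N t s ≤ N t r + N s r := by
    intro t ht s hs r hr
    rw [hN]
    simp only
    rw [← ENNReal.toReal_add (hfin t ht r hr) (hfin s hs r hr)]
    refine ENNReal.toReal_mono (ENNReal.add_ne_top.2 ⟨hfin t ht r hr, hfin s hs r hr⟩) ?_
    have hm : AEMeasurable fun x => ‖ω t x - ω r x‖ₑ := ((hi t ht).sub (hi r hr)).1.enorm
    rw [← lintegral_add_left' hm]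
    refine lintegral_mono fun x => ?_
    rw [← edist_eq_enorm_sub, ← edist_eq_enorm_sub, ← edist_eq_enorm_sub]
    exact edist_triangle_right _ _ _
  have hN0 : ∀ t₀ ∈ Icc 0 T, Tendsto (fun t => N t t₀) (𝓝[Icc 0 T] t₀) (𝓝 0) := fun t₀ ht₀ => by
    have := (ENNReal.tendsto_toReal (a := 0) (by simp)).comp
      (hω.tendsto_lintegral_enorm_sub hq ht₀)
    rw [ENNReal.toReal_zero] at this
    exact this
  set H : ℝ → ℝ := fun t => ∫ x, (inner ℝ (v t x) (mollifyTwice ε (ω t) x) : ℝ) with hH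
  have hcross : ∀ t ∈ Icc 0 T, ∀ s ∈ Icc 0 T, H t - H s
      = (∫ τ in s..t, transport (v τ) (mollifyTwice ε (ω t)))
        + ∫ τ in s..t, transport (v τ) (mollifyTwice ε (ω s)) := by
    intro t ht s hs'
    rw [← hv.integral_inner_sub_eq hT (hs t ht) ((hcurl t ht).divergence_mollifyTwice hε) hs' ht,
      ← hv.integral_inner_sub_eq hT (hs s hs') ((hcurl s hs').divergence_mollifyTwice hε) hs' ht,
      (hcurl s hs').integral_inner_mollifyTwice_comm (hcurl t ht) hε]
    ring
  have htr : ∀ s ∈ Icc 0 T, IntervalIntegrable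
      (fun τ => transport (v τ) (mollifyTwice ε (ω s))) volume 0 T := fun s hs' =>
    hv.intervalIntegrable_flux (ω := fun _ => ω s) hT hq
      ⟨fun _ _ => hω.1 s hs', fun _ _ => by simpa using tendsto_const_nhds⟩ hε hε2
  have hsubset : ∀ t ∈ Icc 0 T, ∀ s ∈ Icc 0 T, uIcc s t ⊆ uIcc 0 T := fun t ht s hs' => by
    rw [uIcc_of_le hT.le]; exact uIcc_subset_Icc hs' ht
  have hD : ∀ t ∈ Icc 0 T, ∀ s ∈ Icc 0 T,
      (H t - 2 * ∫ τ in (0 : ℝ)..t, flux ε v ω τ) - (H s - 2 * ∫ τ in (0 : ℝ)..s, flux ε v ω τ)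
      = ∫ τ in s..t, ((transport (v τ) (mollifyTwice ε (ω t)) - flux ε v ω τ)
        + (transport (v τ) (mollifyTwice ε (ω s)) - flux ε v ω τ)) := by
    intro t ht s hs'
    have i1 := (htr t ht).mono_set (hsubset t ht s hs')
    have i2 := (htr s hs').mono_set (hsubset t ht s hs')
    have i3 := hF.mono_set (hsubset t ht s hs')
    rw [intervalIntegral.integral_add (i1.sub i3) (i2.sub i3),
      intervalIntegral.integral_sub i1 i3, intervalIntegral.integral_sub i2 i3,
      ← intervalIntegral.integral_interval_sub_left (hF' t ht) (hF' s hs')]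
    have := hcross t ht s hs'
    linarith
  have hderiv : ∀ t₀ ∈ Icc 0 T, HasDerivWithinAt
      (fun t => H t - 2 * ∫ τ in (0 : ℝ)..t, flux ε v ω τ) 0 (Icc 0 T) t₀ := by
    intro t₀ ht₀
    rw [hasDerivWithinAt_iff_isLittleO, Asymptotics.isLittleO_iff]
    intro c hc
    have hc' : 0 < c / (3 * C + 1) := by positivity
    have h1 := (hN0 t₀ ht₀).eventually (gt_mem_nhds hc')
    obtain ⟨δ, hδ, h2⟩ := Metric.mem_nhdsWithin_iff.1 h1
    filter_upwards [inter_mem_nhdsWithin _ (Metric.ball_mem_nhds t₀ hδ)] with t ht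
    simp only [smul_zero, sub_zero]
    rw [hD t ht.1 t₀ ht₀]
    refine intervalIntegral.norm_integral_le_of_norm_le_const (fun τ hτ => ?_)
    have hτI : τ ∈ Icc 0 T := uIcc_subset_Icc ht₀ ht.1 (uIoc_subset_uIcc hτ)
    have hτb : τ ∈ Metric.ball t₀ δ := by
      have hconv := (convex_ball t₀ δ).ordConnected
      exact hconv.uIcc_subset (Metric.mem_ball_self hδ) ht.2 (uIoc_subset_uIcc hτ)
    have a1 : N t t₀ < c / (3 * C + 1) := h2 ⟨ht.2, ht.1⟩
    have a2 : N τ t₀ < c / (3 * C + 1) := h2 ⟨hτb, hτI⟩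
    have a3 := hNtri t ht.1 τ hτI t₀ ht₀
    have a4 : N t₀ τ = N τ t₀ := by
      simp only [hN]; congr 1; refine lintegral_congr fun x => ?_
      rw [← edist_eq_enorm_sub, edist_comm, edist_eq_enorm_sub]
    have b1 := hC τ hτI _ _ (hi t ht.1) (hi τ hτI)
    have b2 := hC τ hτI _ _ (hi t₀ ht₀) (hi τ hτI)
    change _ ≤ C * N t τ at b1
    change _ ≤ C * N t₀ τ at b2
    refine (norm_add_le _ _).trans ?_
    rw [Real.norm_eq_abs, Real.norm_eq_abs]
    have b3 : C * N t τ + C * N t₀ τ ≤ C * (3 * (c / (3 * C + 1))) := by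
      rw [← mul_add]
      gcongr
      linarith
    have b4 : C * (3 * (c / (3 * C + 1))) ≤ c := by
      rw [← mul_div_assoc, ← mul_div_assoc, div_le_iff₀ (by positivity)]
      nlinarith
    exact (add_le_add b1 b2).trans (b3.trans b4)
  have hconst := constant_of_has_deriv_right_zero
    (fun t ht => (hderiv t ht).continuousWithinAt) (fun t ht =>
      (hderiv t (Ico_subset_Icc_self ht)).mono_of_mem_nhdsWithin
        (Icc_mem_nhdsGE_of_mem ht))
  intro t ht
  have := hconst t ht
  simp only [intervalIntegral.integral_same, mul_zero, sub_zero] at this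
  linarith

end Balance

theorem integrable_inner_of_memLp {f g : T3 → E3} (hf : MemLp f (ENNReal.ofReal 3) volume)
    (hg : MemLp g (ENNReal.ofReal (3 / 2)) volume) :
    Integrable (fun x => (inner ℝ (f x) (g x) : ℝ)) ∧
      ‖∫ x, (inner ℝ (f x) (g x) : ℝ)‖ₑ
        ≤ eLpNorm f (ENNReal.ofReal 3) volume * eLpNorm g (ENNReal.ofReal (3 / 2)) volume := by
  have hb : ∫⁻ x, ‖(inner ℝ (f x) (g x) : ℝ)‖ₑ
      ≤ eLpNorm f (ENNReal.ofReal 3) volume * eLpNorm g (ENNReal.ofReal (3 / 2)) volume := by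
    have h := lintegral_prod_rpow_le_prod_eLpNorm (μ := (volume : Measure T3)) Finset.univ
      (f := fun i : Fin 2 => ![fun x => ‖f x‖ₑ, fun x => ‖g x‖ₑ] i) (w := fun _ => 1)
      (p := ![ENNReal.ofReal 3, ENNReal.ofReal (3 / 2)])
      (by intro i _; fin_cases i; exacts [hf.1.enorm, hg.1.enorm]) (by simp)
      (by intro i _; fin_cases i <;> simp)
      (by
        rw [Fin.sum_univ_two]
        simp only [Matrix.cons_val_zero, Matrix.cons_val_one]
        rw [← ENNReal.ofReal_div_of_pos (by norm_num), ← ENNReal.ofReal_div_of_pos (by norm_num),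
          ← ENNReal.ofReal_add (by norm_num) (by norm_num)]
        norm_num)
    simp only [Fin.prod_univ_two, Matrix.cons_val_zero, Matrix.cons_val_one,
      ENNReal.rpow_one, eLpNorm_enorm] at h
    refine le_trans (lintegral_mono fun x => ?_) h
    rw [← enorm_norm (f x), ← enorm_norm (g x), ← enorm_mul, enorm_le_iff_norm_le, norm_mul,
      norm_norm, norm_norm]
    exact norm_inner_le_norm _ _
  refine ⟨⟨hf.1.inner hg.1, hb.trans_lt (ENNReal.mul_lt_top hf.2 hg.2)⟩,
    (enorm_integral_le_lintegral_enorm _).trans hb⟩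

theorem tendsto_integral_inner_mollifyTwice {f g : T3 → E3}
    (hf : MemLp f (ENNReal.ofReal 3) volume) (hg : MemLp g (ENNReal.ofReal (3 / 2)) volume) :
    Tendsto (fun ε => ∫ x, (inner ℝ (f x) (mollifyTwice ε g x) : ℝ)) (𝓝[>] 0)
      (𝓝 (∫ x, (inner ℝ (f x) (g x) : ℝ))) := by
  have hgi : Integrable g := hg.integrable (one_le_ofReal (by norm_num))
  rw [tendsto_iff_edist_tendsto_0]
  have h := ENNReal.Tendsto.const_mul (a := eLpNorm f (ENNReal.ofReal 3) volume)
    (tendsto_eLpNorm_mollifyTwice_sub (by norm_num) hg) (Or.inr hf.2.ne)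
  rw [mul_zero] at h
  refine tendsto_of_tendsto_of_tendsto_of_le_of_le' tendsto_const_nhds h
    (Eventually.of_forall fun _ => zero_le) ?_
  filter_upwards [self_mem_nhdsWithin] with ε hε
  have hs := memLp_of_continuous (smoothOnTorus_mollifyTwice hε hgi).continuous
    (ENNReal.ofReal (3 / 2))
  rw [edist_eq_enorm_sub, ← integral_sub (integrable_inner_of_memLp hf hs).1
    (integrable_inner_of_memLp hf hg).1]
  simp_rw [← inner_sub_right]
  exact (integrable_inner_of_memLp hf (hs.sub hg)).2

/-- The helicity is conserved once the helicity flux vanishes in the limit. -/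
theorem helicity_eq_of_tendsto_flux {T : ℝ} (hT : 0 < T) {v : ℝ → T3 → E3} {P : ℝ → T3 → ℝ}
    (hv : IsWeakEulerSolution T v P) {ω : ℝ → T3 → E3}
    (hcurl : ∀ t ∈ Icc 0 T, IsWeakCurl (v t) (ω t)) (hω : ContinuousInLq T (3 / 2) ω)
    (hv3 : ∀ t ∈ Icc 0 T, MemLp (v t) (ENNReal.ofReal 3) volume)
    (h : Tendsto (fun ε => ∫⁻ t in Ioo 0 T, ‖flux ε v ω t‖ₑ) (𝓝[>] 0) (𝓝 0)) :
    ∀ t ∈ Icc 0 T, Integrable (fun x => (inner ℝ (ω t x) (v t x) : ℝ)) ∧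
        ∫ x, (inner ℝ (ω t x) (v t x) : ℝ) = ∫ x, (inner ℝ (ω 0 x) (v 0 x) : ℝ) := by
  have hω' : ∀ t ∈ Icc 0 T, MemLp (ω t) (ENNReal.ofReal (3 / 2)) volume := fun t ht => by
    rw [ofReal_three_halves]; exact hω.1 t ht
  have h0 : (0 : ℝ) ∈ Icc 0 T := ⟨le_rfl, hT.le⟩
  have hq : (1 : ℝ≥0∞) ≤ 3 / 2 := by
    rw [← ofReal_three_halves]; exact one_le_ofReal (by norm_num)
  intro t ht
  simp_rw [fun t x => real_inner_comm (v t x) (ω t x)]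
  refine ⟨(integrable_inner_of_memLp (hv3 t ht) (hω' t ht)).1, ?_⟩
  have l1 := (tendsto_integral_inner_mollifyTwice (hv3 t ht) (hω' t ht)).sub
    (tendsto_integral_inner_mollifyTwice (hv3 0 h0) (hω' 0 h0))
  have l2 : Tendsto (fun ε => (∫ x, (inner ℝ (v t x) (mollifyTwice ε (ω t) x) : ℝ))
      - ∫ x, (inner ℝ (v 0 x) (mollifyTwice ε (ω 0) x) : ℝ)) (𝓝[>] 0) (𝓝 0) := by
    rw [tendsto_iff_edist_tendsto_0]
    have h2 := ENNReal.Tendsto.const_mul (a := 2) h (Or.inr (by simp))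
    rw [mul_zero] at h2
    refine tendsto_of_tendsto_of_tendsto_of_le_of_le' tendsto_const_nhds h2
      (Eventually.of_forall fun _ => zero_le) ?_
    filter_upwards [Ioc_mem_nhdsGT (show (0 : ℝ) < 1 / 2 by norm_num)] with ε hε
    rw [hv.regularized_helicity_sub hT hcurl hq hω hε.1 hε.2 t ht, edist_zero_right, enorm_mul]
    have e2 : ‖(2 : ℝ)‖ₑ = 2 := by
      rw [Real.enorm_of_nonneg (by norm_num)]; norm_num
    rw [e2]
    gcongr
    rw [intervalIntegral.integral_of_le ht.1, integral_Ioc_eq_integral_Ioo]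
    exact (enorm_integral_le_lintegral_enorm _).trans
      (lintegral_mono_set (Ioo_subset_Ioo_right ht.2))
  exact sub_eq_zero.1 (tendsto_nhds_unique l1 l2)

theorem IsWeakEulerSolution.exists_eLpNorm_three_bound {T : ℝ} (hT : 0 < T) {v : ℝ → T3 → E3}
    {P : ℝ → T3 → ℝ} (hv : IsWeakEulerSolution T v P) {ω : ℝ → T3 → E3}
    (hcurl : ∀ t ∈ Icc 0 T, IsWeakCurl (v t) (ω t)) (hω : ContinuousInLq T (3 / 2) ω) :
    ∃ M : ℝ≥0∞, M ≠ ⊤ ∧ ∀ t ∈ Icc 0 T, eLpNorm (v t) (ENNReal.ofReal 3) volume ≤ M := by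
  obtain ⟨C, hC, h⟩ := exists_eLpNorm_three_le_weakCurl
  obtain ⟨E, hE⟩ := hv.exists_energy_bound
  obtain ⟨M, hM, hMb⟩ := hω.exists_bound (by
    rw [← ofReal_three_halves]; exact one_le_ofReal (by norm_num))
  refine ⟨C * (ENNReal.ofReal E ^ (1 / 2 : ℝ) + M), by finiteness, fun t ht => ?_⟩
  refine (h _ _ (hcurl t ht) (hv.isWeakDivFree hT t ht)).trans ?_
  rw [ofReal_three_halves]
  gcongr
  · have hm := hv.memLp_two t ht
    refine (eLpNorm_le_eLpNorm_of_exponent_le (q := 2) ?_ hm.1).trans ?_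
    · rw [← ofReal_three_halves, ← ENNReal.ofReal_ofNat]
      exact ENNReal.ofReal_le_ofReal (by norm_num)
    · rw [hm.eLpNorm_eq_integral_rpow_norm (by norm_num) (by norm_num),
        ← ENNReal.ofReal_rpow_of_nonneg (integral_nonneg fun _ => by positivity) (by norm_num)]
      simp only [ENNReal.toReal_ofNat, Real.rpow_ofNat, one_div]
      gcongr
      exact hE t ht
  · exact hMb t ht

/-! ### The commutator representation of the helicity flux -/

/-- The normalized Lebesgue measure on the ball of radius `ε`. -/
abbrev ballMeasure (ε : ℝ) : Measure E3 := ProbabilityTheory.cond volume (Metric.ball 0 ε)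

theorem isProbabilityMeasure_ballMeasure {ε : ℝ} (hε : 0 < ε) :
    IsProbabilityMeasure (ballMeasure ε) :=
  ProbabilityTheory.cond_isProbabilityMeasure_of_finite
    (Metric.measure_ball_pos volume _ hε).ne' measure_ball_lt_top.ne

theorem exists_lintegral_enorm_mul_le_ballMeasure : ∃ c : ℝ, 0 < c ∧ ∀ {ε : ℝ}, 0 < ε →
    ∀ {k : E3 → ℝ} {K : ℝ}, 0 ≤ K → (∀ y, ‖k y‖ ≤ K * (ε ^ 3)⁻¹) →
      Function.support k ⊆ Metric.closedBall 0 ε → ∀ h : E3 → ℝ≥0∞,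
        ∫⁻ y, ‖k y‖ₑ * h y ≤ ENNReal.ofReal (c * K) * ∫⁻ y, h y ∂(ballMeasure ε) := by
  have h0 := Metric.measure_ball_pos (volume : Measure E3) 0 one_pos
  have ht : volume (Metric.ball (0 : E3) 1) ≠ ⊤ := measure_ball_lt_top.ne
  refine ⟨(volume (Metric.ball (0 : E3) 1)).toReal, ENNReal.toReal_pos h0.ne' ht,
    fun {ε} hε {k K} hK0 hK hs h => (lintegral_enorm_mul_le_of_support hK hs h).trans_eq ?_⟩
  rw [ballMeasure, ProbabilityTheory.cond, lintegral_smul_measure,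
    Measure.addHaar_ball volume _ hε.le, finrank_euclideanSpace, Fintype.card_fin, smul_eq_mul,
    ENNReal.ofReal_mul ENNReal.toReal_nonneg, ENNReal.ofReal_toReal ht, ENNReal.ofReal_mul hK0,
    ENNReal.ofReal_inv_of_pos (by positivity)]
  have e3 : ENNReal.ofReal (ε ^ 3) ≠ 0 := by simp; positivity
  rw [ENNReal.mul_inv (Or.inl e3) (Or.inl ENNReal.ofReal_ne_top)]
  calc ENNReal.ofReal K * (ENNReal.ofReal (ε ^ 3))⁻¹ * ∫⁻ y in Metric.ball 0 ε, h y
      = (volume (Metric.ball (0 : E3) 1) * (volume (Metric.ball (0 : E3) 1))⁻¹)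
        * (ENNReal.ofReal K * (ENNReal.ofReal (ε ^ 3))⁻¹ * ∫⁻ y in Metric.ball 0 ε, h y) := by
          rw [ENNReal.mul_inv_cancel h0.ne' ht, one_mul]
    _ = _ := by ring

/-- The triple product `(a × b) · c`. -/
def tripleProduct (a b c : E3) : ℝ :=
  (a 1 * b 2 - a 2 * b 1) * c 0 + (a 2 * b 0 - a 0 * b 2) * c 1 + (a 0 * b 1 - a 1 * b 0) * c 2

theorem transport_eq_integral_tripleProduct {U φ : T3 → E3} (hU : SmoothOnTorus U)
    (hφ : SmoothOnTorus φ) (hdU : ∀ x, divergence U x = 0) (hdφ : ∀ x, divergence φ x = 0) :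
    transport U φ = ∫ x, tripleProduct (U x) (curl U x) (φ x) := by
  have e1 : transport U φ = ∑ i, ∑ j, -∫ x, pderiv j (fun y => U y i * U y j) x * φ x i := by
    rw [transport, integral_finsetSum _ fun i _ => integrable_finsetSum _ fun j _ =>
      (((hU.coord i).mul (hU.coord j)).mul ((hφ.coord i).pderiv j)).integrable]
    refine Finset.sum_congr rfl fun i _ => ?_
    rw [integral_finsetSum _ fun j _ =>
      (((hU.coord i).mul (hU.coord j)).mul ((hφ.coord i).pderiv j)).integrable]
    exact Finset.sum_congr rfl fun j _ =>
      ((hU.coord i).mul (hU.coord j)).integral_mul_pderiv (hφ.coord i) j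
  have e2 : ∑ i, ∑ j, -∫ x, pderiv i (fun y => U y j * U y j) x * φ x i = 0 := by
    have : ∀ i j, -∫ x, pderiv i (fun y => U y j * U y j) x * φ x i
        = ∫ x, (U x j * U x j) * pderiv i (fun y => φ y i) x := fun i j =>
      (((hU.coord j).mul (hU.coord j)).integral_mul_pderiv (hφ.coord i) i).symm
    simp_rw [this]
    rw [Finset.sum_comm]
    refine Finset.sum_eq_zero fun j _ => ?_
    rw [← integral_finsetSum _ fun i _ =>
      (((hU.coord j).mul (hU.coord j)).mul ((hφ.coord i).pderiv i)).integrable]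
    refine integral_eq_zero_of_ae (Eventually.of_forall fun x => ?_)
    simp only [Pi.zero_apply]
    rw [← Finset.mul_sum]
    have := hdφ x
    rw [divergence] at this
    rw [this, mul_zero]
  have hI : ∀ a i j l : Fin 3, Integrable fun x =>
      pderiv a (fun y => U y i * U y j) x * φ x l := fun a i j l =>
    ((((hU.coord i).mul (hU.coord j)).pderiv a).mul (hφ.coord l)).integrable
  have hsum : ∀ (F : Fin 3 → Fin 3 → T3 → ℝ), (∀ i j, Integrable (F i j)) →
      ∑ i, ∑ j, ∫ x, F i j x = ∫ x, ∑ i, ∑ j, F i j x := fun F hF => by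
    rw [integral_finsetSum _ fun i _ => integrable_finsetSum _ fun j _ => hF i j]
    exact Finset.sum_congr rfl fun i _ => (integral_finsetSum _ fun j _ => hF i j).symm
  simp only [Finset.sum_neg_distrib, neg_eq_zero] at e1 e2
  rw [hsum (fun i j x => pderiv j (fun y => U y i * U y j) x * φ x i) fun i j => hI j i j i] at e1
  rw [hsum (fun i j x => pderiv i (fun y => U y j * U y j) x * φ x i) fun i j => hI i j j i] at e2
  have e4 : (∫ x, ∑ i, ∑ j, pderiv i (fun y => U y j * U y j) x * φ x i)
      - 2 * ∫ x, ∑ i, ∑ j, pderiv j (fun y => U y i * U y j) x * φ x i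
      = 2 * ∫ x, tripleProduct (U x) (curl U x) (φ x) := by
    rw [← integral_const_mul, ← integral_const_mul, ← integral_sub
      (integrable_finsetSum _ fun i _ => integrable_finsetSum _ fun j _ => hI i j j i)
      ((integrable_finsetSum _ fun i _ => integrable_finsetSum _ fun j _ =>
        hI j i j i).const_mul 2)]
    congr 1; ext x
    have h := hdU x
    simp only [(hU.coord _).pderiv_mul (hU.coord _), divergence, Fin.sum_univ_three, curl_apply_zero,
      curl_apply_one, curl_apply_two, tripleProduct] at h ⊢
    generalize pderiv 0 (fun y => U y 0) x = a00 at *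
    generalize pderiv 0 (fun y => U y 1) x = a01 at *
    generalize pderiv 0 (fun y => U y 2) x = a02 at *
    generalize pderiv 1 (fun y => U y 0) x = a10 at *
    generalize pderiv 1 (fun y => U y 1) x = a11 at *
    generalize pderiv 1 (fun y => U y 2) x = a12 at *
    generalize pderiv 2 (fun y => U y 0) x = a20 at *
    generalize pderiv 2 (fun y => U y 1) x = a21 at *
    generalize pderiv 2 (fun y => U y 2) x = a22 at *
    linear_combination (-2) * (U x 0 * φ x 0 + U x 1 * φ x 1 + U x 2 * φ x 2) * h
  rw [e1]
  linarith

theorem tripleProduct_self_right (a b : E3) : tripleProduct a b b = 0 := by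
  rw [tripleProduct]; ring

theorem transport_curl_self {U : T3 → E3} (hU : SmoothOnTorus U) (hd : ∀ x, divergence U x = 0) :
    transport U (curl U) = 0 := by
  rw [transport_eq_integral_tripleProduct hU hU.curl hd fun x => divergence_curl hU x]
  simp [tripleProduct_self_right]

/-- The commutator of the mollification with the product of two coordinates. -/
def commutator (ε : ℝ) (u : T3 → E3) (i j : Fin 3) (x : T3) : ℝ :=
  mollify (eta ε) (fun y => u y i * u y j) x - mollify (eta ε) u x i * mollify (eta ε) u x j

theorem transport_mollifyTwice_eq {u w : T3 → E3} (hu : MemLp u 2 volume) (hd : IsWeakDivFree u)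
    (hc : IsWeakCurl u w) {ε : ℝ} (hε : 0 < ε) :
    transport u (mollifyTwice ε w) = ∑ i, ∑ j, ∫ x,
      commutator ε u i j x * pderiv j (fun y => mollify (eta ε) w y i) x := by
  have hk := isTestKernel_eta hε
  have hU := smoothOnTorus_mollify_eta hε hc.1
  have hW := smoothOnTorus_mollify_eta hε hc.2.1
  have huu : ∀ i j, Integrable fun y => u y i * u y j := fun i j =>
    (MemLp.coord hu i).integrable_mul (MemLp.coord hu j)
  have h0 := transport_curl_self hU (hd.divergence_mollify hc.1 hk)
  rw [hc.curl_mollify hk] at h0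
  have hi1 : ∀ i j, Integrable fun x => mollify (eta ε) (fun y => u y i * u y j) x
      * pderiv j (fun y => mollify (eta ε) w y i) x := fun i j =>
    ((smoothOnTorus_mollify_eta hε (huu i j)).mul ((hW.coord i).pderiv j)).integrable
  have hi2 : ∀ i j, Integrable fun x => mollify (eta ε) u x i * mollify (eta ε) u x j
      * pderiv j (fun y => mollify (eta ε) w y i) x := fun i j =>
    (((hU.coord i).mul (hU.coord j)).mul ((hW.coord i).pderiv j)).integrable
  have h1 : transport u (mollifyTwice ε w) = ∑ i, ∑ j, ∫ x,
      mollify (eta ε) (fun y => u y i * u y j) x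
        * pderiv j (fun y => mollify (eta ε) w y i) x := by
    have e : ∀ i j, pderiv j (fun y => mollifyTwice ε w y i)
        = mollify (eta ε) (pderiv j (fun y => mollify (eta ε) w y i)) := by
      intro i j
      ext1 x
      rw [← pderiv_mollify_eq_mollify_pderiv hk (hW.coord i)]
      congr 1; ext y
      exact (mollify_coord hk hW.integrable i y).symm
    have hi : ∀ i j, Integrable fun x => u x i * u x j
        * pderiv j (fun y => mollifyTwice ε w y i) x := fun i j =>
      integrable_transport_term hu
        (((smoothOnTorus_mollifyTwice hε hc.2.1).coord i).pderiv j).continuous i j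
    rw [transport, integral_finsetSum _ fun i _ => integrable_finsetSum _ fun j _ => hi i j]
    refine Finset.sum_congr rfl fun i _ => ?_
    rw [integral_finsetSum _ fun j _ => hi i j]
    refine Finset.sum_congr rfl fun j _ => ?_
    rw [e, integral_mollify_mul hk (huu i j) ((hW.coord i).pderiv j).continuous]
    simp_rw [eta_neg]
  have h2 : transport (mollify (eta ε) u) (mollify (eta ε) w) = ∑ i, ∑ j, ∫ x,
      mollify (eta ε) u x i * mollify (eta ε) u x j
        * pderiv j (fun y => mollify (eta ε) w y i) x := by
    rw [transport, integral_finsetSum _ fun i _ => integrable_finsetSum _ fun j _ => hi2 i j]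
    refine Finset.sum_congr rfl fun i _ => ?_
    rw [integral_finsetSum _ fun j _ => hi2 i j]
  rw [h1, ← sub_zero (∑ i, ∑ j, _), ← h0, h2, ← Finset.sum_sub_distrib]
  refine Finset.sum_congr rfl fun i _ => ?_
  rw [← Finset.sum_sub_distrib]
  refine Finset.sum_congr rfl fun j _ => ?_
  rw [← integral_sub (hi1 i j) (hi2 i j)]
  congr 1; ext x
  rw [commutator]; ring

theorem enorm_coord_le (a : E3) (i : Fin 3) : ‖a i‖ₑ ≤ ‖a‖ₑ := by
  rw [enorm_le_iff_norm_le]; exact abs_coord_le_norm a i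

theorem sq_lintegral_mul_le {α : Type*} [MeasurableSpace α] {μ : Measure α} {k h : α → ℝ≥0∞}
    (hk : AEMeasurable k μ) (hh : AEMeasurable h μ) (h1 : ∫⁻ y, k y ∂μ ≤ 1) :
    (∫⁻ y, k y * h y ∂μ) ^ 2 ≤ ∫⁻ y, k y * h y ^ 2 ∂μ := by
  have h2 := lintegral_prod_rpow_le_prod_eLpNorm (μ := μ) Finset.univ
    (f := fun i : Fin 2 => ![k, fun y => k y * h y ^ 2] i) (w := fun _ => 1 / 2)
    (p := fun _ => 1) (by intro i _; fin_cases i; exacts [hk, hk.mul (hh.pow_const 2)]) (by simp)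
    (by simp) (by
      simp only [div_one, Fin.sum_univ_two]
      rw [← ENNReal.ofReal_add (by norm_num) (by norm_num)]; norm_num)
  simp only [Fin.prod_univ_two, Matrix.cons_val_zero, Matrix.cons_val_one,
    eLpNorm_one_eq_lintegral_enorm, enorm_eq_self] at h2
  have e : ∀ y, k y ^ (1 / 2 : ℝ) * (k y * h y ^ 2) ^ (1 / 2 : ℝ) = k y * h y := fun y => by
    rw [ENNReal.mul_rpow_of_nonneg _ _ (by norm_num), ← mul_assoc,
      ← ENNReal.rpow_add_of_nonneg _ _ (by norm_num) (by norm_num), ← ENNReal.rpow_two,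
      ← ENNReal.rpow_mul]
    norm_num
  simp_rw [e] at h2
  calc (∫⁻ y, k y * h y ∂μ) ^ 2
      ≤ ((∫⁻ y, k y ∂μ) ^ (1 / 2 : ℝ) * (∫⁻ y, k y * h y ^ 2 ∂μ) ^ (1 / 2 : ℝ)) ^ 2 := by gcongr
    _ ≤ (1 * (∫⁻ y, k y * h y ^ 2 ∂μ) ^ (1 / 2 : ℝ)) ^ 2 := by
        gcongr
        exact ENNReal.rpow_le_one h1 (by norm_num)
    _ = _ := by
        rw [one_mul, ← ENNReal.rpow_two, ← ENNReal.rpow_mul]; norm_num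

theorem enorm_commutator_le {u : T3 → E3} (hu : MemLp u 2 volume) {ε : ℝ} (hε : 0 < ε)
    (i j : Fin 3) (x : T3) : ‖commutator ε u i j x‖ₑ
      ≤ 2 * ∫⁻ y, ‖eta ε y‖ₑ * ‖u x - u (x - toTorus y)‖ₑ ^ 2 := by
  have hk := isTestKernel_eta hε
  have hui : Integrable u := hu.integrable (by norm_num)
  have huu : Integrable fun y => u y i * u y j :=
    (MemLp.coord hu i).integrable_mul (MemLp.coord hu j)
  set c := u x with hc
  set L : E3 →L[ℝ] ℝ := c j • EuclideanSpace.proj (𝕜 := ℝ) i + c i • EuclideanSpace.proj (𝕜 := ℝ) j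
    with hL
  have hLa : ∀ a : E3, L a = c j * a i + c i * a j := fun a => by simp [hL]
  have hLi : Integrable fun y => L (u y) := L.integrable_comp hui
  have e : commutator ε u i j x = mollify (eta ε) (fun y => (u y i - c i) * (u y j - c j)) x
      - (mollify (eta ε) u x i - c i) * (mollify (eta ε) u x j - c j) := by
    have e1 : (fun y => (u y i - c i) * (u y j - c j))
        = fun y => u y i * u y j - (L (u y) - c i * c j) := by
      ext y; rw [hLa]; ring
    have hci : Integrable fun y => L (u y) - c i * c j := hLi.sub (integrable_const _)
    rw [e1, mollify_sub hk huu hci, mollify_sub hk hLi (integrable_const _), mollify_clm L hk hui,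
      mollify_const, integral_eta hε, hLa, commutator]
    simp only [smul_eq_mul]
    ring
  have h2 : ∀ l, ‖mollify (eta ε) u x l - c l‖ₑ
      ≤ ∫⁻ y, ‖eta ε y‖ₑ * ‖c - u (x - toTorus y)‖ₑ := fun l => by
    have := enorm_mollify_sub_le hk hui x c
    rw [integral_eta hε, one_smul] at this
    refine ((enorm_coord_le (mollify (eta ε) u x - c) l).trans this).trans_eq ?_
    refine lintegral_congr fun y => ?_
    rw [enorm_sub_rev]
  have hm : AEMeasurable fun y => ‖c - u (x - toTorus y)‖ₑ :=
    (aestronglyMeasurable_const.sub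
      (hui.1.comp_quasiMeasurePreserving (quasiMeasurePreserving_sub_toTorus x))).enorm
  rw [e, two_mul]
  refine (enorm_sub_le).trans (add_le_add ?_ ?_)
  · refine (enorm_mollify_le _ _ _).trans (lintegral_mono fun y => ?_)
    rw [enorm_mul, sq, enorm_sub_rev c]
    gcongr
    · exact enorm_coord_le (u (x - toTorus y) - c) i
    · exact enorm_coord_le (u (x - toTorus y) - c) j
  · rw [enorm_mul]
    refine (mul_le_mul' (h2 i) (h2 j)).trans ?_
    rw [← sq]
    exact sq_lintegral_mul_le hk.continuous.enorm.aemeasurable hm (lintegral_enorm_eta hε).le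

/-- The helicity flux is controlled by quadratic increments of the velocity and the gradient of
the mollified vorticity. -/
theorem exists_enorm_transport_le : ∃ C : ℝ≥0∞, C ≠ ⊤ ∧ ∀ ε : ℝ, 0 < ε → ∀ u w : T3 → E3,
    MemLp u 2 volume → IsWeakDivFree u → IsWeakCurl u w →
      ‖transport u (mollifyTwice ε w)‖ₑ ≤ C * ∫⁻ x,
        (∫⁻ y, ‖u x - u (x - toTorus y)‖ₑ ^ 2 ∂(ballMeasure ε))
          * ∑ j, ‖pderiv j (mollify (eta ε) w) x‖ₑ := by
  obtain ⟨c, hc, h⟩ := exists_lintegral_enorm_mul_le_ballMeasure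
  obtain ⟨K, hK, hb⟩ := exists_eta_bound
  refine ⟨3 * (2 * ENNReal.ofReal (c * K)), by finiteness, fun ε hε u w hu hd hcurl => ?_⟩
  have hW := smoothOnTorus_mollify_eta hε hcurl.2.1
  set A : T3 → ℝ≥0∞ := fun x => ∫⁻ y, ‖u x - u (x - toTorus y)‖ₑ ^ 2 ∂(ballMeasure ε)
  have h1 : ∀ i j x, ‖commutator ε u i j x‖ₑ ≤ 2 * ENNReal.ofReal (c * K) * A x :=
    fun i j x => by
      rw [mul_assoc]
      refine (enorm_commutator_le hu hε i j x).trans ?_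
      gcongr
      exact h hε hK.le (hb ε hε).1 (support_eta hε) _
  have hmeas : ∀ j, Measurable fun x => ‖pderiv j (mollify (eta ε) w) x‖ₑ := fun j =>
    (hW.pderiv j).continuous.enorm.measurable
  rw [transport_mollifyTwice_eq hu hd hcurl hε]
  calc ‖∑ i, ∑ j, ∫ x, commutator ε u i j x * pderiv j (fun y => mollify (eta ε) w y i) x‖ₑ
      ≤ ∑ _i : Fin 3, ∑ j, ∫⁻ x, (2 * ENNReal.ofReal (c * K) * A x)
          * ‖pderiv j (mollify (eta ε) w) x‖ₑ := by
        refine (enorm_sum_le _ _).trans (Finset.sum_le_sum fun i _ => ?_)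
        refine (enorm_sum_le _ _).trans (Finset.sum_le_sum fun j _ => ?_)
        refine (enorm_integral_le_lintegral_enorm _).trans (lintegral_mono fun x => ?_)
        rw [enorm_mul]
        gcongr
        · exact h1 i j x
        · rw [hW.pderiv_coord]; exact enorm_coord_le _ _
    _ = 3 * ∑ j, ∫⁻ x, (2 * ENNReal.ofReal (c * K) * A x)
          * ‖pderiv j (mollify (eta ε) w) x‖ₑ := by simp
    _ = 3 * ((2 * ENNReal.ofReal (c * K)) * ∑ j, ∫⁻ x, A x
          * ‖pderiv j (mollify (eta ε) w) x‖ₑ) := by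
        congr 1
        rw [Finset.mul_sum]
        refine Finset.sum_congr rfl fun j _ => ?_
        rw [← lintegral_const_mul' _ _ (by finiteness)]
        simp_rw [mul_assoc]
    _ = _ := by
        rw [← mul_assoc]
        congr 1
        have hA : AEMeasurable A := by
          have hac : (volume : Measure T3).prod (ballMeasure ε) ≪ volume.prod volume :=
            Measure.AbsolutelyContinuous.rfl.prod ProbabilityTheory.cond_absolutelyContinuous
          have hm : AEMeasurable (fun z : T3 × E3 => ‖u z.1 - u (z.1 - toTorus z.2)‖ₑ ^ 2)
              ((volume : Measure T3).prod (ballMeasure ε)) :=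
            (((hu.1.comp_fst).sub (aestronglyMeasurable_sub_toTorus hu.1)).enorm.pow_const
              2).mono_ac hac
          exact hm.lintegral_prod_right'
        simp_rw [Finset.mul_sum]
        exact (lintegral_finsetSum' (f := fun j x => A x * ‖pderiv j (mollify (eta ε) w) x‖ₑ) _
          fun j _ => hA.mul (hmeas j).aemeasurable).symm

theorem exists_enorm_pderiv_mollify_le : ∃ C : ℝ, 0 < C ∧ ∀ ε : ℝ, 0 < ε → ∀ w : T3 → E3,
    Integrable w → ∀ j x, ‖pderiv j (mollify (eta ε) w) x‖ₑ
      ≤ ENNReal.ofReal (C * ε⁻¹) * ∫⁻ y, ‖w x - w (x - toTorus y)‖ₑ ∂(ballMeasure ε) := by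
  obtain ⟨c, hc, h⟩ := exists_lintegral_enorm_mul_le_ballMeasure
  obtain ⟨K, hK, hb⟩ := exists_eta_bound
  refine ⟨c * K, by positivity, fun ε hε w hw j x => ?_⟩
  have hk := isTestKernel_eta hε
  rw [pderiv_mollify hk hw]
  have h1 := enorm_mollify_sub_le (hk.kderiv j) hw x (w x)
  rw [integral_kderiv hk, zero_smul, sub_zero] at h1
  refine h1.trans ?_
  have h2 := h hε (k := kderiv j (eta ε)) (K := K * ε⁻¹) (by positivity) (fun y => by
    refine ((hb ε hε).2.1 j y).trans_eq ?_
    field_simp)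
    (support_kderiv_subset Metric.isClosed_closedBall (support_eta hε) j)
    (fun y => ‖w (x - toTorus y) - w x‖ₑ)
  simp_rw [enorm_sub_rev (w x)]
  rw [mul_assoc]
  exact h2

theorem exists_enorm_pderiv_mollify_curl_le : ∃ C : ℝ, 0 < C ∧ ∀ ε : ℝ, 0 < ε →
    ∀ u w : T3 → E3, IsWeakCurl u w → ∀ j x, ‖pderiv j (mollify (eta ε) w) x‖ₑ
      ≤ ENNReal.ofReal (C * (ε ^ 2)⁻¹)
        * ∫⁻ y, ‖u x - u (x - toTorus y)‖ₑ ∂(ballMeasure ε) := by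
  obtain ⟨c, hc, h⟩ := exists_lintegral_enorm_mul_le_ballMeasure
  obtain ⟨K, hK, hb⟩ := exists_eta_bound
  refine ⟨6 * (c * K), by positivity, fun ε hε u w hcurl j x => ?_⟩
  have hk := isTestKernel_eta hε
  have hU := smoothOnTorus_mollify_eta hε hcurl.1
  set B : ℝ≥0∞ := ENNReal.ofReal (c * (K * (ε ^ 2)⁻¹))
    * ∫⁻ y, ‖u x - u (x - toTorus y)‖ₑ ∂(ballMeasure ε) with hB
  have h1 : ∀ a, ‖pderiv j (pderiv a (mollify (eta ε) u)) x‖ₑ ≤ B := by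
    intro a
    have e1 : pderiv a (mollify (eta ε) u) = mollify (kderiv a (eta ε)) u :=
      funext fun x => pderiv_mollify hk hcurl.1 a x
    rw [e1, pderiv_mollify (hk.kderiv a) hcurl.1]
    have h1 := enorm_mollify_sub_le ((hk.kderiv a).kderiv j) hcurl.1 x (u x)
    rw [integral_kderiv (hk.kderiv a), zero_smul, sub_zero] at h1
    refine h1.trans ?_
    have h2 := h hε (k := kderiv j (kderiv a (eta ε))) (K := K * (ε ^ 2)⁻¹) (by positivity)
      (fun y => by
        refine ((hb ε hε).2.2 j a y).trans_eq ?_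
        field_simp)
      (support_kderiv_subset Metric.isClosed_closedBall
        (support_kderiv_subset Metric.isClosed_closedBall (support_eta hε) a) j)
      (fun y => ‖u (x - toTorus y) - u x‖ₑ)
    simp_rw [hB, enorm_sub_rev (u x)]
    exact h2
  have h2 : ∀ a b l m, ‖pderiv j (fun x => pderiv a (fun y => mollify (eta ε) u y b) x
      - pderiv l (fun y => mollify (eta ε) u y m) x) x‖ₑ ≤ 2 * B := by
    intro a b l m
    have e : ∀ a b, pderiv a (fun y => mollify (eta ε) u y b)
        = fun y => pderiv a (mollify (eta ε) u) y b := fun a b =>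
      funext fun y => hU.pderiv_coord b a y
    rw [((hU.coord b).pderiv a).pderiv_sub ((hU.coord m).pderiv l), e, e,
      (hU.pderiv a).pderiv_coord, (hU.pderiv l).pderiv_coord, two_mul]
    refine enorm_sub_le.trans (add_le_add ?_ ?_)
    · exact (enorm_coord_le _ _).trans (h1 a)
    · exact (enorm_coord_le _ _).trans (h1 l)
  have h3 : ∀ i, ‖pderiv j (mollify (eta ε) w) x i‖ₑ ≤ 2 * B := by
    intro i
    rw [← hcurl.curl_mollify hk, ← hU.curl.pderiv_coord]
    fin_cases i
    · exact h2 1 2 2 1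
    · exact h2 2 0 0 2
    · exact h2 0 1 1 0
  have h4 : ∀ a : E3, ‖a‖ₑ ≤ ∑ i, ‖a i‖ₑ := by
    intro a
    have e : a = ∑ i, (a i) • basisVec i := by
      ext j; simp [Pi.single_apply]
    conv_lhs => rw [e]
    refine (enorm_sum_le _ _).trans_eq (Finset.sum_congr rfl fun i _ => ?_)
    have : ‖basisVec i‖ₑ = 1 := by rw [← ofReal_norm]; simp
    rw [enorm_smul, this, mul_one]
  refine (h4 _).trans ((Finset.sum_le_sum fun i _ => h3 i).trans_eq ?_)
  simp only [Finset.sum_const, Finset.card_univ, Fintype.card_fin, nsmul_eq_mul, hB]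
  rw [show 6 * (c * K) * (ε ^ 2)⁻¹ = 6 * (c * (K * (ε ^ 2)⁻¹)) by ring,
    ENNReal.ofReal_mul (p := 6) (by norm_num), ENNReal.ofReal_ofNat]
  push_cast
  ring

/-! ### Measurability of increments -/

theorem measurable_essSup_section {α β : Type*} [MeasurableSpace α] [MeasurableSpace β]
    {ν : Measure β} [SFinite ν] {f : α × β → ℝ≥0∞} (hf : Measurable f) :
    Measurable fun a => essSup (fun b => f (a, b)) ν := by
  refine measurable_of_Iic fun c => ?_
  have h1 : (fun a => essSup (fun b => f (a, b)) ν) ⁻¹' Iic c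
      = (fun a => ν (Prod.mk a ⁻¹' {z | c < f z})) ⁻¹' {0} := by
    ext a
    have h2 : essSup (fun b => f (a, b)) ν ≤ c ↔ ∀ᵐ b ∂ν, f (a, b) ≤ c :=
      ⟨fun h => (ENNReal.ae_le_essSup _).mono fun b hb => hb.trans h,
        fun h => essSup_le_of_ae_le c h⟩
    simp only [mem_preimage, mem_Iic, mem_singleton_iff]
    rw [h2, ae_iff]
    simp [not_le, preimage]
  rw [h1]
  exact (measurable_measure_prodMk_left (measurableSet_lt measurable_const hf))
    (measurableSet_singleton 0)

theorem aemeasurable_eLpNorm_section {α β F : Type*} [MeasurableSpace α] [MeasurableSpace β]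
    [NormedAddCommGroup F] {μ : Measure α} {ν : Measure β} [SFinite ν] {f : α × β → F}
    (hf : AEStronglyMeasurable f (μ.prod ν)) (q : ℝ≥0∞) :
    AEMeasurable (fun a => eLpNorm (fun b => f (a, b)) q ν) μ := by
  rcases eq_or_ne q 0 with rfl | hq0
  · simp
  rcases eq_or_ne q ⊤ with rfl | hqt
  · simp only [eLpNorm_exponent_top, eLpNormEssSup]
    have hm := hf.enorm
    refine ⟨_, measurable_essSup_section (ν := ν) hm.measurable_mk, ?_⟩
    filter_upwards [Measure.ae_ae_of_ae_prod hm.ae_eq_mk] with a ha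
    exact essSup_congr_ae ha
  · simp only [eLpNorm_eq_lintegral_rpow_enorm_toReal hq0 hqt]
    exact ((hf.enorm.pow_const q.toReal).lintegral_prod_right').pow_const _

theorem eLpNorm_sub_translate {f : T3 → E3} (hf : AEStronglyMeasurable f) (q : ℝ≥0∞) (y : E3) :
    eLpNorm (fun x => f x - f (x - toTorus y)) q volume = incrNorm q f y := by
  have hm := measurePreserving_sub_right_T3 (toTorus y)
  have hma := measurePreserving_add_right_T3 (toTorus y)
  have h := eLpNorm_comp_measurePreserving (p := q)
    ((hf.comp_measurePreserving hma).sub hf) hm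
  rw [incrNorm]
  refine Eq.trans ?_ h
  congr 1
  ext1 x
  simp

theorem incrNorm_le {f : T3 → E3} (hf : AEStronglyMeasurable f) {q : ℝ≥0∞} (hq : 1 ≤ q) (y : E3) :
    incrNorm q f y ≤ 2 * eLpNorm f q volume := by
  have hma := measurePreserving_add_right_T3 (toTorus y)
  rw [incrNorm, two_mul]
  refine (eLpNorm_sub_le (f := fun x => f (x + toTorus y)) (hf.comp_measurePreserving hma) hf
    hq).trans_eq ?_
  congr 1
  exact eLpNorm_comp_measurePreserving hf hma

theorem aestronglyMeasurable_increment {τ : Measure ℝ} [SFinite τ] {f : ℝ → T3 → E3}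
    (hf : AEStronglyMeasurable (fun z : ℝ × T3 => f z.1 z.2) (τ.prod volume)) (β : Measure E3)
    [IsProbabilityMeasure β] :
    AEStronglyMeasurable (fun z : (ℝ × E3) × T3 => f z.1.1 z.2 - f z.1.1 (z.2 - toTorus z.1.2))
      ((τ.prod β).prod volume) := by
  have hfst : MeasurePreserving (Prod.fst : ℝ × E3 → ℝ) (τ.prod β) τ := measurePreserving_fst
  have h1 : MeasurePreserving (fun z : (ℝ × E3) × T3 => (z.1.1, z.2 - toTorus z.1.2))
      ((τ.prod β).prod volume) (τ.prod volume) :=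
    hfst.skew_product (g := fun a x => x - toTorus a.2)
      (measurable_snd.sub (measurable_toTorus.comp (measurable_snd.comp measurable_fst)))
      (Eventually.of_forall fun a => (measurePreserving_sub_right_T3 (toTorus a.2)).map_eq)
  have h2 : MeasurePreserving (fun z : (ℝ × E3) × T3 => (z.1.1, z.2))
      ((τ.prod β).prod volume) (τ.prod volume) :=
    hfst.skew_product (g := fun _ x => x) measurable_snd
      (Eventually.of_forall fun a => Measure.map_id)
  exact (hf.comp_measurePreserving h2).sub (hf.comp_measurePreserving h1)

theorem ae_aestronglyMeasurable_section {τ : Measure ℝ} [SFinite τ] {f : ℝ → T3 → E3}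
    (hf : AEStronglyMeasurable (fun z : ℝ × T3 => f z.1 z.2) (τ.prod volume)) :
    ∀ᵐ t ∂τ, AEStronglyMeasurable (f t) volume :=
  hf.prodMk_left

theorem aemeasurable_incrNorm_prod {τ : Measure ℝ} [SFinite τ] {f : ℝ → T3 → E3}
    (hf : AEStronglyMeasurable (fun z : ℝ × T3 => f z.1 z.2) (τ.prod volume)) (β : Measure E3)
    [IsProbabilityMeasure β] (q : ℝ≥0∞) :
    AEMeasurable (fun z : ℝ × E3 => incrNorm q (f z.1) z.2) (τ.prod β) := by
  refine (aemeasurable_eLpNorm_section (aestronglyMeasurable_increment hf β) q).congr ?_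
  have := Measure.quasiMeasurePreserving_fst (μ := τ) (ν := β) |>.ae
    (ae_aestronglyMeasurable_section hf)
  filter_upwards [this] with z hz
  exact eLpNorm_sub_translate hz q z.2

theorem aemeasurable_incrNorm {τ : Measure ℝ} [SFinite τ] {f : ℝ → T3 → E3}
    (hf : AEStronglyMeasurable (fun z : ℝ × T3 => f z.1 z.2) (τ.prod volume)) (q : ℝ≥0∞) (y : E3) :
    AEMeasurable (fun t => incrNorm q (f t) y) τ := by
  have h1 : MeasurePreserving (fun z : ℝ × T3 => (z.1, z.2 + toTorus y))
      (τ.prod volume) (τ.prod volume) :=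
    (MeasurePreserving.id τ).skew_product (g := fun _ x => x + toTorus y)
      (measurable_snd.add_const _)
      (Eventually.of_forall fun a => (measurePreserving_add_right_T3 (toTorus y)).map_eq)
  exact aemeasurable_eLpNorm_section ((hf.comp_measurePreserving h1).sub hf) q

theorem ae_ballMeasure_mem (ε : ℝ) : ∀ᵐ y ∂(ballMeasure ε), y ∈ Metric.ball 0 ε := by
  exact Measure.ae_smul_measure (ae_restrict_mem measurableSet_ball) _

theorem quasiMeasurePreserving_fst_ballMeasure_prod (ε : ℝ) {μ : Measure T3} [SFinite μ] :
    Measure.QuasiMeasurePreserving (fun z : T3 × (E3 × E3) => (z.1, z.2.1))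
      (μ.prod ((ballMeasure ε).prod (ballMeasure ε))) (μ.prod (ballMeasure ε)) :=
  ⟨by fun_prop, by
    have := (Measure.map_prod_map μ ((ballMeasure ε).prod (ballMeasure ε)) measurable_id
      (measurable_fst (α := E3) (β := E3)))
    rw [Measure.map_id] at this
    change Measure.map (Prod.map id Prod.fst) _ ≪ _
    rw [← this]
    exact Measure.AbsolutelyContinuous.rfl.prod
      (Measure.quasiMeasurePreserving_fst (μ := ballMeasure ε) (ν := ballMeasure ε)).2⟩

theorem quasiMeasurePreserving_snd_ballMeasure_prod (ε : ℝ) {μ : Measure T3} [SFinite μ] :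
    Measure.QuasiMeasurePreserving (fun z : T3 × (E3 × E3) => (z.1, z.2.2))
      (μ.prod ((ballMeasure ε).prod (ballMeasure ε))) (μ.prod (ballMeasure ε)) :=
  ⟨by fun_prop, by
    have := (Measure.map_prod_map μ ((ballMeasure ε).prod (ballMeasure ε)) measurable_id
      (measurable_snd (α := E3) (β := E3)))
    rw [Measure.map_id] at this
    change Measure.map (Prod.map id Prod.snd) _ ≪ _
    rw [← this]
    exact Measure.AbsolutelyContinuous.rfl.prod
      (Measure.quasiMeasurePreserving_snd (μ := ballMeasure ε) (ν := ballMeasure ε)).2⟩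

theorem aestronglyMeasurable_increment_ballMeasure {f : T3 → E3} (hf : AEStronglyMeasurable f)
    (ε : ℝ) : AEStronglyMeasurable (fun z : T3 × E3 => f z.1 - f (z.1 - toTorus z.2))
      ((volume : Measure T3).prod (ballMeasure ε)) :=
  (hf.comp_fst.sub (aestronglyMeasurable_sub_toTorus hf)).mono_ac
    (Measure.AbsolutelyContinuous.rfl.prod ProbabilityTheory.cond_absolutelyContinuous)

theorem aestronglyMeasurable_increment_at {f : T3 → E3} (hf : AEStronglyMeasurable f) (ε : ℝ)
    (x : T3) : AEStronglyMeasurable (fun y : E3 => f x - f (x - toTorus y)) (ballMeasure ε) :=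
  (aestronglyMeasurable_const.sub (hf.comp_quasiMeasurePreserving
    (quasiMeasurePreserving_sub_toTorus x))).mono_ac ProbabilityTheory.cond_absolutelyContinuous

/-! ### Flux estimates in terms of increments of the velocity and of the vorticity -/

theorem lintegral_sq_mul_le_incrNorm {u w : T3 → E3} (hu : AEStronglyMeasurable u)
    (hw : AEStronglyMeasurable w) {θ : ℝ} (hθ0 : 0 < θ) (hθ2 : θ ≤ 2) {l q : ℝ≥0∞} (hl : 1 ≤ l)
    (hq : 1 ≤ q) (hlq : ENNReal.ofReal θ / l + 1 / q = ENNReal.ofReal θ / 2) (y z : E3) :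
    ∫⁻ x, ‖u x - u (x - toTorus y)‖ₑ ^ 2 * ‖w x - w (x - toTorus z)‖ₑ
      ≤ incrNorm l u y ^ θ * (2 * eLpNorm u 2 volume) ^ (2 - θ) * incrNorm q w z := by
  have hm : ∀ {f : T3 → E3}, AEStronglyMeasurable f → ∀ y : E3,
      AEMeasurable fun x => ‖f x - f (x - toTorus y)‖ₑ := fun hf y =>
    (hf.sub (hf.comp_measurePreserving (measurePreserving_sub_right_T3 (toTorus y)))).enorm
  have h := lintegral_prod_rpow_le_prod_eLpNorm (μ := (volume : Measure T3)) Finset.univ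
    (f := fun i : Fin 3 => ![fun x => ‖u x - u (x - toTorus y)‖ₑ,
      fun x => ‖u x - u (x - toTorus y)‖ₑ, fun x => ‖w x - w (x - toTorus z)‖ₑ] i)
    (w := ![θ, 2 - θ, 1]) (p := ![l, 2, q])
    (by intro i _; fin_cases i; exacts [hm hu y, hm hu y, hm hw z])
    (by intro i _; fin_cases i <;> simp [hθ0.le, hθ2])
    (by intro i _; fin_cases i <;> simp <;> (rintro rfl; simp at hl hq))
    (by
      rw [Fin.sum_univ_three]
      simp only [Matrix.cons_val_zero, Matrix.cons_val_one, Matrix.cons_val, ENNReal.ofReal_one]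
      rw [add_right_comm, hlq, ← ENNReal.add_div, ← ENNReal.ofReal_add hθ0.le (by linarith),
        add_sub_cancel, ENNReal.ofReal_ofNat]
      exact ENNReal.div_self two_ne_zero (by simp))
  simp only [Fin.prod_univ_three, Matrix.cons_val_zero, Matrix.cons_val_one, Matrix.cons_val,
    ENNReal.rpow_one, eLpNorm_enorm, eLpNorm_sub_translate hu, eLpNorm_sub_translate hw] at h
  refine le_trans (lintegral_mono fun x => ?_) (h.trans ?_)
  · rw [← ENNReal.rpow_add_of_nonneg _ _ hθ0.le (by linarith)]
    simp
  · gcongr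
    exact incrNorm_le hu (by norm_num) y

theorem exists_enorm_transport_le_incrNorm {θ : ℝ} (hθ0 : 0 < θ) (hθ2 : θ ≤ 2) {l q : ℝ≥0∞}
    (hl : 1 ≤ l) (hq : 1 ≤ q)
    (hlq : ENNReal.ofReal θ / l + 1 / q = ENNReal.ofReal θ / 2) :
    ∃ C : ℝ≥0∞, C ≠ ⊤ ∧ ∀ ε : ℝ, 0 < ε → ∀ u w : T3 → E3, MemLp u 2 volume → IsWeakDivFree u →
      IsWeakCurl u w → ‖transport u (mollifyTwice ε w)‖ₑ
        ≤ C * ENNReal.ofReal ε⁻¹ * (2 * eLpNorm u 2 volume) ^ (2 - θ)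
          * ∫⁻ z, incrNorm l u z.1 ^ θ * incrNorm q w z.2
            ∂((ballMeasure ε).prod (ballMeasure ε)) := by
  obtain ⟨C₁, hC₁, h₁⟩ := exists_enorm_transport_le
  obtain ⟨C₂, hC₂, h₂⟩ := exists_enorm_pderiv_mollify_le
  refine ⟨C₁ * (3 * ENNReal.ofReal C₂), by finiteness, fun ε hε u w hu hd hc => ?_⟩
  have hpb := isProbabilityMeasure_ballMeasure hε
  set β := ballMeasure ε
  have hum := hu.1
  have hwm := hc.2.1.1
  have hM : (2 * eLpNorm u 2 volume) ^ (2 - θ) ≠ ⊤ :=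
    ENNReal.rpow_ne_top_of_nonneg (by linarith) (ENNReal.mul_ne_top (by simp) hu.2.ne)
  set A : T3 → ℝ≥0∞ := fun x => ∫⁻ y, ‖u x - u (x - toTorus y)‖ₑ ^ 2 ∂β
  set B : T3 → ℝ≥0∞ := fun x => ∫⁻ y, ‖w x - w (x - toTorus y)‖ₑ ∂β
  calc ‖transport u (mollifyTwice ε w)‖ₑ
      ≤ C₁ * ∫⁻ x, A x * ∑ j, ‖pderiv j (mollify (eta ε) w) x‖ₑ := h₁ ε hε u w hu hd hc
    _ ≤ C₁ * ∫⁻ x, (3 * ENNReal.ofReal (C₂ * ε⁻¹)) * (A x * B x) := by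
        refine mul_le_mul' le_rfl (lintegral_mono fun x => ?_)
        calc A x * ∑ j, ‖pderiv j (mollify (eta ε) w) x‖ₑ
            ≤ A x * ∑ _j : Fin 3, ENNReal.ofReal (C₂ * ε⁻¹) * B x := by
              gcongr with j
              exact h₂ ε hε w hc.2.1 j x
          _ = _ := by simp; ring
    _ = C₁ * ((3 * ENNReal.ofReal (C₂ * ε⁻¹)) * ∫⁻ z, (∫⁻ x,
          ‖u x - u (x - toTorus z.1)‖ₑ ^ 2 * ‖w x - w (x - toTorus z.2)‖ₑ) ∂(β.prod β)) := by
        rw [lintegral_const_mul' _ _ (by finiteness)]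
        have e : ∀ x, A x * B x = ∫⁻ z, ‖u x - u (x - toTorus z.1)‖ₑ ^ 2
            * ‖w x - w (x - toTorus z.2)‖ₑ ∂(β.prod β) := fun x =>
          (lintegral_prod_mul
            ((aestronglyMeasurable_increment_at hum ε x).enorm.pow_const 2)
            (aestronglyMeasurable_increment_at hwm ε x).enorm).symm
        simp_rw [e]
        rw [lintegral_lintegral_swap]
        exact ((((aestronglyMeasurable_increment_ballMeasure hum ε).comp_quasiMeasurePreserving
          (quasiMeasurePreserving_fst_ballMeasure_prod ε)).enorm.pow_const 2).mul
          ((aestronglyMeasurable_increment_ballMeasure hwm ε).comp_quasiMeasurePreserving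
          (quasiMeasurePreserving_snd_ballMeasure_prod ε)).enorm)
    _ ≤ C₁ * ((3 * ENNReal.ofReal (C₂ * ε⁻¹)) * ∫⁻ z, (2 * eLpNorm u 2 volume) ^ (2 - θ)
          * (incrNorm l u z.1 ^ θ * incrNorm q w z.2) ∂(β.prod β)) := by
        gcongr with z
        refine (lintegral_sq_mul_le_incrNorm hum hwm hθ0 hθ2 hl hq hlq z.1 z.2).trans_eq ?_
        ring
    _ = _ := by
        rw [lintegral_const_mul' _ _ hM, ENNReal.ofReal_mul hC₂.le]
        ring

theorem IsWeakEulerSolution.exists_eLpNorm_two_bound {T : ℝ} {v : ℝ → T3 → E3}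
    {P : ℝ → T3 → ℝ} (hv : IsWeakEulerSolution T v P) :
    ∃ M : ℝ≥0∞, M ≠ ⊤ ∧ ∀ t ∈ Icc 0 T, eLpNorm (v t) 2 volume ≤ M := by
  obtain ⟨E, hE⟩ := hv.exists_energy_bound
  refine ⟨ENNReal.ofReal E ^ (1 / 2 : ℝ), by finiteness, fun t ht => ?_⟩
  have hm := hv.memLp_two t ht
  rw [hm.eLpNorm_eq_integral_rpow_norm (by norm_num) (by norm_num),
    ← ENNReal.ofReal_rpow_of_nonneg (integral_nonneg fun _ => by positivity) (by norm_num)]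
  simp only [ENNReal.toReal_ofNat, Real.rpow_ofNat, one_div]
  gcongr
  exact hE t ht

theorem aemeasurable_rpow_mul_prod {τ : Measure ℝ} [SFinite τ] {β : Measure E3}
    [IsProbabilityMeasure β] {G H : ℝ × E3 → ℝ≥0∞} (θ : ℝ) (hG : AEMeasurable G (τ.prod β))
    (hH : AEMeasurable H (τ.prod β)) :
    AEMeasurable (fun z : ℝ × (E3 × E3) => G (z.1, z.2.1) ^ θ * H (z.1, z.2.2))
      (τ.prod (β.prod β)) := by
  have m1 : MeasurePreserving (fun z : ℝ × (E3 × E3) => (z.1, z.2.1)) (τ.prod (β.prod β))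
      (τ.prod β) := (MeasurePreserving.id τ).prod measurePreserving_fst
  have m2 : MeasurePreserving (fun z : ℝ × (E3 × E3) => (z.1, z.2.2)) (τ.prod (β.prod β))
      (τ.prod β) := (MeasurePreserving.id τ).prod measurePreserving_snd
  exact ((hG.comp_quasiMeasurePreserving m1.quasiMeasurePreserving).pow_const θ).mul
    (hH.comp_quasiMeasurePreserving m2.quasiMeasurePreserving)

theorem IsWeakEulerSolution.exists_lintegral_flux_le_incrNorm {T : ℝ} (hT : 0 < T)
    {v ω : ℝ → T3 → E3} {P : ℝ → T3 → ℝ} (hv : IsWeakEulerSolution T v P)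
    (hcurl : ∀ t ∈ Icc 0 T, IsWeakCurl (v t) (ω t)) {θ : ℝ} (hθ0 : 0 < θ) (hθ2 : θ ≤ 2)
    {k l p q : ℝ≥0∞} (hk : 1 ≤ k) (hl : 1 ≤ l) (hp : 1 ≤ p) (hq : 1 ≤ q)
    (hkp : ENNReal.ofReal θ / k + 1 / p = 1)
    (hlq : ENNReal.ofReal θ / l + 1 / q = ENNReal.ofReal θ / 2)
    (hvm : AEStronglyMeasurable (fun z : ℝ × T3 => v z.1 z.2)
      ((volume.restrict (Ioo 0 T)).prod volume))
    (hωm : AEStronglyMeasurable (fun z : ℝ × T3 => ω z.1 z.2)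
      ((volume.restrict (Ioo 0 T)).prod volume)) :
    ∃ C : ℝ≥0∞, C ≠ ⊤ ∧ ∀ ε : ℝ, 0 < ε → ∀ K L : ℝ≥0∞,
      (∀ y ∈ Metric.ball (0 : E3) ε, timeNorm T k (fun t => incrNorm l (v t) y) ≤ K) →
      (∀ y ∈ Metric.ball (0 : E3) ε, timeNorm T p (fun t => incrNorm q (ω t) y) ≤ L) →
      ∫⁻ t in Ioo 0 T, ‖flux ε v ω t‖ₑ ≤ C * ENNReal.ofReal ε⁻¹ * (K ^ θ * L) := by
  obtain ⟨C, hC, h⟩ := exists_enorm_transport_le_incrNorm hθ0 hθ2 hl hq hlq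
  obtain ⟨M, hM, hMb⟩ := hv.exists_eLpNorm_two_bound
  have hM' : (2 * M) ^ (2 - θ) ≠ ⊤ := ENNReal.rpow_ne_top_of_nonneg (by linarith) (by finiteness)
  refine ⟨C * (2 * M) ^ (2 - θ), by finiteness, fun ε hε K L hK hL => ?_⟩
  have hpb := isProbabilityMeasure_ballMeasure hε
  set β := ballMeasure ε
  set τ := (volume : Measure ℝ).restrict (Ioo 0 T)
  have hmeas : AEMeasurable (fun z : ℝ × (E3 × E3) =>
      incrNorm l (v z.1) z.2.1 ^ θ * incrNorm q (ω z.1) z.2.2) (τ.prod (β.prod β)) :=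
    aemeasurable_rpow_mul_prod (G := fun z => incrNorm l (v z.1) z.2)
      (H := fun z => incrNorm q (ω z.1) z.2) θ (aemeasurable_incrNorm_prod hvm β l)
      (aemeasurable_incrNorm_prod hωm β q)
  have htime : ∀ y z : E3, ∫⁻ t, incrNorm l (v t) y ^ θ * incrNorm q (ω t) z ∂τ
      ≤ timeNorm T k (fun t => incrNorm l (v t) y) ^ θ
        * timeNorm T p (fun t => incrNorm q (ω t) z) := by
    intro y z
    have h := lintegral_prod_rpow_le_prod_eLpNorm (μ := τ) Finset.univ
      (f := fun i : Fin 2 => ![fun t => incrNorm l (v t) y, fun t => incrNorm q (ω t) z] i)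
      (w := ![θ, 1]) (p := ![k, p])
      (by
        intro i _; fin_cases i
        exacts [aemeasurable_incrNorm hvm l y, aemeasurable_incrNorm hωm q z])
      (by intro i _; fin_cases i <;> simp [hθ0.le])
      (by intro i _; fin_cases i <;> simp <;> (rintro rfl; simp at hk hp))
      (by
        rw [Fin.sum_univ_two]
        simpa only [Matrix.cons_val_zero, Matrix.cons_val_one, ENNReal.ofReal_one] using hkp)
    simp only [Fin.prod_univ_two, Matrix.cons_val_zero, Matrix.cons_val_one,
      ENNReal.rpow_one] at h
    exact h
  calc ∫⁻ t in Ioo 0 T, ‖flux ε v ω t‖ₑ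
      ≤ ∫⁻ t in Ioo 0 T, C * ENNReal.ofReal ε⁻¹ * (2 * M) ^ (2 - θ)
          * ∫⁻ z, incrNorm l (v t) z.1 ^ θ * incrNorm q (ω t) z.2 ∂(β.prod β) := by
        refine setLIntegral_mono' measurableSet_Ioo fun t ht => ?_
        have ht' := Ioo_subset_Icc_self ht
        refine (h ε hε _ _ (hv.memLp_two t ht') (hv.isWeakDivFree hT t ht') (hcurl t ht')).trans ?_
        gcongr
        exact hMb t ht'
    _ = C * ENNReal.ofReal ε⁻¹ * (2 * M) ^ (2 - θ) * ∫⁻ z, (∫⁻ t,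
          incrNorm l (v t) z.1 ^ θ * incrNorm q (ω t) z.2 ∂τ) ∂(β.prod β) := by
        rw [lintegral_const_mul' _ _ (by finiteness), lintegral_lintegral_swap hmeas]
    _ ≤ C * ENNReal.ofReal ε⁻¹ * (2 * M) ^ (2 - θ) * ∫⁻ z, K ^ θ * L ∂(β.prod β) := by
        gcongr 1
        have hb1 := (Measure.quasiMeasurePreserving_fst (μ := β) (ν := β)).ae
          (ae_ballMeasure_mem ε)
        have hb2 := (Measure.quasiMeasurePreserving_snd (μ := β) (ν := β)).ae
          (ae_ballMeasure_mem ε)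
        refine lintegral_mono_ae ?_
        filter_upwards [hb1, hb2] with z h1 h2
        refine (htime z.1 z.2).trans ?_
        gcongr
        · exact hK _ h1
        · exact hL _ h2
    _ = _ := by
        rw [lintegral_const, measure_univ]
        ring

theorem MemLpBesovC.eventually_le {T : ℝ} {p q : ℝ≥0∞} {s : ℝ} (hs : 0 < s)
    {f : ℝ → T3 → E3} (h : MemLpBesovC T p s q f) {δ : ℝ≥0∞} (hδ : 0 < δ) :
    ∀ᶠ ε : ℝ in 𝓝[>] 0, ∀ y ∈ Metric.ball (0 : E3) ε,
      timeNorm T p (fun t => incrNorm q (f t) y) ≤ δ * ENNReal.ofReal (ε ^ s) := by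
  have h1 := h.2.eventually (gt_mem_nhds hδ)
  rw [eventually_nhdsWithin_iff, Metric.eventually_nhds_iff] at h1
  obtain ⟨r, hr, h1⟩ := h1
  filter_upwards [Ioo_mem_nhdsGT hr] with ε hε y hy
  rcases eq_or_ne y 0 with rfl | hy0
  · have : toTorus 0 = 0 := by ext i; simp [toTorus]
    simp [incrNorm, this, timeNorm]
  have hyε : ‖y‖ < ε := by simpa using hy
  have h2 := (h1 (by simpa using hyε.trans hε.2) hy0).le
  have hy1 : ENNReal.ofReal (‖y‖ ^ s) ≠ 0 := by
    simp only [ne_eq, ENNReal.ofReal_eq_zero, not_le]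
    exact Real.rpow_pos_of_pos (norm_pos_iff.2 hy0) _
  rw [ENNReal.div_le_iff hy1 ENNReal.ofReal_ne_top] at h2
  refine h2.trans ?_
  gcongr

theorem MemLpBesovInfty.exists_le {T : ℝ} {p q : ℝ≥0∞} {s : ℝ} (hs : 0 < s)
    {f : ℝ → T3 → E3} (h : MemLpBesovInfty T p s q f) : ∃ N : ℝ≥0∞, N ≠ ⊤ ∧
    ∀ ε : ℝ, ∀ y ∈ Metric.ball (0 : E3) ε,
      timeNorm T p (fun t => incrNorm q (f t) y) ≤ N * ENNReal.ofReal (ε ^ s) := by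
  refine ⟨_, h.2.ne, fun ε y hy => ?_⟩
  rcases eq_or_ne y 0 with rfl | hy0
  · have : toTorus 0 = 0 := by ext i; simp [toTorus]
    simp [incrNorm, this, timeNorm]
  have hyε : ‖y‖ < ε := by simpa using hy
  have hy1 : ENNReal.ofReal (‖y‖ ^ s) ≠ 0 := by
    simp only [ne_eq, ENNReal.ofReal_eq_zero, not_le]
    exact Real.rpow_pos_of_pos (norm_pos_iff.2 hy0) _
  have h1 : ∀ t, incrNorm q (f t) y
      ≤ ((‖y‖ ^ s).toNNReal : ℝ≥0∞) * besovSeminorm s q (f t) := by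
    intro t
    change _ ≤ ENNReal.ofReal (‖y‖ ^ s) * _
    rw [mul_comm, ← ENNReal.div_le_iff hy1 ENNReal.ofReal_ne_top]
    exact le_iSup₂_of_le y hy0 le_rfl
  have h2 := eLpNorm_le_nnreal_smul_eLpNorm_of_ae_le_mul' (p := p)
    (μ := volume.restrict (Ioo 0 T)) (f := fun t => incrNorm q (f t) y)
    (g := fun t => besovSeminorm s q (f t)) (Eventually.of_forall fun t => by simpa using h1 t)
  refine h2.trans ?_
  rw [ENNReal.smul_def, smul_eq_mul, mul_comm]
  change timeNorm T p _ * ENNReal.ofReal (‖y‖ ^ s) ≤ _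
  gcongr

theorem tendsto_flux_of_besov {T : ℝ} {v ω : ℝ → T3 → E3} {θ α β : ℝ} (hθ0 : 0 < θ)
    (hαβ : 1 ≤ θ * α + β) {k l p q : ℝ≥0∞} {C : ℝ≥0∞} (hC : C ≠ ⊤)
    (h : ∀ ε : ℝ, 0 < ε → ∀ K L : ℝ≥0∞,
      (∀ y ∈ Metric.ball (0 : E3) ε, timeNorm T k (fun t => incrNorm l (v t) y) ≤ K) →
      (∀ y ∈ Metric.ball (0 : E3) ε, timeNorm T p (fun t => incrNorm q (ω t) y) ≤ L) →
      ∫⁻ t in Ioo 0 T, ‖flux ε v ω t‖ₑ ≤ C * ENNReal.ofReal ε⁻¹ * (K ^ θ * L))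
    (hb : ∀ c : ℝ≥0∞, 0 < c → ∃ K L : ℝ≥0∞, K ^ θ * L ≤ c ∧
      ∀ᶠ ε : ℝ in 𝓝[>] 0,
        (∀ y ∈ Metric.ball (0 : E3) ε, timeNorm T k (fun t => incrNorm l (v t) y)
          ≤ K * ENNReal.ofReal (ε ^ α)) ∧
        (∀ y ∈ Metric.ball (0 : E3) ε, timeNorm T p (fun t => incrNorm q (ω t) y)
          ≤ L * ENNReal.ofReal (ε ^ β))) :
    Tendsto (fun ε => ∫⁻ t in Ioo 0 T, ‖flux ε v ω t‖ₑ) (𝓝[>] 0) (𝓝 0) := by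
  rw [ENNReal.tendsto_nhds_zero]
  intro c hc
  obtain ⟨K, L, hKL, hev⟩ := hb (c / (C + 1)) (ENNReal.div_pos hc.ne' (by finiteness))
  filter_upwards [hev, Ioc_mem_nhdsGT (show (0 : ℝ) < 1 by norm_num)] with ε ⟨h1, h2⟩ hε
  refine (h ε hε.1 _ _ h1 h2).trans ?_
  have e1 : ENNReal.ofReal ε⁻¹ * (ENNReal.ofReal (ε ^ α) ^ θ * ENNReal.ofReal (ε ^ β)) ≤ 1 := by
    rw [ENNReal.ofReal_rpow_of_nonneg (Real.rpow_nonneg hε.1.le _) hθ0.le,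
      ← ENNReal.ofReal_mul (by have := hε.1; positivity),
      ← ENNReal.ofReal_mul (by have := hε.1; positivity), ← ENNReal.ofReal_one]
    refine ENNReal.ofReal_le_ofReal ?_
    rw [← Real.rpow_mul hε.1.le, ← Real.rpow_neg_one, ← Real.rpow_add hε.1,
      ← Real.rpow_add hε.1]
    exact Real.rpow_le_one hε.1.le hε.2 (by linarith)
  calc C * ENNReal.ofReal ε⁻¹ * ((K * ENNReal.ofReal (ε ^ α)) ^ θ * (L * ENNReal.ofReal (ε ^ β)))
      = C * (K ^ θ * L) * (ENNReal.ofReal ε⁻¹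
          * (ENNReal.ofReal (ε ^ α) ^ θ * ENNReal.ofReal (ε ^ β))) := by
        rw [ENNReal.mul_rpow_of_nonneg _ _ hθ0.le]; ring
    _ ≤ (C + 1) * (c / (C + 1)) * 1 := by gcongr; exact le_self_add
    _ = c := by rw [mul_one, ENNReal.mul_div_cancel (by simp) (by finiteness)]

theorem exists_pos_rpow_mul_le {θ : ℝ} (hθ : 0 < θ) {N c : ℝ≥0∞} (hN : N ≠ ⊤) (hc : 0 < c) :
    ∃ δ : ℝ≥0∞, 0 < δ ∧ δ ^ θ * N ≤ c := by
  have h1 : Tendsto (fun δ : ℝ≥0∞ => δ ^ θ * N) (𝓝[>] 0) (𝓝 0) := by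
    have h2 : Tendsto (fun δ : ℝ≥0∞ => δ ^ θ) (𝓝[>] 0) (𝓝 0) := by
      have := (ENNReal.continuous_rpow_const (y := θ)).tendsto 0
      rw [ENNReal.zero_rpow_of_pos hθ] at this
      exact this.mono_left nhdsWithin_le_nhds
    have := ENNReal.Tendsto.mul_const h2 (Or.inr hN)
    rwa [zero_mul] at this
  have h3 := (h1.eventually (gt_mem_nhds hc)).and self_mem_nhdsWithin
  obtain ⟨δ, h4, h5⟩ := h3.exists
  exact ⟨δ, h5, h4.le⟩

/-! ### Flux estimates in terms of increments of the velocity -/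

theorem aemeasurable_incrNorm_ballMeasure {u : T3 → E3} (hu : AEStronglyMeasurable u) (q : ℝ≥0∞)
    (ε : ℝ) : AEMeasurable (fun y => incrNorm q u y) (ballMeasure ε) := by
  have h := aemeasurable_eLpNorm_section
    (aestronglyMeasurable_increment_ballMeasure hu ε).prod_swap q
  refine h.congr (Eventually.of_forall fun y => ?_)
  exact eLpNorm_sub_translate hu q y

theorem eLpNorm_enorm_sq {α F : Type*} [MeasurableSpace α] {μ : Measure α} [NormedAddCommGroup F]
    (f : α → F) {q : ℝ} (hq : 0 < q) :
    eLpNorm (fun x => ‖f x‖ₑ ^ 2) (ENNReal.ofReal (q / 2)) μ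
      = eLpNorm f (ENNReal.ofReal q) μ ^ 2 := by
  rw [eLpNorm_ofReal (by positivity), eLpNorm_ofReal hq, ← ENNReal.rpow_two, ← ENNReal.rpow_mul]
  have : ∀ x, ‖‖f x‖ₑ ^ 2‖ₑ ^ (q / 2) = ‖f x‖ₑ ^ q := fun x => by
    rw [enorm_eq_self, ← ENNReal.rpow_two, ← ENNReal.rpow_mul]
    congr 1; ring
  simp_rw [this]
  congr 1
  field_simp

theorem lintegral_rpow_le_rpow {α : Type*} [MeasurableSpace α] {μ : Measure α}
    [IsProbabilityMeasure μ] {h : α → ℝ≥0∞} (hm : AEMeasurable h μ) {a b : ℝ} (ha : 0 < a)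
    (hab : a ≤ b) : (∫⁻ y, h y ^ a ∂μ) ^ (1 / a) ≤ (∫⁻ y, h y ^ b ∂μ) ^ (1 / b) := by
  have := eLpNorm_le_eLpNorm_of_exponent_le (ENNReal.ofReal_le_ofReal hab)
    hm.aestronglyMeasurable
  rw [eLpNorm_ofReal ha, eLpNorm_ofReal (ha.trans_le hab)] at this
  simpa using this

theorem eLpNorm_sum_enorm_le {g : Fin 3 → T3 → E3} {p : ℝ≥0∞} (hp : 1 ≤ p)
    (hg : ∀ j, Continuous (g j)) {K : ℝ≥0∞} (h : ∀ j, eLpNorm (g j) p volume ≤ K) :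
    eLpNorm (fun x => ∑ j, ‖g j x‖ₑ) p volume ≤ 3 * K := by
  have e : (fun x => ∑ j, ‖g j x‖ₑ) = ∑ j, fun x => ‖g j x‖ₑ := by
    ext x; simp [Finset.sum_apply]
  rw [e]
  refine (eLpNorm_sum_le (fun j _ => (hg j).enorm.aestronglyMeasurable) hp).trans ?_
  simp_rw [eLpNorm_enorm]
  refine (Finset.sum_le_sum fun j _ => h j).trans_eq ?_
  simp

theorem exists_pderiv_mollify_bounds : ∃ C : ℝ≥0∞, C ≠ ⊤ ∧ ∀ ε : ℝ, 0 < ε → ε ≤ 1 / 2 →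
    ∀ w : T3 → E3, Integrable w → ∀ j,
      (∀ x, ‖pderiv j (mollify (eta ε) w) x‖ₑ
        ≤ C * ENNReal.ofReal ε ^ (-3 : ℝ) * eLpNorm w (ENNReal.ofReal (3 / 2)) volume) ∧
      eLpNorm (pderiv j (mollify (eta ε) w)) (ENNReal.ofReal (3 / 2)) volume
        ≤ C * ENNReal.ofReal ε ^ (-1 : ℝ) * eLpNorm w (ENNReal.ofReal (3 / 2)) volume := by
  obtain ⟨c, hc, h⟩ := exists_lintegral_enorm_mul_le_ballMeasure
  obtain ⟨K, hK, hb⟩ := exists_eta_bound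
  have hv0 := (Metric.measure_ball_pos (volume : Measure E3) 0 one_pos).ne'
  set D : ℝ≥0∞ := (volume (Metric.ball (0 : E3) 1))⁻¹ ^ (2 / 3 : ℝ) with hD
  have hDt : D ≠ ⊤ := ENNReal.rpow_ne_top_of_nonneg (by norm_num) (ENNReal.inv_ne_top.2 hv0)
  refine ⟨ENNReal.ofReal (c * K) * (D + 1), by finiteness, fun ε hε hε2 w hw j => ?_⟩
  have hpb := isProbabilityMeasure_ballMeasure hε
  have hk := isTestKernel_eta hε
  have hE0 : ENNReal.ofReal ε ≠ 0 := by simpa using hε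
  have hker := fun g => h hε (k := kderiv j (eta ε)) (K := K * ε⁻¹) (by positivity) (fun y => by
    refine ((hb ε hε).2.1 j y).trans_eq ?_
    field_simp) (support_kderiv_subset Metric.isClosed_closedBall (support_eta hε) j) g
  have hcK : ENNReal.ofReal (c * (K * ε⁻¹))
      = ENNReal.ofReal (c * K) * ENNReal.ofReal ε ^ (-1 : ℝ) := by
    rw [← mul_assoc, ENNReal.ofReal_mul (by positivity), ENNReal.rpow_neg_one,
      ENNReal.ofReal_inv_of_pos hε]
  have e1 : pderiv j (mollify (eta ε) w) = mollify (kderiv j (eta ε)) w :=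
    funext fun x => pderiv_mollify hk hw j x
  rw [e1]
  constructor
  · intro x
    refine (enorm_mollify_le _ _ x).trans ((hker _).trans ?_)
    have hm : AEMeasurable (fun y => ‖w (x - toTorus y)‖ₑ) (ballMeasure ε) :=
      ((hw.1.comp_quasiMeasurePreserving (quasiMeasurePreserving_sub_toTorus x)).mono_ac
        ProbabilityTheory.cond_absolutelyContinuous).enorm
    have h1 := lintegral_rpow_le_rpow hm one_pos (show (1 : ℝ) ≤ 3 / 2 by norm_num)
    have h2 : ∫⁻ y, ‖w (x - toTorus y)‖ₑ ^ (3 / 2 : ℝ) ∂(ballMeasure ε)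
        ≤ (volume (Metric.ball (0 : E3) 1))⁻¹ * ENNReal.ofReal ε ^ (-3 : ℝ)
          * ∫⁻ x, ‖w x‖ₑ ^ (3 / 2 : ℝ) := by
      rw [ballMeasure, ProbabilityTheory.cond, lintegral_smul_measure, smul_eq_mul]
      refine mul_le_mul' (le_of_eq ?_)
        (lintegral_ball_sub_toTorus_le_of_le_half (hw.1.enorm.pow_const _) hε2 x)
      rw [Measure.addHaar_ball volume _ hε.le, finrank_euclideanSpace, Fintype.card_fin,
        ENNReal.mul_inv (Or.inr measure_ball_lt_top.ne) (Or.inl ENNReal.ofReal_ne_top),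
        ENNReal.ofReal_pow hε.le, mul_comm, ENNReal.rpow_neg]
      norm_num
    simp only [ENNReal.rpow_one, div_one] at h1
    have h3 : (∫⁻ y, ‖w (x - toTorus y)‖ₑ ^ (3 / 2 : ℝ) ∂(ballMeasure ε)) ^ (1 / (3 / 2) : ℝ)
        ≤ D * ENNReal.ofReal ε ^ (-2 : ℝ) * eLpNorm w (ENNReal.ofReal (3 / 2)) volume := by
      refine (ENNReal.rpow_le_rpow h2 (by norm_num)).trans_eq ?_
      rw [ENNReal.mul_rpow_of_nonneg _ _ (by norm_num), ENNReal.mul_rpow_of_nonneg _ _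
        (by norm_num), ← ENNReal.rpow_mul, eLpNorm_ofReal (by norm_num), hD]
      norm_num
    calc _ ≤ ENNReal.ofReal (c * (K * ε⁻¹))
          * (D * ENNReal.ofReal ε ^ (-2 : ℝ) * eLpNorm w (ENNReal.ofReal (3 / 2)) volume) := by
          gcongr
          exact h1.trans h3
      _ = ENNReal.ofReal (c * K) * D * (ENNReal.ofReal ε ^ (-1 : ℝ) * ENNReal.ofReal ε ^ (-2 : ℝ))
          * eLpNorm w (ENNReal.ofReal (3 / 2)) volume := by rw [hcK]; ring
      _ ≤ _ := by
          rw [← ENNReal.rpow_add _ _ hE0 ENNReal.ofReal_ne_top]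
          norm_num
          gcongr
          exact le_self_add
  · refine (eLpNorm_mollify_le hw.1 (hk.kderiv j).continuous (by norm_num)).trans ?_
    have h1 := hker fun _ => 1
    simp only [mul_one, lintegral_const, measure_univ] at h1
    gcongr
    refine h1.trans ?_
    rw [hcK]
    gcongr
    calc ENNReal.ofReal (c * K) = ENNReal.ofReal (c * K) * 1 := (mul_one _).symm
      _ ≤ _ := by gcongr; exact le_add_self

theorem exists_enorm_transport_le_velocity {p : ℝ} (hp2 : 2 < p) (hp3 : p ≤ 3) :
    ∃ C : ℝ≥0∞, C ≠ ⊤ ∧ ∀ ε : ℝ, 0 < ε → ε ≤ 1 / 2 → ∀ u w : T3 → E3, MemLp u 2 volume →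
      IsWeakDivFree u → IsWeakCurl u w → ‖transport u (mollifyTwice ε w)‖ₑ
        ≤ C * ENNReal.ofReal ε ^ (-((p + 1) / 2))
          * eLpNorm w (ENNReal.ofReal (3 / 2)) volume ^ (3 - p)
          * (∫⁻ y, incrNorm (ENNReal.ofReal (2 * p / (p - 1))) u y ^ 2
            ∂(ballMeasure ε)) ^ (p / 2) := by
  set q : ℝ := 2 * p / (p - 1) with hq
  have hp1 : 0 < p - 1 := by linarith
  have hq2 : 2 ≤ q := by rw [hq, le_div_iff₀ hp1]; linarith
  obtain ⟨C₁, hC₁, h₁⟩ := exists_enorm_transport_le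
  obtain ⟨C₂, hC₂, h₂⟩ := exists_enorm_pderiv_mollify_curl_le
  obtain ⟨C₃, hC₃, h₃⟩ := exists_pderiv_mollify_bounds
  refine ⟨C₁ * ((3 * ENNReal.ofReal C₂) ^ (p - 2) * (3 * C₃) ^ ((3 - p) / 4)
    * (3 * C₃) ^ (3 * (3 - p) / 4)), ?_, fun ε hε hε2 u w hu hd hc => ?_⟩
  · have t1 : (3 * ENNReal.ofReal C₂) ^ (p - 2) ≠ ⊤ :=
      ENNReal.rpow_ne_top_of_nonneg (by linarith) (by finiteness)
    have t2 : (3 * C₃) ^ ((3 - p) / 4) ≠ ⊤ :=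
      ENNReal.rpow_ne_top_of_nonneg (by linarith) (by finiteness)
    have t3 : (3 * C₃) ^ (3 * (3 - p) / 4) ≠ ⊤ :=
      ENNReal.rpow_ne_top_of_nonneg (by linarith) (by finiteness)
    finiteness
  have hpb := isProbabilityMeasure_ballMeasure hε
  set β := ballMeasure ε
  have hum := hu.1
  have hE0 : ENNReal.ofReal ε ≠ 0 := by simpa using hε
  have hEt : ENNReal.ofReal ε ≠ ⊤ := ENNReal.ofReal_ne_top
  set E := ENNReal.ofReal ε
  set N := eLpNorm w (ENNReal.ofReal (3 / 2)) volume
  set e := ∫⁻ y, incrNorm (ENNReal.ofReal q) u y ^ 2 ∂β with he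
  have hW := smoothOnTorus_mollify_eta hε hc.2.1
  have hWc : ∀ j, Continuous (pderiv j (mollify (eta ε) w)) := fun j => (hW.pderiv j).continuous
  set A : T3 → ℝ≥0∞ := fun x => ∫⁻ y, ‖u x - u (x - toTorus y)‖ₑ ^ 2 ∂β
  set g : T3 → ℝ≥0∞ := fun x => ∑ j, ‖pderiv j (mollify (eta ε) w) x‖ₑ
  have hincr := aestronglyMeasurable_increment_ballMeasure hum ε
  have hAm : AEMeasurable A := (hincr.enorm.pow_const 2).lintegral_prod_right'
  have hgm : Measurable g := Finset.measurable_fun_sum _ fun j _ => (hWc j).enorm.measurable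
  have hA : eLpNorm A (ENNReal.ofReal (q / 2)) volume ≤ e := by
    refine (eLpNorm_lintegral_le (g := fun x y => ‖u x - u (x - toTorus y)‖ₑ ^ 2)
      (hincr.enorm.pow_const 2) (by linarith)).trans_eq ?_
    rw [he]
    refine lintegral_congr fun y => ?_
    rw [eLpNorm_enorm_sq (fun x => u x - u (x - toTorus y)) (by linarith),
      eLpNorm_sub_translate hum]
  have hjen : ∫⁻ y, incrNorm (ENNReal.ofReal q) u y ∂β ≤ e ^ (1 / 2 : ℝ) := by
    have := lintegral_rpow_le_rpow (aemeasurable_incrNorm_ballMeasure hum (ENNReal.ofReal q) ε)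
      one_pos (show (1 : ℝ) ≤ 2 by norm_num)
    simpa using this
  have hg1 : eLpNorm g (ENNReal.ofReal q) volume
      ≤ 3 * ENNReal.ofReal C₂ * E ^ (-2 : ℝ) * e ^ (1 / 2 : ℝ) := by
    refine (eLpNorm_sum_enorm_le (one_le_ofReal (by linarith)) hWc
      (K := ENNReal.ofReal C₂ * E ^ (-2 : ℝ) * e ^ (1 / 2 : ℝ)) fun j => ?_).trans_eq (by ring)
    have e1 : ENNReal.ofReal (C₂ * (ε ^ 2)⁻¹) = ENNReal.ofReal C₂ * E ^ (-2 : ℝ) := by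
      rw [ENNReal.ofReal_mul hC₂.le, ENNReal.ofReal_inv_of_pos (by positivity),
        ENNReal.ofReal_pow hε.le, ENNReal.rpow_neg]
      norm_num
      rfl
    have hCt : ENNReal.ofReal (C₂ * (ε ^ 2)⁻¹) ≠ ⊤ := ENNReal.ofReal_ne_top
    calc eLpNorm (pderiv j (mollify (eta ε) w)) (ENNReal.ofReal q) volume
        ≤ eLpNorm (fun x => ∫⁻ y, ENNReal.ofReal (C₂ * (ε ^ 2)⁻¹)
            * ‖u x - u (x - toTorus y)‖ₑ ∂β) (ENNReal.ofReal q) volume := by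
          refine eLpNorm_mono_enorm fun x => ?_
          rw [lintegral_const_mul' _ _ hCt, enorm_eq_self]
          exact h₂ ε hε u w hc j x
      _ ≤ ∫⁻ y, eLpNorm (fun x => ENNReal.ofReal (C₂ * (ε ^ 2)⁻¹)
            * ‖u x - u (x - toTorus y)‖ₑ) (ENNReal.ofReal q) volume ∂β :=
          eLpNorm_lintegral_le (hincr.enorm.const_mul _) (by linarith)
      _ = ∫⁻ y, ENNReal.ofReal (C₂ * (ε ^ 2)⁻¹) * incrNorm (ENNReal.ofReal q) u y ∂β := by
          refine lintegral_congr fun y => ?_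
          have := eLpNorm_const_smul (C₂ * (ε ^ 2)⁻¹) (fun x => u x - u (x - toTorus y))
            (ENNReal.ofReal q) volume
          rw [Real.enorm_of_nonneg (by positivity), eLpNorm_sub_translate hum] at this
          rw [← this, ← eLpNorm_enorm ((C₂ * (ε ^ 2)⁻¹) • _)]
          congr 1
          ext1 x
          rw [Pi.smul_apply, enorm_smul, Real.enorm_of_nonneg (by positivity)]
      _ ≤ _ := by
          rw [lintegral_const_mul' _ _ hCt, e1]
          gcongr
  have hg2 : eLpNorm g ⊤ volume ≤ 3 * C₃ * E ^ (-3 : ℝ) * N := by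
    refine (eLpNorm_sum_enorm_le (by simp) hWc
      (K := C₃ * E ^ (-3 : ℝ) * N) fun j => ?_).trans_eq (by ring)
    rw [eLpNorm_exponent_top]
    exact essSup_le_of_ae_le _ (Eventually.of_forall fun x => (h₃ ε hε hε2 w hc.2.1 j).1 x)
  have hg3 : eLpNorm g (ENNReal.ofReal (3 / 2)) volume ≤ 3 * C₃ * E ^ (-1 : ℝ) * N :=
    (eLpNorm_sum_enorm_le (one_le_ofReal (by norm_num)) hWc
      (K := C₃ * E ^ (-1 : ℝ) * N) fun j => (h₃ ε hε hε2 w hc.2.1 j).2).trans_eq (by ring)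
  have hol : ∫⁻ x, A x * g x ≤ eLpNorm A (ENNReal.ofReal (q / 2)) volume
      * eLpNorm g (ENNReal.ofReal q) volume ^ (p - 2) * eLpNorm g ⊤ volume ^ ((3 - p) / 4)
      * eLpNorm g (ENNReal.ofReal (3 / 2)) volume ^ (3 * (3 - p) / 4) := by
    have h := lintegral_prod_rpow_le_prod_eLpNorm (μ := (volume : Measure T3)) Finset.univ
      (f := fun i : Fin 4 => ![A, g, g, g] i)
      (w := ![1, p - 2, (3 - p) / 4, 3 * (3 - p) / 4])
      (p := ![ENNReal.ofReal (q / 2), ENNReal.ofReal q, ⊤, ENNReal.ofReal (3 / 2)])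
      (by
        intro i _; fin_cases i
        exacts [hAm, hgm.aemeasurable, hgm.aemeasurable, hgm.aemeasurable])
      (by intro i _; fin_cases i <;> simp <;> linarith)
      (by intro i _; fin_cases i <;> simp <;> linarith)
      (by
        rw [Fin.sum_univ_four]
        simp only [Matrix.cons_val_zero, Matrix.cons_val_one, Matrix.cons_val, ENNReal.div_top,
          add_zero]
        rw [← ENNReal.ofReal_div_of_pos (by linarith), ← ENNReal.ofReal_div_of_pos (by linarith),
          ← ENNReal.ofReal_div_of_pos (by norm_num),
          ← ENNReal.ofReal_add (by positivity) (div_nonneg (by linarith) (by linarith)),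
          ← ENNReal.ofReal_add (add_nonneg (by positivity) (div_nonneg (by linarith)
            (by linarith))) (by linarith), ← ENNReal.ofReal_one]
        congr 1
        rw [hq]
        have : p ≠ 0 := by linarith
        field_simp
        ring)
    simp only [Fin.prod_univ_four, Matrix.cons_val_zero, Matrix.cons_val_one, Matrix.cons_val,
      ENNReal.rpow_one] at h
    refine le_trans (lintegral_mono fun x => ?_) h
    rw [mul_assoc, mul_assoc, ← ENNReal.rpow_add_of_nonneg _ _ (by linarith) (by linarith),
      ← ENNReal.rpow_add_of_nonneg _ _ (by linarith) (by linarith)]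
    ring_nf
    simp
  have n1 : 0 ≤ p - 2 := by linarith
  have n2 : 0 ≤ (3 - p) / 4 := by linarith
  have n3 : 0 ≤ 3 * (3 - p) / 4 := by linarith
  calc ‖transport u (mollifyTwice ε w)‖ₑ ≤ C₁ * ∫⁻ x, A x * g x := h₁ ε hε u w hu hd hc
    _ ≤ C₁ * (e * (3 * ENNReal.ofReal C₂ * E ^ (-2 : ℝ) * e ^ (1 / 2 : ℝ)) ^ (p - 2)
        * (3 * C₃ * E ^ (-3 : ℝ) * N) ^ ((3 - p) / 4)
        * (3 * C₃ * E ^ (-1 : ℝ) * N) ^ (3 * (3 - p) / 4)) := by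
        gcongr
        exact hol.trans (by gcongr)
    _ = C₁ * ((3 * ENNReal.ofReal C₂) ^ (p - 2) * (3 * C₃) ^ ((3 - p) / 4)
          * (3 * C₃) ^ (3 * (3 - p) / 4))
        * (E ^ (-2 * (p - 2)) * E ^ (-3 * ((3 - p) / 4)) * E ^ (-1 * (3 * (3 - p) / 4)))
        * (N ^ ((3 - p) / 4) * N ^ (3 * (3 - p) / 4))
        * (e ^ (1 : ℝ) * e ^ (1 / 2 * (p - 2))) := by
        rw [ENNReal.mul_rpow_of_nonneg _ _ n1, ENNReal.mul_rpow_of_nonneg _ _ n1,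
          ENNReal.mul_rpow_of_nonneg _ _ n2, ENNReal.mul_rpow_of_nonneg _ _ n2,
          ENNReal.mul_rpow_of_nonneg _ _ n3, ENNReal.mul_rpow_of_nonneg _ _ n3,
          ENNReal.rpow_mul, ENNReal.rpow_mul, ENNReal.rpow_mul, ENNReal.rpow_mul,
          ENNReal.rpow_one]
        ring
    _ = _ := by
        rw [← ENNReal.rpow_add _ _ hE0 hEt, ← ENNReal.rpow_add _ _ hE0 hEt,
          ← ENNReal.rpow_add_of_nonneg _ _ n2 n3,
          ← ENNReal.rpow_add_of_nonneg _ _ (by norm_num) (by linarith)]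
        have x1 : -2 * (p - 2) + -3 * ((3 - p) / 4) + -1 * (3 * (3 - p) / 4) = -((p + 1) / 2) := by
          ring
        have x2 : (3 - p) / 4 + 3 * (3 - p) / 4 = 3 - p := by ring
        have x3 : 1 + 1 / 2 * (p - 2) = p / 2 := by ring
        rw [x1, x2, x3]

theorem tendsto_flux_of_velocity {T : ℝ} (hT : 0 < T) {v ω : ℝ → T3 → E3} {P : ℝ → T3 → ℝ}
    (hv : IsWeakEulerSolution T v P) (hcurl : ∀ t ∈ Icc 0 T, IsWeakCurl (v t) (ω t))
    (hω : ContinuousInLq T (3 / 2) ω) {p : ℝ} (hp2 : 2 < p) (hp3 : p ≤ 3)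
    (h : ∀ δ : ℝ≥0∞, 0 < δ → ∀ᶠ ε : ℝ in 𝓝[>] 0, ∫⁻ t in Ioo 0 T,
      (∫⁻ y, incrNorm (ENNReal.ofReal (2 * p / (p - 1))) (v t) y ^ 2 ∂(ballMeasure ε)) ^ (p / 2)
        ≤ (δ * ENNReal.ofReal (ε ^ (2 / p))) ^ p) :
    Tendsto (fun ε => ∫⁻ t in Ioo 0 T, ‖flux ε v ω t‖ₑ) (𝓝[>] 0) (𝓝 0) := by
  obtain ⟨C, hC, hb⟩ := exists_enorm_transport_le_velocity hp2 hp3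
  obtain ⟨M, hM, hMb⟩ := hω.exists_bound (by
    rw [← ofReal_three_halves]; exact one_le_ofReal (by norm_num))
  have hMt : M ^ (3 - p) ≠ ⊤ := ENNReal.rpow_ne_top_of_nonneg (by linarith) hM
  have hp0 : 0 < p := by linarith
  rw [ENNReal.tendsto_nhds_zero]
  intro c hc
  obtain ⟨δ, hδ0, hδ⟩ := exists_pos_rpow_mul_le hp0 (N := C * M ^ (3 - p)) (by finiteness) hc
  filter_upwards [h δ hδ0, Ioc_mem_nhdsGT (show (0 : ℝ) < 1 / 2 by norm_num)] with ε h1 hε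
  have hE0 : ENNReal.ofReal ε ≠ 0 := by simpa using hε.1
  have hEt : ENNReal.ofReal ε ^ (-((p + 1) / 2)) ≠ ⊤ :=
    ENNReal.rpow_ne_top_of_ne_zero hE0 ENNReal.ofReal_ne_top
  calc ∫⁻ t in Ioo 0 T, ‖flux ε v ω t‖ₑ
      ≤ ∫⁻ t in Ioo 0 T, C * ENNReal.ofReal ε ^ (-((p + 1) / 2)) * M ^ (3 - p)
          * (∫⁻ y, incrNorm (ENNReal.ofReal (2 * p / (p - 1))) (v t) y ^ 2
            ∂(ballMeasure ε)) ^ (p / 2) := by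
        refine setLIntegral_mono' measurableSet_Ioo fun t ht => ?_
        have ht' := Ioo_subset_Icc_self ht
        refine (hb ε hε.1 hε.2 _ _ (hv.memLp_two t ht') (hv.isWeakDivFree hT t ht')
          (hcurl t ht')).trans ?_
        gcongr
        rw [ofReal_three_halves]
        exact hMb t ht'
    _ ≤ C * ENNReal.ofReal ε ^ (-((p + 1) / 2)) * M ^ (3 - p)
          * (δ * ENNReal.ofReal (ε ^ (2 / p))) ^ p := by
        rw [lintegral_const_mul' _ _ (by finiteness)]
        gcongr
    _ = δ ^ p * (C * M ^ (3 - p)) * ENNReal.ofReal ε ^ ((3 - p) / 2) := by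
        rw [ENNReal.mul_rpow_of_nonneg _ _ hp0.le, ← ENNReal.ofReal_rpow_of_pos hε.1,
          ← ENNReal.rpow_mul, div_mul_cancel₀ _ hp0.ne']
        have : ENNReal.ofReal ε ^ ((3 - p) / 2)
            = ENNReal.ofReal ε ^ (-((p + 1) / 2)) * ENNReal.ofReal ε ^ (2 : ℝ) := by
          rw [← ENNReal.rpow_add _ _ hE0 ENNReal.ofReal_ne_top]
          congr 1; ring
        rw [this]
        ring
    _ ≤ c * 1 := by
        gcongr
        refine ENNReal.rpow_le_one ?_ (by linarith)
        rw [← ENNReal.ofReal_one]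
        exact ENNReal.ofReal_le_ofReal (by linarith [hε.2])
    _ = c := mul_one c

theorem eventually_velocity_of_besovC {T : ℝ} {v : ℝ → T3 → E3} {p q : ℝ} (hp2 : 2 < p)
    (h : MemLpBesovC T (ENNReal.ofReal p) (2 / p) (ENNReal.ofReal q) v) {δ : ℝ≥0∞} (hδ : 0 < δ) :
    ∀ᶠ ε : ℝ in 𝓝[>] 0, ∫⁻ t in Ioo 0 T,
      (∫⁻ y, incrNorm (ENNReal.ofReal q) (v t) y ^ 2 ∂(ballMeasure ε)) ^ (p / 2)
        ≤ (δ * ENNReal.ofReal (ε ^ (2 / p))) ^ p := by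
  have hp0 : 0 < p := by linarith
  filter_upwards [h.eventually_le (by positivity) hδ, self_mem_nhdsWithin] with ε h1 hε
  have hpb := isProbabilityMeasure_ballMeasure hε
  set τ := (volume : Measure ℝ).restrict (Ioo 0 T)
  have hm := aemeasurable_incrNorm_prod h.1.1 (ballMeasure ε) (ENNReal.ofReal q)
  calc ∫⁻ t, (∫⁻ y, incrNorm (ENNReal.ofReal q) (v t) y ^ 2 ∂(ballMeasure ε)) ^ (p / 2) ∂τ
      ≤ ∫⁻ t, ∫⁻ y, incrNorm (ENNReal.ofReal q) (v t) y ^ p ∂(ballMeasure ε) ∂τ := by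
        refine lintegral_mono_ae ?_
        filter_upwards [ae_aestronglyMeasurable_section h.1.1] with t ht
        have h2 := lintegral_rpow_le_rpow
          (aemeasurable_incrNorm_ballMeasure ht (ENNReal.ofReal q) ε) two_pos hp2.le
        have h3 := ENNReal.rpow_le_rpow h2 hp0.le
        rw [← ENNReal.rpow_mul, ← ENNReal.rpow_mul, one_div_mul_cancel hp0.ne', ENNReal.rpow_one,
          one_div_mul_eq_div] at h3
        simpa using h3
    _ = ∫⁻ y, ∫⁻ t, incrNorm (ENNReal.ofReal q) (v t) y ^ p ∂τ ∂(ballMeasure ε) :=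
        lintegral_lintegral_swap (hm.pow_const p)
    _ ≤ ∫⁻ _y, (δ * ENNReal.ofReal (ε ^ (2 / p))) ^ p ∂(ballMeasure ε) := by
        refine lintegral_mono_ae ?_
        filter_upwards [ae_ballMeasure_mem ε] with y hy
        have h2 := ENNReal.rpow_le_rpow (h1 y hy) hp0.le
        rw [timeNorm, eLpNorm_ofReal hp0, ← ENNReal.rpow_mul, one_div_mul_cancel hp0.ne',
          ENNReal.rpow_one] at h2
        simpa using h2
    _ = _ := by simp

theorem lintegral_incrNorm_sq_le_avgIncr {u : T3 → E3} (hu : AEStronglyMeasurable u) {q ε : ℝ}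
    (hε : 0 < ε) (hq : 2 ≤ q) :
    (∫⁻ y, incrNorm (ENNReal.ofReal q) u y ^ 2 ∂(ballMeasure ε)) ^ (1 / 2 : ℝ)
      ≤ avgIncr q ε u := by
  have hpb := isProbabilityMeasure_ballMeasure hε
  have h2 := lintegral_rpow_le_rpow
    (aemeasurable_incrNorm_ballMeasure hu (ENNReal.ofReal q) ε) two_pos hq
  have hq0 : 0 < q := by linarith
  simp only [ENNReal.rpow_two] at h2
  refine h2.trans_eq ?_
  rw [avgIncr]
  congr 1
  simp_rw [setLAverage_eq']
  change _ = ∫⁻ x, ∫⁻ y, ‖u x - u (x - toTorus y)‖ₑ ^ q ∂(ballMeasure ε)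
  rw [lintegral_lintegral_swap
    ((aestronglyMeasurable_increment_ballMeasure hu ε).enorm.pow_const q)]
  refine lintegral_congr fun y => ?_
  rw [← eLpNorm_sub_translate hu, eLpNorm_ofReal hq0, ← ENNReal.rpow_mul,
    one_div_mul_cancel hq0.ne', ENNReal.rpow_one]

theorem eventually_velocity_of_besovVMO {T : ℝ} {v : ℝ → T3 → E3} {p q : ℝ} (hp2 : 2 < p)
    (hq : 2 ≤ q) (h : MemLpBesovVMO T p (2 / p) q v) {δ : ℝ≥0∞} (hδ : 0 < δ) :
    ∀ᶠ ε : ℝ in 𝓝[>] 0, ∫⁻ t in Ioo 0 T,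
      (∫⁻ y, incrNorm (ENNReal.ofReal q) (v t) y ^ 2 ∂(ballMeasure ε)) ^ (p / 2)
        ≤ (δ * ENNReal.ofReal (ε ^ (2 / p))) ^ p := by
  have hp0 : 0 < p := by linarith
  filter_upwards [h.2.eventually (gt_mem_nhds hδ), self_mem_nhdsWithin] with ε h1 hε
  have hε' : ENNReal.ofReal (ε ^ (2 / p)) ≠ 0 := by
    simp only [ne_eq, ENNReal.ofReal_eq_zero, not_le]
    exact Real.rpow_pos_of_pos hε _
  have h2 := h1.le
  rw [ENNReal.div_le_iff hε' ENNReal.ofReal_ne_top] at h2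
  have h3 := ENNReal.rpow_le_rpow h2 hp0.le
  rw [timeNorm, eLpNorm_ofReal hp0, ← ENNReal.rpow_mul, one_div_mul_cancel hp0.ne',
    ENNReal.rpow_one] at h3
  refine le_trans (lintegral_mono_ae ?_) h3
  filter_upwards [ae_aestronglyMeasurable_section h.1.1] with t ht
  have h4 := ENNReal.rpow_le_rpow (lintegral_incrNorm_sq_le_avgIncr ht hε hq) hp0.le
  rw [← ENNReal.rpow_mul, one_div_mul_eq_div] at h4
  rwa [enorm_eq_self]

/-! ### The flux as a triple product, and velocities with integrable gradient -/

theorem lintegral_enorm_mul_le_three {f g : T3 → E3} (hf : AEStronglyMeasurable f)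
    (hg : AEStronglyMeasurable g) : ∫⁻ x, ‖f x‖ₑ * ‖g x‖ₑ
      ≤ eLpNorm f (ENNReal.ofReal 3) volume * eLpNorm g (ENNReal.ofReal (3 / 2)) volume := by
  have h := ENNReal.lintegral_mul_le_Lp_mul_Lq (volume : Measure T3)
    (p := 3) (q := 3 / 2) (by constructor <;> norm_num) hf.enorm hg.enorm
  rw [eLpNorm_ofReal (by norm_num), eLpNorm_ofReal (by norm_num)]
  exact h

theorem integrable_coord_mul_coord {f g : T3 → E3} (hf : MemLp f (ENNReal.ofReal 3) volume)
    (hg : MemLp g (ENNReal.ofReal (3 / 2)) volume) (i j : Fin 3) {G : T3 → ℝ}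
    (hG : Continuous G) : Integrable fun x => f x i * g x j * G x := by
  refine integrable_mul_continuous ⟨(MemLp.coord hf i).1.mul (MemLp.coord hg j).1, ?_⟩ hG
  refine lt_of_le_of_lt (lintegral_mono fun x => ?_)
    ((lintegral_enorm_mul_le_three hf.1 hg.1).trans_lt (ENNReal.mul_lt_top hf.2 hg.2))
  rw [enorm_mul]
  exact mul_le_mul' (enorm_coord_le _ _) (enorm_coord_le _ _)

theorem tendsto_integral_mollify_mul_mollify {f g : T3 → E3}
    (hf : MemLp f (ENNReal.ofReal 3) volume) (hg : MemLp g (ENNReal.ofReal (3 / 2)) volume)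
    (i j : Fin 3) {G : T3 → ℝ} (hG : Continuous G) :
    Tendsto (fun ε => ∫ x, mollify (eta ε) f x i * mollify (eta ε) g x j * G x) (𝓝[>] 0)
      (𝓝 (∫ x, f x i * g x j * G x)) := by
  obtain ⟨K, hK⟩ := isCompact_univ.exists_bound_of_continuousOn hG.continuousOn
  have hfi : Integrable f := hf.integrable (one_le_ofReal (by norm_num))
  have hgi : Integrable g := hg.integrable (one_le_ofReal (by norm_num))
  rw [tendsto_iff_edist_tendsto_0]
  have h1 := ENNReal.Tendsto.const_mul (a := eLpNorm f (ENNReal.ofReal 3) volume)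
    (tendsto_eLpNorm_mollify_eta_sub (by norm_num) hg) (Or.inr hf.2.ne)
  have h2 := ENNReal.Tendsto.mul_const (b := eLpNorm g (ENNReal.ofReal (3 / 2)) volume)
    (tendsto_eLpNorm_mollify_eta_sub (by norm_num) hf) (Or.inr hg.2.ne)
  have h3 := ENNReal.Tendsto.mul_const (b := ENNReal.ofReal K) (h1.add h2)
    (Or.inr ENNReal.ofReal_ne_top)
  rw [mul_zero, zero_mul, add_zero, zero_mul] at h3
  refine tendsto_of_tendsto_of_tendsto_of_le_of_le' tendsto_const_nhds h3
    (Eventually.of_forall fun _ => zero_le) ?_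
  filter_upwards [self_mem_nhdsWithin] with ε hε
  have hF := smoothOnTorus_mollify_eta hε hfi
  have hH := smoothOnTorus_mollify_eta hε hgi
  rw [edist_eq_enorm_sub, ← integral_sub
    (integrable_mul_continuous ((hF.coord i).mul (hH.coord j)).integrable hG)
    (integrable_coord_mul_coord hf hg i j hG)]
  set F := mollify (eta ε) f
  set H := mollify (eta ε) g
  have hFm := hF.integrable.1
  have hdm : AEStronglyMeasurable fun x => H x - g x := hH.integrable.1.sub hg.1
  calc _ ≤ ∫⁻ x, ‖F x i * H x j * G x - f x i * g x j * G x‖ₑ := enorm_integral_le_lintegral_enorm _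
    _ ≤ ∫⁻ x, (‖F x‖ₑ * ‖H x - g x‖ₑ + ‖F x - f x‖ₑ * ‖g x‖ₑ) * ENNReal.ofReal K := by
        refine lintegral_mono fun x => ?_
        have e : F x i * H x j * G x - f x i * g x j * G x
            = (F x i * (H x - g x) j + (F x - f x) i * g x j) * G x := by
          simp only [PiLp.sub_apply]; ring
        rw [e, enorm_mul]
        refine mul_le_mul' ((enorm_add_le _ _).trans ?_) ?_
        · rw [enorm_mul, enorm_mul]
          exact add_le_add (mul_le_mul' (enorm_coord_le _ _) (enorm_coord_le _ _))
            (mul_le_mul' (enorm_coord_le _ _) (enorm_coord_le _ _))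
        · rw [← ofReal_norm]
          exact ENNReal.ofReal_le_ofReal (hK x (mem_univ x))
    _ = ((∫⁻ x, ‖F x‖ₑ * ‖H x - g x‖ₑ) + ∫⁻ x, ‖F x - f x‖ₑ * ‖g x‖ₑ) * ENNReal.ofReal K := by
        rw [lintegral_mul_const' _ _ ENNReal.ofReal_ne_top,
          lintegral_add_left' (f := fun x => ‖F x‖ₑ * ‖H x - g x‖ₑ) (hFm.enorm.mul hdm.enorm)]
    _ ≤ _ := by
        gcongr
        · refine (lintegral_enorm_mul_le_three hFm hdm).trans ?_
          gcongr
          exact eLpNorm_mollify_eta_le hf.1 hε (by norm_num)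
        · exact lintegral_enorm_mul_le_three (hFm.sub hf.1) hg.1

theorem tendsto_integral_sum_mollify_mul_mollify {f g : T3 → E3}
    (hf : MemLp f (ENNReal.ofReal 3) volume) (hg : MemLp g (ENNReal.ofReal (3 / 2)) volume)
    {G : Fin 3 → Fin 3 → T3 → ℝ} (hG : ∀ i j, Continuous (G i j)) :
    Tendsto (fun ε => ∫ x, ∑ i, ∑ j, mollify (eta ε) f x i * mollify (eta ε) g x j * G i j x)
      (𝓝[>] 0) (𝓝 (∫ x, ∑ i, ∑ j, f x i * g x j * G i j x)) := by
  have hsum : ∀ (F : Fin 3 → Fin 3 → T3 → ℝ), (∀ i j, Integrable (F i j)) →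
      ∫ x, ∑ i, ∑ j, F i j x = ∑ i, ∑ j, ∫ x, F i j x := fun F hF => by
    rw [integral_finsetSum _ fun i _ => integrable_finsetSum _ fun j _ => hF i j]
    exact Finset.sum_congr rfl fun i _ => integral_finsetSum _ fun j _ => hF i j
  rw [hsum _ fun i j => integrable_coord_mul_coord hf hg i j (hG i j)]
  refine (tendsto_finsetSum _ fun i _ => tendsto_finsetSum _ fun j _ =>
    tendsto_integral_mollify_mul_mollify hf hg i j (hG i j)).congr' ?_
  filter_upwards [self_mem_nhdsWithin] with ε hε
  have hF := smoothOnTorus_mollify_eta hε (hf.integrable (one_le_ofReal (by norm_num)))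
  have hH := smoothOnTorus_mollify_eta hε (hg.integrable (one_le_ofReal (by norm_num)))
  exact (hsum _ fun i j =>
    integrable_mul_continuous ((hF.coord i).mul (hH.coord j)).integrable (hG i j)).symm

theorem transport_eq_integral_tripleProduct_of_weak {u w φ : T3 → E3}
    (hu : MemLp u (ENNReal.ofReal 3) volume) (hw : MemLp w (ENNReal.ofReal (3 / 2)) volume)
    (hd : IsWeakDivFree u) (hc : IsWeakCurl u w) (hφ : SmoothOnTorus φ)
    (hdφ : ∀ x, divergence φ x = 0) :
    transport u φ = ∫ x, tripleProduct (u x) (w x) (φ x) := by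
  set G : Fin 3 → Fin 3 → T3 → ℝ := fun i j x =>
    (!![0, φ x 2, -φ x 1; -φ x 2, 0, φ x 0; φ x 1, -φ x 0, 0] : Matrix (Fin 3) (Fin 3) ℝ) i j
  have hG : ∀ i j, Continuous (G i j) := by
    have h := fun i => (hφ.coord i).continuous
    intro i j
    fin_cases i <;> fin_cases j
    exacts [continuous_const, h 2, (h 1).neg, (h 2).neg, continuous_const, h 0, h 1, (h 0).neg,
      continuous_const]
  have e : ∀ a b : T3 → E3, (∫ x, tripleProduct (a x) (b x) (φ x))
      = ∫ x, ∑ i, ∑ j, a x i * b x j * G i j x := by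
    intro a b
    congr 1; ext x
    simp [G, Fin.sum_univ_three, tripleProduct]
    ring
  have h32 : MemLp u (ENNReal.ofReal (3 / 2)) volume :=
    hu.mono_exponent (ENNReal.ofReal_le_ofReal (by norm_num))
  have h1 := tendsto_integral_sum_mollify_mul_mollify hu h32
    (G := fun i j => pderiv j (fun y => φ y i)) fun i j => ((hφ.coord i).pderiv j).continuous
  have h2 := tendsto_integral_sum_mollify_mul_mollify hu hw hG
  rw [e]
  refine tendsto_nhds_unique h1 (h2.congr' ?_)
  filter_upwards [self_mem_nhdsWithin] with ε hε
  have hk := isTestKernel_eta hε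
  have h := transport_eq_integral_tripleProduct (smoothOnTorus_mollify_eta hε hc.1) hφ
    (hd.divergence_mollify hc.1 hk) hdφ
  rw [hc.curl_mollify hk, e] at h
  exact h.symm

theorem enorm_tripleProduct_le (a b c : E3) :
    ‖tripleProduct a b c‖ₑ ≤ 6 * (‖a‖ₑ * ‖b‖ₑ * ‖c‖ₑ) := by
  have h : |tripleProduct a b c| ≤ 6 * (‖a‖ * ‖b‖ * ‖c‖) := by
    have hh : ∀ i j k, |a i * b j * c k| ≤ ‖a‖ * ‖b‖ * ‖c‖ := fun i j k => by
      rw [abs_mul, abs_mul]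
      gcongr <;> exact abs_coord_le_norm _ _
    have h1 := abs_le.1 (hh 1 2 0)
    have h2 := abs_le.1 (hh 2 1 0)
    have h3 := abs_le.1 (hh 2 0 1)
    have h4 := abs_le.1 (hh 0 2 1)
    have h5 := abs_le.1 (hh 0 1 2)
    have h6 := abs_le.1 (hh 1 0 2)
    rw [tripleProduct, abs_le]
    constructor <;> linarith
  have := ENNReal.ofReal_le_ofReal h
  rwa [← Real.norm_eq_abs, ofReal_norm, ENNReal.ofReal_mul (by norm_num),
    ENNReal.ofReal_mul (by positivity), ENNReal.ofReal_mul (by positivity), ofReal_norm, ofReal_norm,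
    ofReal_norm, show ENNReal.ofReal 6 = 6 by norm_num] at this

theorem enorm_transport_mollifyTwice_le {u w : T3 → E3} (hu : MemLp u (ENNReal.ofReal 3) volume)
    (hw : MemLp w (ENNReal.ofReal (3 / 2)) volume) (hd : IsWeakDivFree u) (hc : IsWeakCurl u w)
    {r s : ℝ} (hr : 0 < r) (hs : 0 < s) (hrs : s⁻¹ + r⁻¹ + r⁻¹ = 1) {ε : ℝ} (hε : 0 < ε) :
    ‖transport u (mollifyTwice ε w)‖ₑ ≤ 6 * (eLpNorm u (ENNReal.ofReal s) volume
      * eLpNorm w (ENNReal.ofReal r) volume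
      * eLpNorm (fun x => mollifyTwice ε w x - w x) (ENNReal.ofReal r) volume) := by
  have hS := smoothOnTorus_mollifyTwice hε hc.2.1
  rw [transport_eq_integral_tripleProduct_of_weak hu hw hd hc hS (hc.divergence_mollifyTwice hε)]
  have h := lintegral_prod_rpow_le_prod_eLpNorm (μ := (volume : Measure T3)) Finset.univ
    (f := fun i : Fin 3 => ![fun x => ‖u x‖ₑ, fun x => ‖w x‖ₑ,
      fun x => ‖mollifyTwice ε w x - w x‖ₑ] i) (w := fun _ => 1)
    (p := ![ENNReal.ofReal s, ENNReal.ofReal r, ENNReal.ofReal r])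
    (by intro i _; fin_cases i; exacts [hu.1.enorm, hw.1.enorm, (hS.integrable.1.sub hw.1).enorm])
    (by simp) (by intro i _; fin_cases i <;> simpa)
    (by
      simp only [ENNReal.ofReal_one, Fin.sum_univ_three, Matrix.cons_val_zero, Matrix.cons_val_one,
        Matrix.cons_val, one_div]
      rw [← ENNReal.ofReal_inv_of_pos hs, ← ENNReal.ofReal_inv_of_pos hr,
        ← ENNReal.ofReal_add (by positivity) (by positivity),
        ← ENNReal.ofReal_add (by positivity) (by positivity), hrs, ENNReal.ofReal_one])
  simp only [ENNReal.rpow_one, Fin.prod_univ_three, Matrix.cons_val_zero, Matrix.cons_val_one,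
    Matrix.cons_val, eLpNorm_enorm] at h
  calc _ ≤ ∫⁻ x, ‖tripleProduct (u x) (w x) (mollifyTwice ε w x)‖ₑ :=
        enorm_integral_le_lintegral_enorm _
    _ ≤ ∫⁻ x, 6 * (‖u x‖ₑ * ‖w x‖ₑ * ‖mollifyTwice ε w x - w x‖ₑ) := by
        refine lintegral_mono fun x => ?_
        have e : tripleProduct (u x) (w x) (mollifyTwice ε w x)
            = tripleProduct (u x) (w x) (mollifyTwice ε w x - w x) := by
          simp only [tripleProduct, PiLp.sub_apply]; ring
        rw [e]
        exact enorm_tripleProduct_le _ _ _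
    _ ≤ _ := by
        rw [lintegral_const_mul' _ _ (by norm_num)]
        gcongr

theorem enorm_curl_le {φ : T3 → E3} (hφ : SmoothOnTorus φ) (x : T3) :
    ‖curl φ x‖ₑ ≤ 2 * ∑ j, ‖pderiv j φ x‖ₑ := by
  have h : ‖curl φ x‖ ≤ 2 * ∑ j, ‖pderiv j φ x‖ := by
    have hb := fun i j => abs_le.1 (abs_pderiv_coord_le hφ i j x)
    have h0 : |curl φ x 0| ≤ ‖pderiv 1 φ x‖ + ‖pderiv 2 φ x‖ := by
      rw [curl_apply_zero, abs_le]
      constructor <;> linarith [hb 2 1, hb 1 2]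
    have h1 : |curl φ x 1| ≤ ‖pderiv 2 φ x‖ + ‖pderiv 0 φ x‖ := by
      rw [curl_apply_one, abs_le]
      constructor <;> linarith [hb 0 2, hb 2 0]
    have h2 : |curl φ x 2| ≤ ‖pderiv 0 φ x‖ + ‖pderiv 1 φ x‖ := by
      rw [curl_apply_two, abs_le]
      constructor <;> linarith [hb 1 0, hb 0 1]
    have h3 : ‖curl φ x‖ ≤ |curl φ x 0| + |curl φ x 1| + |curl φ x 2| := by
      rw [EuclideanSpace.norm_eq, Fin.sum_univ_three]
      refine Real.sqrt_le_iff.2 ⟨by positivity, ?_⟩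
      simp only [Real.norm_eq_abs]
      nlinarith [abs_nonneg (curl φ x 0), abs_nonneg (curl φ x 1), abs_nonneg (curl φ x 2),
        mul_nonneg (abs_nonneg (curl φ x 0)) (abs_nonneg (curl φ x 1)),
        mul_nonneg (abs_nonneg (curl φ x 0)) (abs_nonneg (curl φ x 2)),
        mul_nonneg (abs_nonneg (curl φ x 1)) (abs_nonneg (curl φ x 2))]
    rw [Fin.sum_univ_three]
    linarith
  have := ENNReal.ofReal_le_ofReal h
  rwa [ofReal_norm, ENNReal.ofReal_mul (by norm_num), ENNReal.ofReal_sum_of_nonneg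
    (fun _ _ => norm_nonneg _), show ENNReal.ofReal 2 = 2 by norm_num,
    Finset.sum_congr rfl fun j _ => ofReal_norm (pderiv j φ x)] at this

theorem IsWeakCurl.eLpNorm_le_weakPartial {u w : T3 → E3} (hc : IsWeakCurl u w)
    {g : Fin 3 → T3 → E3} (hg : ∀ j, IsWeakPartial j u (g j)) {r : ℝ} (hr : 1 ≤ r) :
    eLpNorm w (ENNReal.ofReal r) volume ≤ 2 * ∑ j, eLpNorm (g j) (ENNReal.ofReal r) volume := by
  refine eLpNorm_le_of_mollify_le hc.2.1 fun ε hε => ?_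
  have hk := isTestKernel_eta hε
  have hU := smoothOnTorus_mollify_eta hε hc.1
  rw [← hc.curl_mollify hk]
  have hm : ∀ j, AEStronglyMeasurable (fun x => ‖pderiv j (mollify (eta ε) u) x‖) := fun j =>
    (hU.pderiv j).continuous.norm.aestronglyMeasurable
  calc eLpNorm (EulerTorus.curl (mollify (eta ε) u)) (ENNReal.ofReal r) volume
      ≤ eLpNorm ((2 : ℝ) • ∑ j, fun x => ‖pderiv j (mollify (eta ε) u) x‖)
          (ENNReal.ofReal r) volume := by
        refine eLpNorm_mono_enorm fun x => (enorm_curl_le hU x).trans_eq ?_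
        rw [Pi.smul_apply, Finset.sum_apply, enorm_smul, Real.enorm_of_nonneg (by norm_num),
          Real.enorm_of_nonneg (Finset.sum_nonneg fun _ _ => norm_nonneg _),
          ENNReal.ofReal_sum_of_nonneg fun _ _ => norm_nonneg _,
          Finset.sum_congr rfl fun j _ => ofReal_norm (pderiv j (mollify (eta ε) u) x)]
        norm_num
    _ ≤ 2 * ∑ j, eLpNorm (pderiv j (mollify (eta ε) u)) (ENNReal.ofReal r) volume := by
        rw [eLpNorm_const_smul, Real.enorm_of_nonneg (by norm_num)]
        refine mul_le_mul' (by norm_num) ((eLpNorm_sum_le (fun j _ => hm j)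
          (one_le_ofReal hr)).trans_eq ?_)
        simp_rw [eLpNorm_norm]
    _ ≤ _ := by
        gcongr with j
        rw [(hg j).pderiv_mollify hk]
        exact eLpNorm_mollify_eta_le (hg j).2.1.1 hε hr

theorem eLpNorm_le_rpow_mul_rpow {α F : Type*} [MeasurableSpace α] {μ : Measure α}
    [NormedAddCommGroup F] {f : α → F} (hf : AEStronglyMeasurable f μ) {p q s a b : ℝ}
    (hp : 0 < p) (hq : 0 < q) (hs : 0 < s) (ha : 0 ≤ a) (hb : 0 ≤ b) (hab : a + b = 1)
    (hs' : s⁻¹ = a / p + b / q) : eLpNorm f (ENNReal.ofReal s) μ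
      ≤ eLpNorm f (ENNReal.ofReal p) μ ^ a * eLpNorm f (ENNReal.ofReal q) μ ^ b := by
  have h := lintegral_prod_rpow_le_prod_eLpNorm (μ := μ) Finset.univ
    (f := fun (_ : Fin 2) x => ‖f x‖ₑ) (w := ![s * a, s * b])
    (p := ![ENNReal.ofReal p, ENNReal.ofReal q]) (fun _ _ => hf.enorm)
    (by intro i _; fin_cases i <;> simp <;> positivity)
    (by intro i _; fin_cases i <;> simpa)
    (by
      simp only [Fin.sum_univ_two, Matrix.cons_val_zero, Matrix.cons_val_one]
      rw [← ENNReal.ofReal_div_of_pos hp, ← ENNReal.ofReal_div_of_pos hq,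
        ← ENNReal.ofReal_add (by positivity) (by positivity), mul_div_assoc, mul_div_assoc,
        ← mul_add, ← hs', mul_inv_cancel₀ hs.ne', ENNReal.ofReal_one])
  simp only [Fin.prod_univ_two, Matrix.cons_val_zero, Matrix.cons_val_one, eLpNorm_enorm] at h
  rw [eLpNorm_ofReal hs]
  have e : ∀ x, ‖f x‖ₑ ^ (s * a) * ‖f x‖ₑ ^ (s * b) = ‖f x‖ₑ ^ s := fun x => by
    rw [← ENNReal.rpow_add_of_nonneg _ _ (by positivity) (by positivity), ← mul_add, hab, mul_one]
  simp_rw [e] at h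
  refine (ENNReal.rpow_le_rpow h (by positivity)).trans_eq ?_
  rw [ENNReal.mul_rpow_of_nonneg _ _ (by positivity), ← ENNReal.rpow_mul, ← ENNReal.rpow_mul]
  congr 2 <;> field_simp

theorem exists_eLpNorm_le_one_add_rpow {p : ℝ} (hp2 : 2 < p) (hp3 : p ≤ 3) {M : ℝ≥0∞}
    (hM : M ≠ ⊤) : ∃ C : ℝ≥0∞, C ≠ ⊤ ∧ ∀ (u : T3 → E3) (g : Fin 3 → T3 → E3),
      (∀ j, IsWeakPartial j u (g j)) → eLpNorm u (ENNReal.ofReal 3) volume ≤ M →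
      eLpNorm u (ENNReal.ofReal (3 * p / (7 - 2 * p))) volume
        ≤ C * (1 + ∑ j, eLpNorm (g j) (ENNReal.ofReal (6 * p / (5 * p - 7))) volume) ^ (p - 2) := by
  have hp0 : 0 < p := by linarith
  have h72 : 0 < 7 - 2 * p := by linarith
  have h57 : 0 < 5 * p - 7 := by linarith
  rcases le_or_gt (3 * p) 7 with h7 | h7
  · refine ⟨M, hM, fun u g hg hu => ?_⟩
    have h1 : eLpNorm u (ENNReal.ofReal (3 * p / (7 - 2 * p))) volume ≤ M := by
      refine (eLpNorm_le_eLpNorm_of_exponent_le (ENNReal.ofReal_le_ofReal ?_) (hg 0).1.1).trans hu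
      rw [div_le_iff₀ h72]
      linarith
    calc _ ≤ M * 1 := by rwa [mul_one]
      _ ≤ _ := by
        gcongr
        exact ENNReal.one_le_rpow le_self_add (by linarith)
  · set r : ℝ := 6 * p / (5 * p - 7) with hr
    set q : ℝ := 6 * p / (3 * p - 7) with hq
    set b : ℝ := (6 * p - 14) / (7 - p) with hb
    have h37 : 0 < 3 * p - 7 := by linarith
    have h7p : 0 < 7 - p := by linarith
    have hb0 : 0 ≤ b := div_nonneg (by linarith) h7p.le
    have hb1 : b ≤ 1 := by rw [hb, div_le_one h7p]; linarith
    have hbp : b ≤ p - 2 := by rw [hb, div_le_iff₀ h7p]; nlinarith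
    have hr1 : 1 ≤ r := by rw [hr, le_div_iff₀ h57]; linarith
    have hr3 : r ≤ 3 := by rw [hr, div_le_iff₀ h57]; linarith
    have hq0 : 0 < q := by positivity
    obtain ⟨C, hC, h⟩ := exists_eLpNorm_le_weakPartial hr1 hq0 (by
      rw [hq, hr]; field_simp; ring)
    have t1 : M ^ (1 - b) ≠ ⊤ := ENNReal.rpow_ne_top_of_nonneg (by linarith) hM
    have t2 : (C * (M + 1)) ^ b ≠ ⊤ := ENNReal.rpow_ne_top_of_nonneg hb0 (by finiteness)
    refine ⟨M ^ (1 - b) * (C * (M + 1)) ^ b, by finiteness, fun u g hg hu => ?_⟩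
    set N := ∑ j, eLpNorm (g j) (ENNReal.ofReal r) volume
    have h1 : eLpNorm u (ENNReal.ofReal q) volume ≤ C * (M + 1) * (1 + N) := by
      refine (h u g hg).trans ?_
      rw [mul_assoc]
      gcongr
      calc eLpNorm u (ENNReal.ofReal r) volume + N ≤ M + N := by
            gcongr
            exact (eLpNorm_le_eLpNorm_of_exponent_le (ENNReal.ofReal_le_ofReal hr3)
              (hg 0).1.1).trans hu
        _ ≤ M + N + (M * N + 1) := le_self_add
        _ = (M + 1) * (1 + N) := by ring
    refine (eLpNorm_le_rpow_mul_rpow (hg 0).1.1 three_pos hq0 (by positivity)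
      (sub_nonneg.2 hb1) hb0 (by ring) ?_).trans ?_
    · rw [hq, hb]
      field_simp
      ring
    calc _ ≤ M ^ (1 - b) * (C * (M + 1) * (1 + N)) ^ b := by gcongr
      _ = M ^ (1 - b) * (C * (M + 1)) ^ b * (1 + N) ^ b := by
        rw [ENNReal.mul_rpow_of_nonneg _ _ hb0, mul_assoc]
      _ ≤ _ := by
        gcongr
        exact le_self_add

theorem eLpNorm_mollifyTwice_sub_le {F : Type*} [NormedAddCommGroup F] [NormedSpace ℝ F]
    [CompleteSpace F] {f : T3 → F} (hf : Integrable f) {ε p : ℝ} (hε : 0 < ε) (hp : 1 ≤ p) :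
    eLpNorm (fun x => mollifyTwice ε f x - f x) (ENNReal.ofReal p) volume
      ≤ 2 * eLpNorm f (ENNReal.ofReal p) volume := by
  have hS := smoothOnTorus_mollify_eta hε hf
  refine (eLpNorm_sub_le (smoothOnTorus_mollifyTwice hε hf).integrable.1 hf.1
    (one_le_ofReal hp)).trans ?_
  rw [two_mul]
  gcongr
  exact (eLpNorm_mollify_eta_le hS.integrable.1 hε hp).trans (eLpNorm_mollify_eta_le hf.1 hε hp)

theorem lintegral_one_add_sum_rpow_ne_top {α : Type*} [MeasurableSpace α] {μ : Measure α}
    [IsFiniteMeasure μ] {N : Fin 3 → α → ℝ≥0∞} (hm : ∀ j, AEMeasurable (N j) μ) {p : ℝ}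
    (hp : 1 ≤ p) (h : ∀ j, eLpNorm (N j) (ENNReal.ofReal p) μ < ⊤) :
    ∫⁻ t, (1 + ∑ j, N j t) ^ p ∂μ ≠ ⊤ := by
  have hp0 : 0 < p := by linarith
  have h1 : eLpNorm ((fun _ => (1 : ℝ≥0∞)) + ∑ j, N j) (ENNReal.ofReal p) μ < ⊤ := by
    refine (eLpNorm_add_le aestronglyMeasurable_const
      (Finset.aestronglyMeasurable_sum _ fun j _ => (hm j).aestronglyMeasurable)
      (one_le_ofReal hp)).trans_lt (ENNReal.add_lt_top.2 ⟨?_, ?_⟩)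
    · exact (memLp_const_enorm (by simp)).2
    · exact (eLpNorm_sum_le (fun j _ => (hm j).aestronglyMeasurable)
        (one_le_ofReal hp)).trans_lt (ENNReal.sum_lt_top.2 fun j _ => h j)
  rw [eLpNorm_ofReal hp0, ENNReal.rpow_lt_top_iff_of_pos (by positivity)] at h1
  simpa [Finset.sum_apply] using h1.ne

theorem tendsto_flux_of_grad {T : ℝ} (hT : 0 < T) {v ω : ℝ → T3 → E3} {P : ℝ → T3 → ℝ}
    (hv : IsWeakEulerSolution T v P) (hcurl : ∀ t ∈ Icc 0 T, IsWeakCurl (v t) (ω t))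
    (hω : ContinuousInLq T (3 / 2) ω) {p : ℝ} (hp2 : 2 < p) (hp3 : p ≤ 3)
    (h : GradMemLpLq T (ENNReal.ofReal p) (ENNReal.ofReal (6 * p / (5 * p - 7))) v) :
    Tendsto (fun ε => ∫⁻ t in Ioo 0 T, ‖flux ε v ω t‖ₑ) (𝓝[>] 0) (𝓝 0) := by
  have hp0 : 0 < p := by linarith
  have h72 : 0 < 7 - 2 * p := by linarith
  have h57 : 0 < 5 * p - 7 := by linarith
  obtain ⟨g, hg⟩ := h
  obtain ⟨M, hM, hMb⟩ := hv.exists_eLpNorm_three_bound hT hcurl hω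
  obtain ⟨C, hC, hCb⟩ := exists_eLpNorm_le_one_add_rpow hp2 hp3 hM
  set r : ℝ := 6 * p / (5 * p - 7) with hr
  set s : ℝ := 3 * p / (7 - 2 * p) with hs
  have hr1 : 1 ≤ r := by rw [hr, le_div_iff₀ h57]; linarith
  have hr0 : 0 < r := by positivity
  have hs0 : 0 < s := by positivity
  have hrs : s⁻¹ + r⁻¹ + r⁻¹ = 1 := by rw [hr, hs]; field_simp; ring
  set N : Fin 3 → ℝ → ℝ≥0∞ := fun j t => eLpNorm (g j t) (ENNReal.ofReal r) volume
  have hNm : ∀ j, AEMeasurable (N j) (volume.restrict (Ioo 0 T)) := fun j =>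
    aemeasurable_eLpNorm_section (hg j).2.1 _
  have hNfin := lintegral_one_add_sum_rpow_ne_top hNm (by linarith : 1 ≤ p) fun j => (hg j).2.2
  have hq : (1 : ℝ≥0∞) ≤ 3 / 2 := by
    rw [← ofReal_three_halves]; exact one_le_ofReal (by norm_num)
  have hpart : ∀ᵐ t ∂(volume.restrict (Ioo 0 T)), ∀ j, IsWeakPartial j (v t) (g j t) :=
    ae_all_iff.2 fun j => (hg j).1
  have hmem : ∀ t ∈ Ioo 0 T, MemLp (v t) (ENNReal.ofReal 3) volume := fun t ht =>
    ⟨(hv.memLp_two t (Ioo_subset_Icc_self ht)).1,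
      (hMb t (Ioo_subset_Icc_self ht)).trans_lt hM.lt_top⟩
  have key : ∀ t ∈ Ioo 0 T, ∀ ε : ℝ, 0 < ε → ‖flux ε v ω t‖ₑ
      ≤ 6 * (eLpNorm (v t) (ENNReal.ofReal s) volume * eLpNorm (ω t) (ENNReal.ofReal r) volume
        * eLpNorm (fun x => mollifyTwice ε (ω t) x - ω t x) (ENNReal.ofReal r) volume) := by
    intro t ht ε hε
    have ht' := Ioo_subset_Icc_self ht
    refine enorm_transport_mollifyTwice_le (hmem t ht) ?_ (hv.isWeakDivFree hT t ht') (hcurl t ht')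
      hr0 hs0 hrs hε
    rw [ofReal_three_halves]
    exact hω.1 t ht'
  have hbig : ∫⁻ t in Ioo 0 T, 48 * C * (1 + ∑ j, N j t) ^ p ≠ ⊤ := by
    rw [lintegral_const_mul' _ _ (by finiteness)]
    finiteness
  rw [← lintegral_zero (μ := volume.restrict (Ioo 0 T))]
  refine tendsto_lintegral_filter_of_dominated_convergence'
    (fun t => 48 * C * (1 + ∑ j, N j t) ^ p) ?_ ?_ hbig ?_
  · filter_upwards [Ioc_mem_nhdsGT (show (0 : ℝ) < 1 / 2 by norm_num)] with ε hε
    have := hv.intervalIntegrable_flux hT hq hω hε.1 hε.2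
    rw [intervalIntegrable_iff_integrableOn_Ioo_of_le hT.le] at this
    exact this.1.enorm
  · filter_upwards [self_mem_nhdsWithin] with ε hε
    filter_upwards [hpart, ae_restrict_mem measurableSet_Ioo] with t htp ht
    have ht' := Ioo_subset_Icc_self ht
    have hw := (hcurl t ht').eLpNorm_le_weakPartial htp hr1
    have hu := hCb _ _ htp (hMb t ht')
    have hS := eLpNorm_mollifyTwice_sub_le (hcurl t ht').2.1 hε hr1
    set S := ∑ j, N j t with hSdef
    have hS1 : S ≤ 1 + S := le_add_self
    calc ‖flux ε v ω t‖ₑ ≤ 6 * ((C * (1 + S) ^ (p - 2)) * (2 * S) * (2 * (2 * S))) := by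
          refine (key t ht ε hε).trans ?_
          gcongr
          exact hS.trans (by gcongr)
      _ = 48 * C * (S * S * (1 + S) ^ (p - 2)) := by ring
      _ ≤ 48 * C * ((1 + S) * (1 + S) * (1 + S) ^ (p - 2)) := by gcongr
      _ = _ := by
          rw [← sq, ← ENNReal.rpow_two, ← ENNReal.rpow_add_of_nonneg _ _ (by norm_num)
            (by linarith)]
          congr 2; ring
  · have hfin := ae_lt_top' ((hNm 0).add ((hNm 1).add (hNm 2)) |>.const_add 1 |>.pow_const p) (by
      simpa [Fin.sum_univ_three, add_assoc] using hNfin)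
    filter_upwards [hpart, hfin, ae_restrict_mem measurableSet_Ioo] with t htp htf ht
    have ht' := Ioo_subset_Icc_self ht
    rw [ENNReal.rpow_lt_top_iff_of_pos hp0] at htf
    have hsum : ∑ j, N j t ≠ ⊤ := by
      rw [Fin.sum_univ_three, add_assoc]
      exact (le_add_self.trans_lt htf).ne
    have hw : eLpNorm (ω t) (ENNReal.ofReal r) volume ≠ ⊤ :=
      (((hcurl t ht').eLpNorm_le_weakPartial htp hr1).trans_lt
        (ENNReal.mul_lt_top (by norm_num) hsum.lt_top)).ne
    have hu : eLpNorm (v t) (ENNReal.ofReal s) volume ≠ ⊤ := by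
      refine ((hCb _ _ htp (hMb t ht')).trans_lt (ENNReal.mul_lt_top hC.lt_top ?_)).ne
      exact (ENNReal.rpow_ne_top_of_nonneg (by linarith)
        (ENNReal.add_ne_top.2 ⟨by norm_num, hsum⟩)).lt_top
    have h1 := tendsto_eLpNorm_mollifyTwice_sub hr1 ⟨(hcurl t ht').2.1.1, hw.lt_top⟩
    have h2 := ENNReal.Tendsto.const_mul (a := (6 : ℝ≥0∞)) (ENNReal.Tendsto.const_mul
      (a := eLpNorm (v t) (ENNReal.ofReal s) volume * eLpNorm (ω t) (ENNReal.ofReal r) volume) h1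
      (Or.inr (ENNReal.mul_ne_top hu hw))) (Or.inr (by norm_num))
    rw [mul_zero, mul_zero] at h2
    have h3 : Tendsto (fun ε => ‖flux ε v ω t‖ₑ) (𝓝[>] 0) (𝓝 0) := by
      refine tendsto_of_tendsto_of_tendsto_of_le_of_le' tendsto_const_nhds h2
        (Eventually.of_forall fun _ => zero_le) ?_
      filter_upwards [self_mem_nhdsWithin] with ε hε using key t ht ε hε
    exact h3

theorem tendsto_flux_of_besovC_of_besovInfty {T : ℝ} (hT : 0 < T) {v ω : ℝ → T3 → E3}
    {P : ℝ → T3 → ℝ} (hv : IsWeakEulerSolution T v P)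
    (hcurl : ∀ t ∈ Icc 0 T, IsWeakCurl (v t) (ω t)) {θ α β : ℝ} {k l p q : ℝ≥0∞}
    (hθ0 : 0 < θ) (hθ2 : θ ≤ 2) (hα : 0 < α) (hβ : 0 < β) (hk : 1 ≤ k) (hl : 1 ≤ l) (hp : 1 ≤ p)
    (hq : 1 ≤ q) (hkp : ENNReal.ofReal θ / k + 1 / p = 1)
    (hlq : ENNReal.ofReal θ / l + 1 / q = ENNReal.ofReal θ / 2) (hαβ : 1 ≤ θ * α + β)
    (h : MemLpBesovC T k α l v ∧ MemLpBesovInfty T p β q ω ∨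
      MemLpBesovInfty T k α l v ∧ MemLpBesovC T p β q ω) :
    Tendsto (fun ε => ∫⁻ t in Ioo 0 T, ‖flux ε v ω t‖ₑ) (𝓝[>] 0) (𝓝 0) := by
  have hm : AEStronglyMeasurable (fun z : ℝ × T3 => v z.1 z.2)
        ((volume.restrict (Ioo 0 T)).prod volume) ∧
      AEStronglyMeasurable (fun z : ℝ × T3 => ω z.1 z.2)
        ((volume.restrict (Ioo 0 T)).prod volume) := by
    rcases h with h | h <;> exact ⟨h.1.1.1, h.2.1.1⟩
  obtain ⟨C, hC, hb⟩ := hv.exists_lintegral_flux_le_incrNorm hT hcurl hθ0 hθ2 hk hl hp hq hkp hlq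
    hm.1 hm.2
  refine tendsto_flux_of_besov hθ0 hαβ hC hb fun c hc => ?_
  rcases h with ⟨h1, h2⟩ | ⟨h1, h2⟩
  · obtain ⟨N, hN, hNb⟩ := h2.exists_le hβ
    obtain ⟨δ, hδ, hδc⟩ := exists_pos_rpow_mul_le hθ0 hN hc
    refine ⟨δ, N, hδc, ?_⟩
    filter_upwards [h1.eventually_le hα hδ] with ε hε using ⟨hε, hNb ε⟩
  · obtain ⟨N, hN, hNb⟩ := h1.exists_le hα
    obtain ⟨δ, hδ, hδc⟩ := exists_pos_rpow_mul_le one_pos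
      (ENNReal.rpow_ne_top_of_nonneg hθ0.le hN) hc
    refine ⟨N, δ, by rwa [ENNReal.rpow_one, mul_comm] at hδc, ?_⟩
    filter_upwards [h2.eventually_le hβ hδ] with ε hε using ⟨hNb ε, hε⟩

end EulerTorus

end

theorem theorem1p4 (T : ℝ) (hT : 0 < T)
    (v : ℝ → EulerTorus.T3 → EulerTorus.E3) (P : ℝ → EulerTorus.T3 → ℝ)
    (hv : EulerTorus.IsWeakEulerSolution T v P)
    (ω : ℝ → EulerTorus.T3 → EulerTorus.E3)
    (hcurl : ∀ t ∈ Icc 0 T, EulerTorus.IsWeakCurl (v t) (ω t))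
    (hω : EulerTorus.ContinuousInLq T (3 / 2) ω)
    (hcond :
      (∃ p : ℝ, 2 < p ∧ p ≤ 3 ∧
        EulerTorus.MemLpBesovC T (ENNReal.ofReal p) (2 / p)
          (ENNReal.ofReal (2 * p / (p - 1))) v) ∨
      (∃ p : ℝ, 2 < p ∧ p ≤ 3 ∧
        EulerTorus.MemLpBesovVMO T p (2 / p) (2 * p / (p - 1)) v) ∨
      (∃ p : ℝ, 2 < p ∧ p ≤ 3 ∧
        EulerTorus.GradMemLpLq T (ENNReal.ofReal p)
          (ENNReal.ofReal (6 * p / (5 * p - 7))) v) ∨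
      (∃ (θ α β : ℝ) (k l p q : ℝ≥0∞),
        0 < θ ∧ θ ≤ 2 ∧ 0 < α ∧ α < 1 ∧ 0 < β ∧ β < 1 ∧
        1 ≤ k ∧ 1 ≤ l ∧ 1 ≤ p ∧ 1 ≤ q ∧
        ENNReal.ofReal θ / k + 1 / p = 1 ∧
        ENNReal.ofReal θ / l + 1 / q = ENNReal.ofReal θ / 2 ∧
        1 ≤ θ * α + β ∧
        EulerTorus.MemLpBesovC T k α l v ∧ EulerTorus.MemLpBesovInfty T p β q ω) ∨
      (∃ (θ α β : ℝ) (k l p q : ℝ≥0∞),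
        0 < θ ∧ θ ≤ 2 ∧ 0 < α ∧ α < 1 ∧ 0 < β ∧ β < 1 ∧
        1 ≤ k ∧ 1 ≤ l ∧ 1 ≤ p ∧ 1 ≤ q ∧
        ENNReal.ofReal θ / k + 1 / p = 1 ∧
        ENNReal.ofReal θ / l + 1 / q = ENNReal.ofReal θ / 2 ∧
        1 ≤ θ * α + β ∧
        EulerTorus.MemLpBesovInfty T k α l v ∧ EulerTorus.MemLpBesovC T p β q ω)) :
    ∀ t ∈ Icc 0 T,
      Integrable (fun x => (inner ℝ (ω t x) (v t x) : ℝ)) ∧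
        ∫ x, (inner ℝ (ω t x) (v t x) : ℝ) = ∫ x, (inner ℝ (ω 0 x) (v 0 x) : ℝ) := by
  have hv3 : ∀ t ∈ Icc 0 T, MemLp (v t) (ENNReal.ofReal 3) volume := by
    obtain ⟨M, hM, hMb⟩ := hv.exists_eLpNorm_three_bound hT hcurl hω
    exact fun t ht => ⟨(hv.memLp_two t ht).1, (hMb t ht).trans_lt hM.lt_top⟩
  refine EulerTorus.helicity_eq_of_tendsto_flux hT hv hcurl hω hv3 ?_
  rcases hcond with ⟨p, hp2, hp3, h⟩ | ⟨p, hp2, hp3, h⟩ | ⟨p, hp2, hp3, h⟩ |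
    ⟨θ, α, β, k, l, p, q, hθ0, hθ2, hα, -, hβ, -, hk, hl, hp, hq, hkp, hlq, hαβ, h⟩ |
    ⟨θ, α, β, k, l, p, q, hθ0, hθ2, hα, -, hβ, -, hk, hl, hp, hq, hkp, hlq, hαβ, h⟩
  · exact EulerTorus.tendsto_flux_of_velocity hT hv hcurl hω hp2 hp3 fun δ hδ =>
      EulerTorus.eventually_velocity_of_besovC hp2 h hδ
  · refine EulerTorus.tendsto_flux_of_velocity hT hv hcurl hω hp2 hp3 fun δ hδ =>
      EulerTorus.eventually_velocity_of_besovVMO hp2 ?_ h hδ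
    rw [le_div_iff₀ (by linarith)]
    linarith
  · exact EulerTorus.tendsto_flux_of_grad hT hv hcurl hω hp2 hp3 h
  · exact EulerTorus.tendsto_flux_of_besovC_of_besovInfty hT hv hcurl hθ0 hθ2 hα hβ hk hl hp hq hkp
      hlq hαβ (Or.inl h)
  · exact EulerTorus.tendsto_flux_of_besovC_of_besovInfty hT hv hcurl hθ0 hθ2 hα hβ hk hl hp hq hkp
      hlq hαβ (Or.inr h)
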